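/- Let $0<\alpha<1$, $d_1,d_2,d_\alpha>0$, $a<b$ and $T>0$. Consider the Riesz space-fractional turbulent diffusion equation $$\frac{\partial u}{\partial t}=-d_1\frac{\partial u}{\partial x}+d_2\frac{\partial^2u}{\partial x^2}+d_\alpha\frac{\partial^\alpha u}{\partial|x|^\alpha}+s(x,t),\qquad a<x<b,\ 0<t<T,$$ with $u(x,0)=\varphi(x)$ for $x\in[a,b]$ and $u(a,t)=u(b,t)=0$ for $t\in[0,T]$, where $$\frac{\partial^\alpha f(x)}{\partial|x|^\alpha}=-\frac{1}{2\cos(\pi\alpha/2)\,\Gamma(1-\alpha)}\left(\frac{d}{dx}\int_a^x\frac{f(\xi)}{(x-\xi)^{\alpha}}\,d\xi-\frac{d}{dx}\int_x^b\frac{f(\xi)}{(\xi-x)^{\alpha}}\,d\xi\right).$$ For integers $M,N\ge1$ put $h=(b-a)/M$, $\tau=T/N$, $x_j=a+jh$, $t_k=k\tau$, $t_{k+1/2}=(k+\frac12)\tau$. Let $\varpi_\ell$ be defined by the Taylor expansion $\left(\frac32-2z+\frac12z^2\right)^\alpha=\sum_{\ell\ge0}\varpi_\ell z^\ell$ at $z=0$,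 and put $\nu=\frac{d_\alpha}{2\cos(\pi\alpha/2)h^\alpha}$. The scheme is, for $1\le j\le M-1$ and $0\le k\le N-1$, $$\begin{aligned}&\Big(\tfrac{d_2}{h^2}+\tfrac{d_1}{2h}\Big)U_{j-1}^{k+1}-\Big(\tfrac2\tau+\tfrac{2d_2}{h^2}\Big)U_j^{k+1}+\Big(\tfrac{d_2}{h^2}-\tfrac{d_1}{2h}\Big)U_{j+1}^{k+1}-\nu\Big[\sum_{\ell=0}^{j}\varpi_\ell U_{j-\ell}^{k+1}+\sum_{\ell=0}^{M-j}\varpi_\ell U_{j+\ell}^{k+1}\Big]\\&=-\Big(\tfrac{d_2}{h^2}+\tfrac{d_1}{2h}\Big)U_{j-1}^{k}-\Big(\tfrac2\tau-\tfrac{2d_2}{h^2}\Big)U_j^{k}-\Big(\tfrac{d_2}{h^2}-\tfrac{d_1}{2h}\Big)U_{j+1}^{k}+\nu\Big[\sum_{\ell=0}^{j}\varpi_\ell U_{j-\ell}^{k}+\sum_{\ell=0}^{M-j}\varpi_\ell U_{j+\ell}^{k}\Big]-2s_j^{k+\frac12},\end{aligned}$$ with $U_0^k=U_M^k=0$ for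 $0\le k\le N$ and prescribed $U_j^0$ for $1\le j\le M-1$. Write $\|w\|_h=\big(h\sum_{j=1}^{M-1}|w_j|^2\big)^{1/2}$. **Unconditional stability.** 1. For all $h,\tau>0$ and every $\theta\in[-\pi,\pi]$ there is exactly one $\xi\in\mathbb C$ such that $E_j^k=\xi^ke^{ij\theta}$ ($j\in\mathbb Z$, $k\ge0$) solves the error equation, that is, the scheme without source on the grid $\mathbb Z$, with $\sum_{\ell=0}^{j}$ and $\sum_{\ell=0}^{M-j}$ replaced by (convergent) series $\sum_{\ell=0}^{\infty}$; and $|\xi|\le1$. 2. For all $M,N\ge1$ the scheme has exactly one solution for arbitrary initial values $U_j^0$ and source values $s_j^{k+1/2}$, and any two solutions $U,V$ with the same source values satisfy $\|V^k-U^k\|_h\le\|V^0-U^0\|_h$ for $0\le k\le N$. **Convergence.** Let $u$ be a solution of the initial-boundary value problem that is of class $C^4$ on $[a,b]\times[0,T]$ and satisfies $u_x(a,t)=u_x(b,t)=0$ for all $t\in[0,T]$. Then there is a constant $C$, independent of $M$ and $N$, such that for all $M,N\ge1$ the solution $U$ of the scheme with $U_j^0=\varphi(x_j)$ and $s_j^{k+1/2}=s(x_j,t_{k+1/2})$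 satisfies $$\|u(x_\cdot,t_k)-U^k\|_h\le C(\tau^2+h^2),\qquad 0\le k\le N.$$ -/

import Mathlib

namespace TurbulentDiffusion

/-- Generating function `W₂(z) = (3/2 - 2 z + z²/2)^α` of the second-order convolution weights. -/
noncomputable def genW2 (α z : ℝ) : ℝ := (3 / 2 - 2 * z + z ^ 2 / 2) ^ α

/-- The second-order convolution weight `ϖ_{2,ℓ}^{(α)}`: the `ℓ`-th Taylor coefficient at `0` of the
generating function. -/
noncomputable def weight2 (α : ℝ) (l : ℕ) : ℝ :=
  iteratedDeriv l (genW2 α) 0 / (Nat.factorial l : ℝ)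

/-- Left Riemann–Liouville derivative of order `α ∈ (0,1)` with base point `a`. -/
noncomputable def rlLeft (α a : ℝ) (f : ℝ → ℝ) (x : ℝ) : ℝ :=
  1 / Real.Gamma (1 - α) * deriv (fun y : ℝ => ∫ ξ in a..y, (y - ξ) ^ (-α) * f ξ) x

/-- Right Riemann–Liouville derivative of order `α ∈ (0,1)` with base point `b`. -/
noncomputable def rlRight (α b : ℝ) (f : ℝ → ℝ) (x : ℝ) : ℝ :=
  (-1) / Real.Gamma (1 - α) * deriv (fun y : ℝ => ∫ ξ in y..b, (ξ - y) ^ (-α) * f ξ) x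

/-- Riesz derivative of order `α ∈ (0,1)` on `(a,b)`. -/
noncomputable def riesz (α a b : ℝ) (f : ℝ → ℝ) (x : ℝ) : ℝ :=
  -(1 / (2 * Real.cos (Real.pi * α / 2))) * (rlLeft α a f x + rlRight α b f x)

/-- `u x t` solves, on `[a,b] × [0,T]`, the Riesz space-fractional turbulent diffusion equation
`u_t = -d₁ u_x + d₂ u_xx + d_α ∂^α u / ∂|x|^α + s` with initial value `φ` and homogeneous boundary
values. -/
structure IsSolution (α d1 d2 dα a b T : ℝ) (φ : ℝ → ℝ) (s u : ℝ → ℝ → ℝ) : Prop where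
  equation : ∀ x ∈ Set.Ioo a b, ∀ t ∈ Set.Ioo 0 T,
    deriv (fun r => u x r) t =
      -d1 * deriv (fun y => u y t) x + d2 * iteratedDeriv 2 (fun y => u y t) x
        + dα * riesz α a b (fun y => u y t) x + s x t
  initial : ∀ x ∈ Set.Icc a b, u x 0 = φ x
  boundary_left : ∀ t ∈ Set.Icc 0 T, u a t = 0
  boundary_right : ∀ t ∈ Set.Icc 0 T, u b t = 0

/-- The coefficient `ν = d_α / (2 cos(πα/2) h^α)`. -/
noncomputable def nu (α dα h : ℝ) : ℝ := dα / (2 * Real.cos (Real.pi * α / 2) * h ^ α)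

/-- The truncated Riesz sums
`∑_{ℓ=0}^{j} ϖ_{2,ℓ} w_{j-ℓ} + ∑_{ℓ=0}^{M-j} ϖ_{2,ℓ} w_{j+ℓ}` of a grid function `w`. -/
noncomputable def rieszSum (α : ℝ) (M : ℕ) (w : ℕ → ℝ) (j : ℕ) : ℝ :=
  ∑ l ∈ Finset.range (j + 1), weight2 α l * w (j - l)
    + ∑ l ∈ Finset.range (M - j + 1), weight2 α l * w (j + l)

/-- The grid function `U k j` (time level `k ≤ N`, space index `j ≤ M`) is a solution of the
Crank–Nicolson scheme with space step `h` and time step `τ`, with initial values `v j` at the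
interior nodes, zero boundary values, and source values `σ k j` (the source at the node `j` and the
half time level `k + 1/2`). -/
structure IsSchemeSolution (α d1 d2 dα h τ : ℝ) (M N : ℕ) (v : ℕ → ℝ) (σ : ℕ → ℕ → ℝ)
    (U : ℕ → ℕ → ℝ) : Prop where
  initial : ∀ j, 0 < j → j < M → U 0 j = v j
  boundary_left : ∀ k, k ≤ N → U k 0 = 0
  boundary_right : ∀ k, k ≤ N → U k M = 0
  step : ∀ k, k < N → ∀ j, 0 < j → j < M →
    (d2 / h ^ 2 + d1 / (2 * h)) * U (k + 1) (j - 1)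
        - (2 / τ + 2 * d2 / h ^ 2) * U (k + 1) j
        + (d2 / h ^ 2 - d1 / (2 * h)) * U (k + 1) (j + 1)
        - nu α dα h * rieszSum α M (U (k + 1)) j
      = -(d2 / h ^ 2 + d1 / (2 * h)) * U k (j - 1)
        - (2 / τ - 2 * d2 / h ^ 2) * U k j
        - (d2 / h ^ 2 - d1 / (2 * h)) * U k (j + 1)
        + nu α dα h * rieszSum α M (U k) j
        - 2 * σ k j

/-- Discrete `L²` norm `(h ∑_{j=1}^{M-1} |w_j|²)^{1/2}`. -/
noncomputable def discreteL2 (h : ℝ) (M : ℕ) (w : ℕ → ℝ) : ℝ :=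
  Real.sqrt (h * ∑ j ∈ Finset.Ioo 0 M, w j ^ 2)

/-- The full Riesz sums `∑_{ℓ≥0} ϖ_{2,ℓ} w_{j-ℓ} + ∑_{ℓ≥0} ϖ_{2,ℓ} w_{j+ℓ}` of a grid function on
the whole line. -/
noncomputable def rieszSeries (α : ℝ) (w : ℤ → ℂ) (j : ℤ) : ℂ :=
  ∑' l : ℕ, (weight2 α l : ℂ) * w (j - l) + ∑' l : ℕ, (weight2 α l : ℂ) * w (j + l)

/-- `E k j` solves the error equation of the scheme on the infinite grid `ℤ`: the homogeneous
scheme for the functions extended to the whole line, all the series involved being convergent. -/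
structure IsErrorSolution (α d1 d2 dα h τ : ℝ) (E : ℕ → ℤ → ℂ) : Prop where
  summable_left : ∀ k j, Summable fun l : ℕ => (weight2 α l : ℂ) * E k (j - l)
  summable_right : ∀ k j, Summable fun l : ℕ => (weight2 α l : ℂ) * E k (j + l)
  step : ∀ (k : ℕ) (j : ℤ),
    ((d2 / h ^ 2 + d1 / (2 * h) : ℝ) : ℂ) * E (k + 1) (j - 1)
        - ((2 / τ + 2 * d2 / h ^ 2 : ℝ) : ℂ) * E (k + 1) j
        + ((d2 / h ^ 2 - d1 / (2 * h) : ℝ) : ℂ) * E (k + 1) (j + 1)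
        - (nu α dα h : ℂ) * rieszSeries α (E (k + 1)) j
      = -((d2 / h ^ 2 + d1 / (2 * h) : ℝ) : ℂ) * E k (j - 1)
        - ((2 / τ - 2 * d2 / h ^ 2 : ℝ) : ℂ) * E k j
        - ((d2 / h ^ 2 - d1 / (2 * h) : ℝ) : ℂ) * E k (j + 1)
        + (nu α dα h : ℂ) * rieszSeries α (E k) j

/-- `ξ` is an amplification factor at the phase angle `θ`: the Fourier mode
`E_j^k = ξ^k e^{ijθ}` solves the error equation. -/
def IsAmplificationFactor (α d1 d2 dα h τ θ : ℝ) (ξ : ℂ) : Prop :=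
  IsErrorSolution α d1 d2 dα h τ fun k j => ξ ^ k * Complex.exp (Complex.I * j * θ)

/-- Von Neumann stability for the steps `h`, `τ`: at every phase angle there is exactly one
amplification factor, and its modulus is at most one. -/
def IsVonNeumannStable (α d1 d2 dα h τ : ℝ) : Prop :=
  ∀ θ ∈ Set.Icc (-Real.pi) Real.pi,
    ∃ ξ : ℂ, IsAmplificationFactor α d1 d2 dα h τ θ ξ ∧ ‖ξ‖ ≤ 1 ∧
      ∀ ζ : ℂ, IsAmplificationFactor α d1 d2 dα h τ θ ζ → ζ = ξ

/-- Unique solvability of the scheme for all initial values and all source values. -/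
def IsUniquelySolvable (α d1 d2 dα h τ : ℝ) (M N : ℕ) : Prop :=
  ∀ (v : ℕ → ℝ) (σ : ℕ → ℕ → ℝ), ∃ U : ℕ → ℕ → ℝ,
    IsSchemeSolution α d1 d2 dα h τ M N v σ U ∧
      ∀ V : ℕ → ℕ → ℝ, IsSchemeSolution α d1 d2 dα h τ M N v σ V →
        ∀ k ≤ N, ∀ j ≤ M, V k j = U k j

/-- Stability of the scheme in the discrete `L²` norm: a perturbation of the initial values is not
amplified at any time level. -/
def IsL2Stable (α d1 d2 dα h τ : ℝ) (M N : ℕ) : Prop :=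
  ∀ (v w : ℕ → ℝ) (σ : ℕ → ℕ → ℝ) (U V : ℕ → ℕ → ℝ),
    IsSchemeSolution α d1 d2 dα h τ M N v σ U →
    IsSchemeSolution α d1 d2 dα h τ M N w σ V →
      ∀ k ≤ N, discreteL2 h M (fun j => V k j - U k j) ≤ discreteL2 h M (fun j => w j - v j)

end TurbulentDiffusion

namespace TurbulentDiffusion

/-! Stability rests on one positivity fact. Since `3/2 - 2z + z²/2 = (3/2)(1 - z)(1 - z/3)` has
nonnegative real part in the unit disc, and so does each linear factor, the argument of the product
stays in `[-π/2, π/2]`; raising to the power `α < 1` only shrinks it. Hence `∑ ϖ_l cos(lθ) ≥ 0`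
(`tsum_weight2_mul_cos_nonneg`), and integrating this against `|∑ w_j e^{ijθ}|²` makes the Toeplitz
form of the weights nonnegative (`weight2_quadForm_nonneg`). The fractional part of the scheme
therefore dissipates for every step size, the centred drift is skew and the diffusion yields minus a
sum of squared differences (`sum_mul_spatialOp_le`). Von Neumann stability is then the fact that a
Cayley transform maps the left half plane into the unit disc; solvability is injectivity of a square
linear system; `L²` stability is `energy_estimate` with zero residual.

For consistency, a function with vanishing value and slope at `a` is a superposition of truncated
squares `(x - c)₊²`, so the quadrature needs to be examined on these alone. Three partial summations
turn the weights into coefficients of `(1 - z)^(α - 3)` times a function analytic beyond the unit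
circle; a Stirling-type estimate with the right centring (`abs_Gamma_mul_negBinom_sub_le`) gives an
error `O(h² s^(-α))` at distance `s` (`exists_abs_kernel_le`), and Taylor's formula with integral
remainder transfers it to smooth functions (`exists_quadrature_error`).

As `u_xx` need not vanish at the end points, the residual is only `O(τ² + h²)` times (distance to
the boundary)`^(-α)`. This weight is integrable, but not square integrable once `α ≥ 1/2`. So
`energy_estimate` takes the residual in the discrete `L¹` norm and pairs it with the maximum norm,
which the diffusion controls through `sq_le_mul_sum_sq_sub`. -/

open Finset Filter Topology

/-! ### Binomial coefficients and the convolution weights. -/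

/-- The `n`-th Taylor coefficient of `(1 - z)^(-β)`. -/
noncomputable def negBinom (β : ℝ) (n : ℕ) : ℝ := ∏ i ∈ range n, (β + i) / (i + 1)

lemma negBinom_zero (β : ℝ) : negBinom β 0 = 1 := by simp [negBinom]

lemma negBinom_succ (β : ℝ) (n : ℕ) :
    negBinom β (n + 1) = negBinom β n * ((β + n) / (n + 1)) := by
  rw [negBinom, prod_range_succ, negBinom]

lemma mul_negBinom_add_one (β : ℝ) (n : ℕ) :
    β * negBinom (β + 1) n = (β + n) * negBinom β n := by
  induction n with
  | zero => simp [negBinom_zero]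
  | succ n ih =>
    have hn : (n : ℝ) + 1 ≠ 0 := by positivity
    rw [negBinom_succ, negBinom_succ, ← mul_assoc, ih]
    push_cast
    field_simp
    ring

lemma negBinom_add_one_succ (β : ℝ) (n : ℕ) :
    negBinom (β + 1) (n + 1) = negBinom (β + 1) n + negBinom β (n + 1) := by
  have hn : (n : ℝ) + 1 ≠ 0 := by positivity
  have h := mul_negBinom_add_one β n
  rw [negBinom_succ, negBinom_succ]
  field_simp
  linarith

/-- Partial summation multiplies a generating function by `1/(1 - z)`, which raises the exponent `β`
by one. -/
lemma sum_negBinom (β : ℝ) (n : ℕ) :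
    ∑ i ∈ range (n + 1), negBinom β i = negBinom (β + 1) n := by
  induction n with
  | zero => simp [negBinom_zero]
  | succ n ih => rw [sum_range_succ, ih, negBinom_add_one_succ]

lemma negBinom_pos {β : ℝ} (hβ : 0 < β) (n : ℕ) : 0 < negBinom β n :=
  prod_pos fun i _ => by positivity

lemma negBinom_neg_succ_nonpos {α : ℝ} (h0 : 0 < α) (h1 : α < 1) (n : ℕ) :
    negBinom (-α) (n + 1) ≤ 0 := by
  induction n with
  | zero => rw [negBinom_succ, negBinom_zero]; norm_num; linarith
  | succ n ih =>
    rw [negBinom_succ]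
    refine mul_nonpos_of_nonpos_of_nonneg ih ?_
    push_cast
    have : (0 : ℝ) ≤ n := n.cast_nonneg
    exact div_nonneg (by linarith) (by linarith)

/-- All coefficients of `(1 - z)^α` after the leading `1` are nonpositive, while the partial sums,
being coefficients of `(1 - z)^(α - 1)`, are positive. So the negative terms have total mass at most
`1`. -/
lemma sum_abs_negBinom_le {α : ℝ} (h0 : 0 < α) (h1 : α < 1) (n : ℕ) :
    ∑ i ∈ range n, |negBinom (-α) i| ≤ 2 := by
  cases n with
  | zero => simp
  | succ n =>
    have h := sum_negBinom (-α) n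
    rw [sum_range_succ'] at h ⊢
    have hp : 0 < negBinom (-α + 1) n := negBinom_pos (by linarith) n
    have e : ∑ k ∈ range n, |negBinom (-α) (k + 1)| = -∑ k ∈ range n, negBinom (-α) (k + 1) := by
      rw [← sum_neg_distrib]
      exact sum_congr rfl fun k _ => abs_of_nonpos (negBinom_neg_succ_nonpos h0 h1 k)
    rw [e]
    rw [negBinom_zero] at h ⊢
    simp only [abs_one]
    linarith

lemma summable_abs_negBinom {α : ℝ} (h0 : 0 < α) (h1 : α < 1) :
    Summable fun i => |negBinom (-α) i| :=
  summable_of_sum_range_le (fun _ => abs_nonneg _) (sum_abs_negBinom_le h0 h1)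

lemma abs_negBinom_le_two {α : ℝ} (h0 : 0 < α) (h1 : α < 1) (n : ℕ) :
    |negBinom (-α) n| ≤ 2 :=
  (single_le_sum (f := fun i => |negBinom (-α) i|) (fun _ _ => abs_nonneg _)
    (self_mem_range_succ n)).trans (sum_abs_negBinom_le h0 h1 (n + 1))

lemma iteratedDeriv_one_sub_mul_rpow (c p : ℝ) (n : ℕ) (z : ℝ) (hz : c * z < 1) :
    iteratedDeriv n (fun z => (1 - c * z) ^ p) z
      = (∏ i ∈ range n, (c * (i - p))) * (1 - c * z) ^ (p - n) := by
  induction n generalizing z with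
  | zero => simp
  | succ n ih =>
    have hU : IsOpen {z : ℝ | c * z < 1} := isOpen_lt (by fun_prop) (by fun_prop)
    have he : iteratedDeriv n (fun z => (1 - c * z) ^ p) =ᶠ[𝓝 z]
        fun z => (∏ i ∈ range n, (c * (i - p))) * (1 - c * z) ^ (p - n) := by
      filter_upwards [hU.mem_nhds hz] with y hy using ih y hy
    have hd : HasDerivAt (fun z : ℝ => 1 - c * z) (-c) z := by
      simpa using ((hasDerivAt_id z).const_mul c).const_sub 1
    rw [iteratedDeriv_succ, he.deriv_eq,
      ((hd.rpow_const (p := p - n) (Or.inl (by linarith))).const_mul _).deriv, prod_range_succ]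
    push_cast
    rw [show p - (n + 1 : ℝ) = p - n - 1 by ring]
    ring

lemma taylorCoeff_one_sub_mul_rpow (c p : ℝ) (n : ℕ) :
    iteratedDeriv n (fun z => (1 - c * z) ^ p) 0 = n.factorial * (c ^ n * negBinom (-p) n) := by
  rw [iteratedDeriv_one_sub_mul_rpow c p n 0 (by simp)]
  simp only [mul_zero, sub_zero, Real.one_rpow, mul_one]
  induction n with
  | zero => simp [negBinom_zero]
  | succ n ih =>
    have hn : (n : ℝ) + 1 ≠ 0 := by positivity
    rw [prod_range_succ, ih, negBinom_succ, Nat.factorial_succ]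
    push_cast
    field_simp
    ring

/-- Rests on `3/2 - 2z + z²/2 = (3/2)(1 - z)(1 - z/3)`. Splitting the real power requires
nonnegative factors, hence only a neighbourhood of `0`. -/
lemma genW2_eventuallyEq (α : ℝ) :
    genW2 α =ᶠ[𝓝 0] fun z => (3 / 2 : ℝ) ^ α *
      ((fun z => (1 - 1 * z) ^ α) * (fun z => (1 - 1 / 3 * z) ^ α) : ℝ → ℝ) z := by
  filter_upwards [Iio_mem_nhds (show (0 : ℝ) < 1 by norm_num)] with z hz
  have hz : z < 1 := hz
  simp only [genW2, Pi.mul_apply]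
  rw [← Real.mul_rpow (by linarith) (by linarith), ← Real.mul_rpow (by norm_num)
    (mul_nonneg (by linarith) (by linarith))]
  congr 1
  ring

/-- Leibniz's rule for the factorization; the factorials cancel the binomial coefficient. -/
lemma weight2_eq_sum (α : ℝ) (n : ℕ) :
    weight2 α n = (3 / 2 : ℝ) ^ α * ∑ p ∈ antidiagonal n,
      negBinom (-α) p.1 * ((1 / 3 : ℝ) ^ p.2 * negBinom (-α) p.2) := by
  have hc : ∀ c : ℝ, ContDiffAt ℝ n (fun z : ℝ => (1 - c * z) ^ α) 0 := fun c =>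
    ContDiffAt.rpow_const_of_ne (by fun_prop) (by simp)
  rw [weight2, (genW2_eventuallyEq α).iteratedDeriv_eq, iteratedDeriv_const_mul_field,
    iteratedDeriv_mul (hc _) (hc _), mul_div_assoc, sum_div,
    Finset.Nat.sum_antidiagonal_eq_sum_range_succ_mk]
  congr 1
  refine sum_congr rfl fun i hi => ?_
  have hi : i ≤ n := by simpa [Nat.lt_succ_iff] using hi
  rw [taylorCoeff_one_sub_mul_rpow, taylorCoeff_one_sub_mul_rpow, one_pow]
  have h := Nat.choose_mul_factorial_mul_factorial hi
  have h' : ((n.choose i : ℝ) * i.factorial * (n - i).factorial) = n.factorial := by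
    exact_mod_cast h
  rw [← h']
  have h1 : (n.choose i : ℝ) ≠ 0 := by exact_mod_cast (Nat.choose_pos hi).ne'
  have h2 : (i.factorial : ℝ) ≠ 0 := by positivity
  have h3 : ((n - i).factorial : ℝ) ≠ 0 := by positivity
  field_simp

/-- Taylor coefficients of the analytic factor `(3/2)^α (1 - z/3)^α`. -/
noncomputable def smoothCoeff (α : ℝ) (n : ℕ) : ℝ :=
  (3 / 2 : ℝ) ^ α * ((1 / 3 : ℝ) ^ n * negBinom (-α) n)

lemma abs_smoothCoeff_le {α : ℝ} (h0 : 0 < α) (h1 : α < 1) (n : ℕ) :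
    |smoothCoeff α n| ≤ 3 * (1 / 3) ^ n := by
  have h := abs_negBinom_le_two h0 h1 n
  have h' : (3 / 2 : ℝ) ^ α ≤ 3 / 2 := by
    simpa using Real.rpow_le_rpow_of_exponent_le (show (1 : ℝ) ≤ 3 / 2 by norm_num) h1.le
  rw [smoothCoeff, abs_mul, abs_mul, abs_of_pos (by positivity : (0 : ℝ) < (3 / 2) ^ α),
    abs_of_pos (by positivity : (0 : ℝ) < (1 / 3) ^ n)]
  calc _ ≤ (3 / 2 : ℝ) * ((1 / 3) ^ n * 2) := by gcongr
    _ = _ := by ring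

/-- As an identity of formal power series, the convolution lets later partial summations be handled
by commutative ring arithmetic. -/
lemma mk_weight2 (α : ℝ) :
    PowerSeries.mk (weight2 α)
      = PowerSeries.mk (negBinom (-α)) * PowerSeries.mk (smoothCoeff α) := by
  ext n
  rw [PowerSeries.coeff_mul, PowerSeries.coeff_mk, weight2_eq_sum, mul_sum]
  refine sum_congr rfl fun p _ => ?_
  simp only [PowerSeries.coeff_mk, smoothCoeff]
  ring

lemma weight2_eq_antidiagonal (α : ℝ) (n : ℕ) :
    weight2 α n = ∑ p ∈ antidiagonal n, negBinom (-α) p.1 * smoothCoeff α p.2 := by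
  have := congrArg (PowerSeries.coeff n) (mk_weight2 α)
  simpa [PowerSeries.coeff_mul] using this

lemma summable_abs_smoothCoeff {α : ℝ} (h0 : 0 < α) (h1 : α < 1) :
    Summable fun n => |smoothCoeff α n| :=
  Summable.of_nonneg_of_le (fun _ => abs_nonneg _) (abs_smoothCoeff_le h0 h1)
    ((summable_geometric_of_lt_one (by norm_num) (by norm_num)).mul_left 3)

lemma summable_abs_weight2 {α : ℝ} (h0 : 0 < α) (h1 : α < 1) :
    Summable fun n => |weight2 α n| := by
  have := summable_norm_sum_mul_antidiagonal_of_summable_norm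
    (f := negBinom (-α)) (g := smoothCoeff α) (summable_abs_negBinom h0 h1)
    (summable_abs_smoothCoeff h0 h1)
  refine this.congr fun n => ?_
  rw [Real.norm_eq_abs, weight2_eq_antidiagonal]

/-! ### The generating function inside the unit disc. -/

lemma neg_one_pow_mul_choose (a : ℂ) (n : ℕ) :
    (-1) ^ n * Ring.choose a n = ∏ i ∈ range n, (-a + i) / ((i : ℂ) + 1) := by
  induction n with
  | zero => simp
  | succ n ih =>
    rw [prod_range_succ, ← ih, Ring.choose_eq_smul, Ring.choose_eq_smul,
      descPochhammer_succ_right, Polynomial.smeval_mul, Nat.factorial_succ]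
    have h1 : ((n : ℂ) + 1) ≠ 0 := by exact_mod_cast Nat.succ_ne_zero n
    have h2 : (n.factorial : ℂ) ≠ 0 := by exact_mod_cast n.factorial_ne_zero
    simp only [Polynomial.smeval_sub, Polynomial.smeval_X, Polynomial.smeval_natCast, smul_eq_mul]
    push_cast
    field_simp
    simp [pow_succ]
    ring

lemma hasSum_negBinom_cpow (α : ℝ) {z : ℂ} (hz : ‖z‖ < 1) :
    HasSum (fun n => (negBinom (-α) n : ℂ) * z ^ n) ((1 - z) ^ (α : ℂ)) := by
  have h := (Complex.one_add_cpow_hasFPowerSeriesOnBall_zero (a := (α : ℂ))).hasSum (y := -z)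
    (by rw [← ENNReal.ofReal_one, Metric.eball_ofReal]; simpa using hz)
  simp only [zero_add, binomialSeries_apply, List.ofFn_const, List.prod_replicate,
    smul_eq_mul] at h
  rw [sub_eq_add_neg]
  have e : (fun n => (negBinom (-α) n : ℂ) * z ^ n)
      = fun n => Ring.choose (α : ℂ) n * (-z) ^ n := by
    ext n
    have := neg_one_pow_mul_choose α n
    rw [neg_pow z, ← mul_assoc, mul_comm (Ring.choose _ _), this, negBinom]
    push_cast
    rfl
  rw [e]
  exact h

/-- The sum of the generating series of the weights inside the unit disc. -/
lemma hasSum_weight2_mul_pow {α : ℝ} (h0 : 0 < α) (h1 : α < 1) {z : ℂ} (hz : ‖z‖ < 1) :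
    HasSum (fun n => (weight2 α n : ℂ) * z ^ n)
      (((3 / 2 : ℝ) ^ α : ℝ) * ((1 - z) ^ (α : ℂ) * (1 - z / 3) ^ (α : ℂ))) := by
  have hz3 : ‖z / 3‖ < 1 := by
    rw [norm_div]
    norm_num
    linarith
  have hle : ∀ n, ‖z ^ n‖ ≤ 1 := fun n => by
    rw [norm_pow]
    exact pow_le_one₀ (norm_nonneg _) hz.le
  have hf := hasSum_negBinom_cpow α hz
  have hg : HasSum (fun n => (smoothCoeff α n : ℂ) * z ^ n)
      (((3 / 2 : ℝ) ^ α : ℝ) * (1 - z / 3) ^ (α : ℂ)) := by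
    convert! (hasSum_negBinom_cpow α hz3).mul_left _ using 2 with n
    simp only [smoothCoeff, div_pow]
    push_cast
    ring
  have hfs : Summable fun n => ‖(negBinom (-α) n : ℂ) * z ^ n‖ :=
    Summable.of_nonneg_of_le (fun _ => norm_nonneg _) (fun n => by
      rw [norm_mul, Complex.norm_real]
      exact mul_le_of_le_one_right (norm_nonneg _) (hle n)) (summable_abs_negBinom h0 h1)
  have hgs : Summable fun n => ‖(smoothCoeff α n : ℂ) * z ^ n‖ :=
    Summable.of_nonneg_of_le (fun _ => norm_nonneg _) (fun n => by
      rw [norm_mul, Complex.norm_real]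
      exact mul_le_of_le_one_right (norm_nonneg _) (hle n)) (summable_abs_smoothCoeff h0 h1)
  have e : (fun n => (weight2 α n : ℂ) * z ^ n) = fun n => ∑ p ∈ antidiagonal n,
      ((negBinom (-α) p.1 : ℂ) * z ^ p.1) * ((smoothCoeff α p.2 : ℂ) * z ^ p.2) := by
    ext n
    rw [weight2_eq_antidiagonal]
    push_cast
    rw [sum_mul]
    refine sum_congr rfl fun p hp => ?_
    rw [← mem_antidiagonal.1 hp, pow_add]
    ring
  rw [e, mul_left_comm, ← hg.tsum_eq, ← hf.tsum_eq,
    tsum_mul_tsum_eq_tsum_sum_antidiagonal_of_summable_norm hfs hgs]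
  exact (summable_norm_sum_mul_antidiagonal_of_summable_norm hfs hgs).of_norm.hasSum

/-! ### Binomial coefficients versus powers, with relative error `O(n⁻²)`. -/

/-- The difference is odd in `y`, so the quadratic terms of the two logarithms cancel. -/
lemma abs_log_one_add_sub_log_one_sub_le {y : ℝ} (h0 : 0 ≤ y) (h1 : y ≤ 1 / 2) :
    |Real.log (1 + y) - Real.log (1 - y) - 2 * y| ≤ 4 * y ^ 3 := by
  have a1 := Real.abs_log_sub_add_sum_range_le (x := y) (by rw [abs_of_nonneg h0]; linarith) 2
  have a2 := Real.abs_log_sub_add_sum_range_le (x := -y)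
    (by rw [abs_neg, abs_of_nonneg h0]; linarith) 2
  simp only [sum_range_succ, range_zero, sum_empty, abs_neg, abs_of_nonneg h0, sub_neg_eq_add]
    at a1 a2
  norm_num at a1 a2
  have hb : y ^ 3 / (1 - y) ≤ 2 * y ^ 3 := by
    rw [div_le_iff₀ (by linarith)]
    nlinarith [pow_nonneg h0 3]
  rw [abs_le] at a1 a2 ⊢
  constructor <;> linarith [a1.1, a1.2, a2.1, a2.2]

/-- Summing increments out to infinity: `q + d` decreases to `0` and `q - d` increases to `0`. -/
lemma le_and_ge_of_sub_le {q d : ℕ → ℝ} (hq : Tendsto q atTop (𝓝 0)) (hd : Tendsto d atTop (𝓝 0))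
    (h : ∀ n, |q (n + 1) - q n| ≤ d n - d (n + 1)) (n : ℕ) : |q n| ≤ d n := by
  have a1 : Antitone fun n => q n + d n := antitone_nat_of_succ_le fun n => by
    linarith [(abs_le.1 (h n)).2]
  have a2 : Monotone fun n => q n - d n := monotone_nat_of_le_succ fun n => by
    linarith [(abs_le.1 (h n)).1]
  have b1 := a1.le_of_tendsto (a := 0) (by simpa using hq.add hd) n
  have b2 := a2.ge_of_tendsto (a := 0) (by simpa using hq.sub hd) n
  rw [abs_le]
  constructor <;> linarith

lemma abs_exp_sub_one_le_mul_exp (q : ℝ) : |Real.exp q - 1| ≤ |q| * Real.exp |q| := by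
  have h1 := Real.add_one_le_exp q
  have h2 := Real.add_one_le_exp (-q)
  have h3 : Real.exp q * Real.exp (-q) = 1 := by rw [← Real.exp_add]; simp
  have h4 : Real.exp q ≤ Real.exp |q| := Real.exp_le_exp.2 (le_abs_self q)
  have h5 : 1 ≤ Real.exp |q| := Real.one_le_exp (abs_nonneg q)
  rw [abs_le]
  constructor
  · nlinarith [neg_abs_le q, abs_nonneg q]
  · have : Real.exp q - 1 ≤ q * Real.exp q := by nlinarith [Real.exp_pos q]
    nlinarith [le_abs_self q, abs_nonneg q, Real.exp_pos q]

lemma negBinom_mul_GammaSeq {β : ℝ} (hβ : 0 < β) (n : ℕ) :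
    Real.GammaSeq β n * (negBinom β n * (β + n)) = (n : ℝ) ^ β := by
  have h : ∀ n : ℕ, ∏ j ∈ range n, (β + j) = negBinom β n * n.factorial := by
    intro n
    induction n with
    | zero => simp [negBinom_zero]
    | succ n ih =>
      have hn : (n : ℝ) + 1 ≠ 0 := by positivity
      rw [prod_range_succ, ih, negBinom_succ, Nat.factorial_succ]
      push_cast
      field_simp
  have h1 := negBinom_pos hβ n
  have h2 : (0 : ℝ) < n.factorial := by positivity
  have h3 : 0 < β + n := by positivity
  rw [Real.GammaSeq, prod_range_succ, h]
  field_simp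

lemma tendsto_nat_div_add_const (c : ℝ) :
    Tendsto (fun n : ℕ => (n : ℝ) / (n + c)) atTop (𝓝 1) := by
  have h : Tendsto (fun n : ℕ => 1 - c / ((n : ℝ) + c)) atTop (𝓝 (1 - 0)) :=
    tendsto_const_nhds.sub (tendsto_const_nhds.div_atTop
      (tendsto_natCast_atTop_atTop.atTop_add tendsto_const_nhds))
  rw [sub_zero] at h
  refine h.congr' ?_
  filter_upwards [(tendsto_natCast_atTop_atTop (R := ℝ)).eventually_gt_atTop (-c)] with n hn
  have : (n : ℝ) + c ≠ 0 := by linarith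
  field_simp
  ring

/-- This is Euler's limit for `Γ`. The shift `β/2` does not affect the limit; it is what makes the
rate in `abs_Gamma_mul_negBinom_sub_le` second order. -/
lemma tendsto_Gamma_mul_negBinom_div {β : ℝ} (hβ : 1 < β) :
    Tendsto (fun n : ℕ => Real.Gamma β * negBinom β n / ((n : ℝ) + β / 2) ^ (β - 1))
      atTop (𝓝 1) := by
  have hΓ := Real.Gamma_pos_of_pos (show 0 < β by linarith)
  have h1 := (tendsto_const_nhds (x := Real.Gamma β)).div (Real.GammaSeq_tendsto_Gamma β) hΓ.ne'
  have h2 := tendsto_nat_div_add_const β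
  have h3 := (tendsto_nat_div_add_const (β / 2)).rpow_const (p := β - 1) (Or.inl one_ne_zero)
  have h := (h1.mul h2).mul h3
  rw [div_self hΓ.ne', Real.one_rpow, one_mul, one_mul] at h
  refine h.congr' ?_
  filter_upwards [eventually_ge_atTop 1] with n hn
  have hn0 : (0 : ℝ) < n := by exact_mod_cast hn
  have hG := negBinom_mul_GammaSeq (show 0 < β by linarith) n
  have hb := negBinom_pos (show 0 < β by linarith) n
  have hbn : 0 < β + n := by positivity
  have hGp : 0 < Real.GammaSeq β n := by
    have : 0 < (n : ℝ) ^ β := by positivity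
    rw [← hG] at this
    exact pos_of_mul_pos_left this (by positivity)
  have hx : 0 < ((n : ℝ) + β / 2) ^ (β - 1) := by positivity
  have hsplit : (n : ℝ) ^ β = n * (n : ℝ) ^ (β - 1) := by
    rw [Real.rpow_sub_one hn0.ne']
    field_simp
  rw [Real.div_rpow hn0.le (by positivity), add_comm (n : ℝ) β]
  simp only [Pi.div_apply]
  rw [hsplit] at hG
  field_simp
  linarith

/-- The logarithm of the ratio of the two terms tends to `0`, so it suffices to sum its increments.
With the centre `n + β/2` the first-order terms of each increment cancel and leave `O(n⁻³)`. -/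
lemma abs_Gamma_mul_negBinom_sub_le {β : ℝ} (hβ1 : 1 < β) (hβ3 : β ≤ 3) (n : ℕ) :
    |Real.Gamma β * negBinom β n - ((n : ℝ) + β / 2) ^ (β - 1)|
      ≤ 40 * Real.exp 10 * ((n : ℝ) + 1) ^ (β - 3) := by
  have hΓ := Real.Gamma_pos_of_pos (show 0 < β by linarith)
  set r : ℕ → ℝ := fun n => Real.Gamma β * negBinom β n / ((n : ℝ) + β / 2) ^ (β - 1) with hr
  have hrpos : ∀ n, 0 < r n := fun n => by
    have := negBinom_pos (show 0 < β by linarith) n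
    positivity
  set q : ℕ → ℝ := fun n => Real.log (r n) with hq
  have hq0 : Tendsto q atTop (𝓝 0) := by
    have := (tendsto_Gamma_mul_negBinom_div hβ1).log one_ne_zero
    simpa using this
  have hd0 : Tendsto (fun n : ℕ => 10 / ((n : ℝ) + 1) ^ 2) atTop (𝓝 0) := by
    refine tendsto_const_nhds.div_atTop ?_
    exact (tendsto_pow_atTop two_ne_zero).comp
      (tendsto_natCast_atTop_atTop.atTop_add tendsto_const_nhds)
  have hstep : ∀ n : ℕ, |q (n + 1) - q n|
      ≤ 10 / ((n : ℝ) + 1) ^ 2 - 10 / (((n + 1 : ℕ) : ℝ) + 1) ^ 2 := by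
    intro n
    -- Common midpoint of the pairs `(n + 1, n + β)` and `(n + β/2, n + 1 + β/2)`: every logarithm
    -- in the increment becomes one of `x ± c`.
    set x : ℝ := n + (β + 1) / 2 with hx
    have hn : (0 : ℝ) ≤ n := n.cast_nonneg
    have hx0 : 0 < x := by positivity
    have hlog : ∀ c : ℝ, c < x → -x < c →
        Real.log (1 + c / x) - Real.log (1 - c / x) = Real.log (x + c) - Real.log (x - c) := by
      intro c hc hc'
      rw [show x + c = x * (1 + c / x) by field_simp, show x - c = x * (1 - c / x) by field_simp,
        Real.log_mul hx0.ne', Real.log_mul hx0.ne']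
      · ring
      · have : c / x < 1 := by rwa [div_lt_one hx0]
        linarith
      · have : -1 < c / x := by rw [lt_div_iff₀ hx0]; linarith
        linarith
    have hqe : ∀ n : ℕ, q n = Real.log (Real.Gamma β) + Real.log (negBinom β n)
        - (β - 1) * Real.log (n + β / 2) := by
      intro n
      have := negBinom_pos (show 0 < β by linarith) n
      rw [hq, hr]
      simp only
      rw [Real.log_div (by positivity) (by positivity), Real.log_mul hΓ.ne' this.ne',
        Real.log_rpow (by positivity)]
    have hdiff : q (n + 1) - q n
        = (Real.log (1 + (β - 1) / 2 / x) - Real.log (1 - (β - 1) / 2 / x))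
          - (β - 1) * (Real.log (1 + 1 / 2 / x) - Real.log (1 - 1 / 2 / x)) := by
      have := negBinom_pos (show 0 < β by linarith) n
      rw [hlog _ (by linarith) (by linarith), hlog _ (by linarith) (by linarith), hqe, hqe,
        negBinom_succ, Real.log_mul this.ne' (by positivity),
        Real.log_div (by positivity) (by positivity), hx]
      push_cast
      ring_nf
    have b1 := abs_log_one_add_sub_log_one_sub_le (y := (β - 1) / 2 / x)
      (div_nonneg (by linarith) hx0.le) (by rw [div_le_iff₀ hx0]; linarith)
    have b2 := abs_log_one_add_sub_log_one_sub_le (y := 1 / 2 / x)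
      (by positivity) (by rw [div_le_iff₀ hx0]; linarith)
    have c1 : ((β - 1) / 2 / x) ^ 3 ≤ 1 / x ^ 3 := by
      rw [div_pow]
      gcongr
      exact pow_le_one₀ (by linarith) (by linarith)
    have c2 : (1 / 2 / x) ^ 3 = 1 / 8 * (1 / x ^ 3) := by field_simp; norm_num
    have c3 : 1 / x ^ 3 ≤ 1 / ((n : ℝ) + 1) ^ 3 := by
      gcongr
      linarith
    -- The factor `5` is `4` from the first expansion plus at most `2 · 4/8` from the second; the
    -- right side telescopes.
    have c4 : 5 * (1 / ((n : ℝ) + 1) ^ 3)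
        ≤ 10 / ((n : ℝ) + 1) ^ 2 - 10 / (((n + 1 : ℕ) : ℝ) + 1) ^ 2 := by
      push_cast
      rw [div_sub_div _ _ (by positivity) (by positivity), mul_one_div,
        div_le_div_iff₀ (by positivity) (by positivity)]
      nlinarith [pow_nonneg hn 2, pow_nonneg hn 3, pow_nonneg hn 4, pow_nonneg hn 5]
    refine le_trans ?_ c4
    rw [hdiff]
    have hp : 0 ≤ 1 / x ^ 3 := by positivity
    rw [abs_le] at b1 b2 ⊢
    have e : (β - 1) * (2 * (1 / 2 / x)) = 2 * ((β - 1) / 2 / x) := by ring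
    constructor
    · nlinarith [mul_le_mul_of_nonneg_left b2.2 (show 0 ≤ β - 1 by linarith)]
    · nlinarith [mul_le_mul_of_nonneg_left b2.1 (show 0 ≤ β - 1 by linarith)]
  have hqn := le_and_ge_of_sub_le hq0 hd0 hstep n
  have hn : (0 : ℝ) ≤ n := n.cast_nonneg
  -- A uniform bound on the exponent, needed to linearize `exp (q n) - 1`; it is the source of `exp
  -- 10`.
  have hq10 : |q n| ≤ 10 := hqn.trans (div_le_self (by norm_num) (one_le_pow₀ (by linarith)))
  have hy : 0 < ((n : ℝ) + β / 2) ^ (β - 1) := by positivity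
  have hrn : Real.Gamma β * negBinom β n = ((n : ℝ) + β / 2) ^ (β - 1) * Real.exp (q n) := by
    rw [hq]
    simp only
    rw [Real.exp_log (hrpos n), hr]
    field_simp
  have hyle : ((n : ℝ) + β / 2) ^ (β - 1) ≤ 4 * ((n : ℝ) + 1) ^ (β - 1) := by
    calc ((n : ℝ) + β / 2) ^ (β - 1) ≤ (2 * ((n : ℝ) + 1)) ^ (β - 1) :=
          Real.rpow_le_rpow (by positivity) (by linarith) (by linarith)
      _ = 2 ^ (β - 1) * ((n : ℝ) + 1) ^ (β - 1) := Real.mul_rpow (by norm_num) (by positivity)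
      _ ≤ 2 ^ (2 : ℝ) * ((n : ℝ) + 1) ^ (β - 1) := by
          gcongr
          · norm_num
          · linarith
      _ = _ := by norm_num
  have hsplit : ((n : ℝ) + 1) ^ (β - 3) = ((n : ℝ) + 1) ^ (β - 1) / ((n : ℝ) + 1) ^ 2 := by
    rw [show β - 3 = β - 1 - 2 by ring, Real.rpow_sub (by positivity), Real.rpow_two]
  rw [hrn, ← mul_sub_one, abs_mul, abs_of_pos hy]
  calc ((n : ℝ) + β / 2) ^ (β - 1) * |Real.exp (q n) - 1|
      ≤ (4 * ((n : ℝ) + 1) ^ (β - 1)) * (10 / ((n : ℝ) + 1) ^ 2 * Real.exp 10) := by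
        gcongr
        exact (abs_exp_sub_one_le_mul_exp _).trans (by gcongr)
    _ = _ := by rw [hsplit]; ring

/-- The graph of `x ↦ x ^ p`, `p ≥ 1`, lies above its tangents. -/
lemma rpow_add_mul_sub_le_rpow {p y z : ℝ} (hp : 1 ≤ p) (hy : 0 ≤ y) (hz : 0 < z) :
    z ^ p + p * z ^ (p - 1) * (y - z) ≤ y ^ p := by
  have h := one_add_mul_self_le_rpow_one_add (s := y / z - 1)
    (by have := div_nonneg hy hz.le; linarith) hp
  rw [add_sub_cancel, Real.div_rpow hy hz.le, le_div_iff₀ (by positivity)] at h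
  rw [Real.rpow_sub_one hz.ne']
  refine le_trans (le_of_eq ?_) h
  field_simp

/-- The graph of `x ↦ x ^ p`, `0 ≤ p ≤ 1`, lies below its tangents. -/
lemma rpow_le_rpow_add_mul_sub {p y z : ℝ} (hp0 : 0 ≤ p) (hp1 : p ≤ 1) (hy : 0 ≤ y)
    (hz : 0 < z) : y ^ p ≤ z ^ p + p * z ^ (p - 1) * (y - z) := by
  have h := rpow_one_add_le_one_add_mul_self (s := y / z - 1)
    (by have := div_nonneg hy hz.le; linarith) hp0 hp1
  rw [add_sub_cancel, Real.div_rpow hy hz.le, div_le_iff₀ (by positivity)] at h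
  rw [Real.rpow_sub_one hz.ne']
  refine h.trans (le_of_eq ?_)
  field_simp

/-- Convexity at both points squeezes the remainder between `0` and `p (y^(p-1) - z^(p-1))(y - z)`,
and `x^(p-1)`, with exponent in `[0,1]`, has Lipschitz constant at most `m^(p-2)` on `[m, ∞)`. -/
lemma abs_rpow_sub_tangent_le {p y z m : ℝ} (hp1 : 1 ≤ p) (hp2 : p ≤ 2) (hm : 0 < m)
    (hy : m ≤ y) (hz : m ≤ z) :
    |y ^ p - z ^ p - p * z ^ (p - 1) * (y - z)| ≤ 2 * (y - z) ^ 2 * m ^ (p - 2) := by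
  have hy0 : 0 < y := by linarith
  have hz0 : 0 < z := by linarith
  have key : ∀ u v : ℝ, m ≤ u → u ≤ v →
      0 ≤ v ^ (p - 1) - u ^ (p - 1) ∧ v ^ (p - 1) - u ^ (p - 1) ≤ m ^ (p - 2) * (v - u) := by
    intro u v hu huv
    have hu0 : 0 < u := by linarith
    refine ⟨sub_nonneg.2 (Real.rpow_le_rpow hu0.le huv (by linarith)), ?_⟩
    have h := rpow_le_rpow_add_mul_sub (p := p - 1) (by linarith) (by linarith)
      (show 0 ≤ v by linarith) hu0
    have h2 : u ^ (p - 1 - 1) ≤ m ^ (p - 2) := by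
      rw [show p - 1 - 1 = p - 2 by ring]
      exact Real.rpow_le_rpow_of_nonpos hm hu (by linarith)
    have h3 : (p - 1) * u ^ (p - 1 - 1) ≤ 1 * m ^ (p - 2) := by
      gcongr
      linarith
    nlinarith [mul_le_mul_of_nonneg_right h3 (show 0 ≤ v - u by linarith)]
  have l1 := rpow_add_mul_sub_le_rpow hp1 hy0.le hz0
  have l2 := rpow_add_mul_sub_le_rpow hp1 hz0.le hy0
  rw [abs_of_nonneg (by linarith)]
  have hM : 0 ≤ m ^ (p - 2) := by positivity
  have h1 : y ^ p - z ^ p - p * z ^ (p - 1) * (y - z)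
      ≤ p * ((y ^ (p - 1) - z ^ (p - 1)) * (y - z)) := by linarith
  refine h1.trans ?_
  have h2 : (y ^ (p - 1) - z ^ (p - 1)) * (y - z) ≤ m ^ (p - 2) * (y - z) ^ 2 := by
    rcases le_total z y with h | h
    · have := key z y hz h
      nlinarith [mul_le_mul_of_nonneg_right this.2 (show 0 ≤ y - z by linarith)]
    · have := key y z hy h
      nlinarith [mul_le_mul_of_nonneg_right this.2 (show 0 ≤ z - y by linarith)]
  have h3 : 0 ≤ m ^ (p - 2) * (y - z) ^ 2 := by positivity
  nlinarith

/-! ### Threefold partial sums of the weights. -/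

/-- Partial sums of a sequence. -/
noncomputable def partialSum (ω : ℕ → ℝ) (n : ℕ) : ℝ := ∑ i ∈ range (n + 1), ω i

lemma partialSum_succ (ω : ℕ → ℝ) (n : ℕ) :
    partialSum ω (n + 1) = partialSum ω n + ω (n + 1) := sum_range_succ _ _

lemma partialSum_negBinom (β : ℝ) : partialSum (negBinom β) = negBinom (β + 1) :=
  funext (sum_negBinom β)

lemma mk_partialSum (ω : ℕ → ℝ) :
    PowerSeries.mk (partialSum ω) = PowerSeries.mk ω * PowerSeries.mk (fun _ => 1) := by
  ext n
  simp [PowerSeries.coeff_mul, partialSum, Finset.Nat.sum_antidiagonal_eq_sum_range_succ_mk]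

/-- Three factors `1/(1 - z)` turn `(1 - z)^α` into `(1 - z)^(-(3 - α))` and leave the analytic
factor untouched. -/
lemma partialSum_three_weight2 (α : ℝ) (n : ℕ) :
    partialSum (partialSum (partialSum (weight2 α))) n
      = ∑ p ∈ antidiagonal n, negBinom (3 - α) p.1 * smoothCoeff α p.2 := by
  have h : PowerSeries.mk (partialSum (partialSum (partialSum (weight2 α))))
      = PowerSeries.mk (negBinom (3 - α)) * PowerSeries.mk (smoothCoeff α) := by
    rw [show 3 - α = -α + 1 + 1 + 1 by ring, ← partialSum_negBinom, ← partialSum_negBinom,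
      ← partialSum_negBinom]
    simp only [mk_partialSum, mk_weight2]
    ring
  simpa [PowerSeries.coeff_mul] using congrArg (PowerSeries.coeff n) h

lemma hasSum_negBinom_rpow (α : ℝ) {x : ℝ} (hx : |x| < 1) :
    HasSum (fun n => negBinom (-α) n * x ^ n) ((1 - x) ^ α) := by
  have h := hasSum_negBinom_cpow α (z := x) (by simpa using hx)
  have h1 : (1 - (x : ℂ)) ^ (α : ℂ) = (((1 - x) ^ α : ℝ) : ℂ) := by
    rw [Complex.ofReal_cpow (by linarith [(abs_lt.1 hx).2])]
    push_cast
    rfl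
  rw [h1] at h
  exact_mod_cast h

lemma hasSum_smoothCoeff (α : ℝ) : HasSum (smoothCoeff α) 1 := by
  have h := (hasSum_negBinom_rpow α (x := 1 / 3) (by norm_num [abs_of_pos])).mul_left
    ((3 / 2 : ℝ) ^ α)
  rw [← Real.mul_rpow (by norm_num) (by norm_num)] at h
  norm_num at h
  convert! h using 2 with n
  rw [smoothCoeff]
  simp only [one_div, inv_pow]
  ring

/-- This is the derivative at `z = 1` of `(3/2)^α (1 - z/3)^α`. The first moment `-α/2` is what
makes the quadrature second order: it offsets the shift by `α/2` left by the factor `(1 - z)^α`. -/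
lemma hasSum_mul_smoothCoeff (α : ℝ) : HasSum (fun m : ℕ => m * smoothCoeff α m) (-α / 2) := by
  rw [← hasSum_nat_add_iff' 1]
  simp only [range_one, sum_singleton, Nat.cast_zero, zero_mul, sub_zero]
  have h := (hasSum_negBinom_rpow (α - 1) (x := 1 / 3) (by norm_num [abs_of_pos])).mul_left
    ((3 / 2 : ℝ) ^ α * (-α / 3))
  convert! h using 1
  · ext m
    have h1 := mul_negBinom_add_one (-α) m
    have hm : (m : ℝ) + 1 ≠ 0 := by positivity
    rw [smoothCoeff, negBinom_succ, show -(α - 1) = -α + 1 by ring, pow_succ]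
    push_cast
    field_simp
    linarith
  · rw [show (1 - 1 / 3 : ℝ) = (3 / 2)⁻¹ by norm_num, Real.inv_rpow (by norm_num),
      Real.rpow_sub_one (by norm_num)]
    have : (3 / 2 : ℝ) ^ α ≠ 0 := by positivity
    field_simp

/-- Moves decay from the index `n - m` to `n` at the price of a factor linear in `m`, which the
geometric decay of `smoothCoeff` absorbs. -/
lemma add_one_rpow_neg_le {α : ℝ} (h0 : 0 < α) (h1 : α < 1) {m n k : ℕ} (h : n ≤ k + m) :
    ((k : ℝ) + 1) ^ (-α) ≤ ((m : ℝ) + 1) * ((n : ℝ) + 1) ^ (-α) := by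
  have hk : (0 : ℝ) ≤ k := k.cast_nonneg
  have hm : (0 : ℝ) ≤ m := m.cast_nonneg
  have hle : (n : ℝ) + 1 ≤ ((k : ℝ) + 1) * ((m : ℝ) + 1) := by
    have : (n : ℝ) ≤ k + m := by exact_mod_cast h
    nlinarith
  have e : ((k : ℝ) + 1) ^ (-α)
      = (((k : ℝ) + 1) * ((m : ℝ) + 1)) ^ (-α) * ((m : ℝ) + 1) ^ α := by
    rw [Real.mul_rpow (by positivity) (by positivity), mul_assoc, ← Real.rpow_add (by positivity)]
    simp
  rw [e, mul_comm]
  gcongr ?_ * ?_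
  · calc ((m : ℝ) + 1) ^ α ≤ ((m : ℝ) + 1) ^ (1 : ℝ) :=
        Real.rpow_le_rpow_of_exponent_le (by linarith) h1.le
      _ = _ := Real.rpow_one _
  · exact Real.rpow_le_rpow_of_nonpos (by positivity) hle (by linarith)

/-- Replace each `Γ(3 - α) negBinom (3 - α) (n - m)` by `(n - m + (3 - α)/2)^(2 - α)` and expand at
`n + 3/2`. The displacement `-(m + α/2)` has zero mean against `smoothCoeff`, so the linear term
drops out. -/
lemma exists_abs_partialSum_three_sub_le {α : ℝ} (h0 : 0 < α) (h1 : α < 1) :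
    ∃ C : ℝ, 0 ≤ C ∧ ∀ n : ℕ,
      |Real.Gamma (3 - α) * partialSum (partialSum (partialSum (weight2 α))) n
        - ((n : ℝ) + 3 / 2) ^ (2 - α)| ≤ C * ((n : ℝ) + 1) ^ (-α) := by
  set B : ℝ := 40 * Real.exp 10 with hB
  have hBp : 0 ≤ B := by positivity
  have hS : Summable fun m : ℕ => 3 * (1 / 3 : ℝ) ^ m * ((B + 8) * ((m : ℝ) + 2) ^ 3) := by
    have : Summable fun m : ℕ => ((m : ℝ) + 2) ^ 3 * (1 / 3 : ℝ) ^ m := by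
      have h := fun k => summable_pow_mul_geometric_of_norm_lt_one (R := ℝ) k
        (r := 1 / 3) (by norm_num)
      have e : (fun m : ℕ => ((m : ℝ) + 2) ^ 3 * (1 / 3 : ℝ) ^ m)
          = fun m : ℕ => ((m : ℝ) ^ 3 * (1 / 3 : ℝ) ^ m + 6 * ((m : ℝ) ^ 2 * (1 / 3 : ℝ) ^ m)
            + 12 * ((m : ℝ) ^ 1 * (1 / 3 : ℝ) ^ m)) + 8 * ((m : ℝ) ^ 0 * (1 / 3 : ℝ) ^ m) := by
        ext m; ring
      rw [e]
      exact (((h 3).add ((h 2).mul_left 6)).add ((h 1).mul_left 12)).add ((h 0).mul_left 8)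
    refine (this.mul_left (3 * (B + 8))).congr fun m => ?_
    ring
  refine ⟨∑' m : ℕ, 3 * (1 / 3 : ℝ) ^ m * ((B + 8) * ((m : ℝ) + 2) ^ 3),
    tsum_nonneg fun m => by positivity, fun n => ?_⟩
  set y : ℝ := (n : ℝ) + 3 / 2 with hy
  have hn : (0 : ℝ) ≤ n := n.cast_nonneg
  have hy0 : 0 < y := by positivity
  set G : ℕ → ℝ := fun m => if m ≤ n then Real.Gamma (3 - α) * negBinom (3 - α) (n - m) else 0
    with hG
  -- Error of the tangent approximation at `y`; the added linear term has zero sum against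
  -- `smoothCoeff`.
  set e : ℕ → ℝ := fun m => G m - y ^ (2 - α) + (m + α / 2) * ((2 - α) * y ^ (1 - α)) with he
  have hbound : ∀ m : ℕ, |e m| ≤ (B + 8) * ((m : ℝ) + 2) ^ 3 * ((n : ℝ) + 1) ^ (-α) := by
    intro m
    have hm : (0 : ℝ) ≤ m := m.cast_nonneg
    have hP : 0 < ((n : ℝ) + 1) ^ (-α) := by positivity
    by_cases hmn : m ≤ n
    · set k := n - m with hk
      have hkn : (n : ℝ) = k + m := by
        rw [hk, Nat.cast_sub hmn]; ring
      have hk0 : (0 : ℝ) ≤ k := k.cast_nonneg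
      have b1 := abs_Gamma_mul_negBinom_sub_le (β := 3 - α) (by linarith) (by linarith) k
      have b2 := abs_rpow_sub_tangent_le (p := 2 - α) (y := (k : ℝ) + (3 - α) / 2) (z := y)
        (m := (k : ℝ) + 1) (by linarith) (by linarith) (by positivity) (by linarith)
        (by linarith)
      have b3 := add_one_rpow_neg_le h0 h1 (show n ≤ k + m by omega)
      rw [show 3 - α - 3 = -α by ring, show 3 - α - 1 = 2 - α by ring] at b1
      rw [show 2 - α - 2 = -α by ring, show 2 - α - 1 = 1 - α by ring,
        show (k : ℝ) + (3 - α) / 2 - y = -(m + α / 2) by rw [hy, hkn]; ring] at b2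
      have e1 : e m = (Real.Gamma (3 - α) * negBinom (3 - α) k
          - ((k : ℝ) + (3 - α) / 2) ^ (2 - α)) + (((k : ℝ) + (3 - α) / 2) ^ (2 - α) - y ^ (2 - α)
          - (2 - α) * y ^ (1 - α) * -(m + α / 2)) := by
        rw [he, hG]
        simp only [if_pos hmn]
        ring
      have b4 : 2 * (-(m + α / 2)) ^ 2 ≤ 2 * ((m : ℝ) + 2) ^ 2 := by
        rw [neg_sq]
        gcongr
        linarith
      have hk1 : 0 < ((k : ℝ) + 1) ^ (-α) := by positivity
      calc |e m| ≤ B * ((k : ℝ) + 1) ^ (-α) + 2 * ((m : ℝ) + 2) ^ 2 * ((k : ℝ) + 1) ^ (-α) := by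
            rw [e1]
            refine (abs_add_le _ _).trans (add_le_add b1 (b2.trans ?_))
            gcongr
        _ = (B + 2 * ((m : ℝ) + 2) ^ 2) * ((k : ℝ) + 1) ^ (-α) := by ring
        _ ≤ ((B + 8) * ((m : ℝ) + 2) ^ 2) * (((m : ℝ) + 2) * ((n : ℝ) + 1) ^ (-α)) := by
            gcongr
            · nlinarith [mul_nonneg hBp hm, mul_nonneg (mul_nonneg hBp hm) hm]
            · exact b3.trans (by gcongr; norm_num)
        _ = _ := by ring
    -- Here the coefficient is absent and `G m = 0`; crude bounds polynomial in `m` suffice because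
    -- `m > n`.
    · have hmn' : (n : ℝ) + 1 ≤ m := by exact_mod_cast Nat.lt_of_not_le hmn
      have b3 := add_one_rpow_neg_le h0 h1 (m := m) (n := n) (k := 0) (by omega)
      simp only [Nat.cast_zero, zero_add, Real.one_rpow] at b3
      have hyp : ∀ p : ℝ, p ≤ 2 → y ^ p ≤ y ^ 2 := by
        intro p hp
        rw [← Real.rpow_natCast]
        exact Real.rpow_le_rpow_of_exponent_le (by linarith) (by exact_mod_cast hp)
      have hyp1 : y ^ (1 - α) ≤ y := by
        calc y ^ (1 - α) ≤ y ^ (1 : ℝ) :=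
              Real.rpow_le_rpow_of_exponent_le (by linarith) (by linarith)
          _ = y := Real.rpow_one y
      have hy2 : y ≤ (m : ℝ) + 2 := by linarith
      have c0 : 0 ≤ y ^ (1 - α) := by positivity
      have c1 : y ^ (2 - α) ≤ ((m : ℝ) + 2) ^ 2 :=
        (hyp _ (by linarith)).trans (by gcongr)
      have c2 : (m + α / 2) * ((2 - α) * y ^ (1 - α)) ≤ ((m : ℝ) + 2) * (2 * ((m : ℝ) + 2)) := by
        have c5 : (2 - α) * y ^ (1 - α) ≤ 2 * ((m : ℝ) + 2) :=
          mul_le_mul (by linarith) (hyp1.trans hy2) c0 (by norm_num)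
        exact mul_le_mul (by linarith) c5 (mul_nonneg (by linarith) c0) (by positivity)
      have c3 : 0 ≤ (m + α / 2) * ((2 - α) * y ^ (1 - α)) :=
        mul_nonneg (by positivity) (mul_nonneg (by linarith) c0)
      have c4 : 0 ≤ y ^ (2 - α) := by positivity
      calc |e m| ≤ 2 * ((m : ℝ) + 2) ^ 2 * 1 := by
            rw [he, hG]
            simp only [if_neg hmn]
            rw [abs_le]
            constructor <;> nlinarith
        _ ≤ (B + 8) * ((m : ℝ) + 2) ^ 2 * (((m : ℝ) + 2) * ((n : ℝ) + 1) ^ (-α)) := by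
            gcongr
            · linarith
            · exact b3.trans (by gcongr; norm_num)
        _ = _ := by ring
  have hsumG : HasSum (fun m => smoothCoeff α m * G m)
      (Real.Gamma (3 - α) * partialSum (partialSum (partialSum (weight2 α))) n) := by
    have : ∑ m ∈ range (n + 1), smoothCoeff α m * G m
        = Real.Gamma (3 - α) * partialSum (partialSum (partialSum (weight2 α))) n := by
      rw [partialSum_three_weight2, Finset.Nat.sum_antidiagonal_eq_sum_range_succ_mk,
        ← sum_range_reflect, mul_sum]
      refine sum_congr rfl fun m hm => ?_
      have hm : m ≤ n := by simpa [Nat.lt_succ_iff] using hm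
      have e1 : n + 1 - 1 - m = n - m := by omega
      simp only [hG, e1, if_pos (Nat.sub_le n m), Nat.sub_sub_self hm]
      ring
    rw [← this]
    refine hasSum_sum_of_ne_finset_zero fun m hm => ?_
    have hm : ¬ m ≤ n := by simpa [Nat.lt_succ_iff] using hm
    simp [hG, hm]
  have hsum : HasSum (fun m => smoothCoeff α m * e m)
      (Real.Gamma (3 - α) * partialSum (partialSum (partialSum (weight2 α))) n
        - y ^ (2 - α)) := by
    have h := (hsumG.sub ((hasSum_smoothCoeff α).mul_right (y ^ (2 - α)))).add
      (((hasSum_mul_smoothCoeff α).add ((hasSum_smoothCoeff α).mul_right (α / 2))).mul_right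
        ((2 - α) * y ^ (1 - α)))
    convert! h using 1
    · ext m
      rw [he]
      ring
    · ring
  have hS' := hS.mul_right (((n : ℝ) + 1) ^ (-α))
  rw [← hsum.tsum_eq, ← tsum_mul_right, ← Real.norm_eq_abs]
  refine tsum_of_norm_bounded hS'.hasSum fun m => ?_
  rw [norm_mul, Real.norm_eq_abs, Real.norm_eq_abs, mul_assoc]
  exact mul_le_mul (abs_smoothCoeff_le h0 h1 m) (hbound m) (abs_nonneg _) (by positivity)

/-! ### Quadrature of the truncated square. -/

lemma sum_mul_sub_eq_partialSum (ω : ℕ → ℝ) (n : ℕ) :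
    ∑ l ∈ range (n + 2), ω l * ((n + 1 : ℕ) - l : ℝ) = partialSum (partialSum ω) n := by
  induction n with
  | zero => simp [sum_range_succ, partialSum]
  | succ n ih =>
    rw [partialSum_succ, ← ih, sum_range_succ, partialSum, ← sum_add_distrib]
    simp only [sub_self, mul_zero, add_zero]
    refine sum_congr rfl fun l _ => ?_
    push_cast
    ring

lemma sum_mul_sub_sq_eq_partialSum (ω : ℕ → ℝ) (n : ℕ) :
    ∑ l ∈ range (n + 3), ω l * ((n + 2 : ℕ) - l : ℝ) ^ 2
      = partialSum (partialSum (partialSum ω)) (n + 1)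
        + partialSum (partialSum (partialSum ω)) n := by
  induction n with
  | zero =>
    simp [sum_range_succ, partialSum]
    ring
  | succ n ih =>
    rw [partialSum_succ _ (n + 1), partialSum_succ _ n]
    have h := sum_mul_sub_eq_partialSum ω (n + 1)
    rw [partialSum_succ _ n] at ih
    have e : ∑ l ∈ range (n + 1 + 3), ω l * ((n + 1 + 2 : ℕ) - l : ℝ) ^ 2
        = ∑ l ∈ range (n + 3), ω l * ((n + 2 : ℕ) - l : ℝ) ^ 2
          + 2 * ∑ l ∈ range (n + 1 + 2), ω l * ((n + 1 + 1 : ℕ) - l : ℝ)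
          + ∑ l ∈ range (n + 2 + 1), ω l := by
      rw [sum_range_succ, mul_sum, ← sum_add_distrib, ← sum_add_distrib]
      push_cast
      rw [show ((n : ℝ) + 1 + 2 - (n + 3)) = 0 by ring]
      rw [zero_pow two_ne_zero, mul_zero, add_zero]
      refine sum_congr rfl fun l _ => ?_
      ring
    rw [e, ih, h]
    have h2 : ∑ l ∈ range (n + 2 + 1), ω l = partialSum ω (n + 2) := rfl
    rw [h2, partialSum_succ (partialSum ω) (n + 1)]
    ring

/-- Reflects `∑ (k + θ)² z^k = (θ² + (1 + 2θ - 2θ²) z + (1 - θ)² z²)/(1 - z)³`; the numerator holds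
twice the values of a quadratic B-spline. -/
lemma sum_mul_sub_add_sq_eq (ω : ℕ → ℝ) (n : ℕ) (θ : ℝ) :
    ∑ l ∈ range (n + 3), ω l * ((n + 2 : ℕ) + θ - l : ℝ) ^ 2
      = θ ^ 2 * partialSum (partialSum (partialSum ω)) (n + 2)
        + (1 + 2 * θ - 2 * θ ^ 2) * partialSum (partialSum (partialSum ω)) (n + 1)
        + (1 - θ) ^ 2 * partialSum (partialSum (partialSum ω)) n := by
  have h2 := sum_mul_sub_sq_eq_partialSum ω n
  have h1 := sum_mul_sub_eq_partialSum ω (n + 1)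
  have h0 : ∑ l ∈ range (n + 2 + 1), ω l = partialSum ω (n + 2) := rfl
  have e : ∑ l ∈ range (n + 3), ω l * ((n + 2 : ℕ) + θ - l : ℝ) ^ 2
      = ∑ l ∈ range (n + 3), ω l * ((n + 2 : ℕ) - l : ℝ) ^ 2
        + 2 * θ * ∑ l ∈ range (n + 1 + 2), ω l * ((n + 1 + 1 : ℕ) - l : ℝ)
        + θ ^ 2 * ∑ l ∈ range (n + 2 + 1), ω l := by
    rw [mul_sum, mul_sum, ← sum_add_distrib, ← sum_add_distrib]
    refine sum_congr rfl fun l _ => ?_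
    push_cast
    ring
  have p1 := partialSum_succ (partialSum (partialSum ω)) (n + 1)
  have p2 := partialSum_succ (partialSum (partialSum ω)) n
  have p3 := partialSum_succ (partialSum ω) (n + 1)
  rw [e, h2, h1, h0]
  rw [show n + 1 + 1 = n + 2 by ring] at p1 p3
  rw [p1, p2, p3]
  ring

/-- The three weights are nonnegative with sum `2`. -/
lemma abs_threePoint_le {θ x y z B : ℝ} (h0 : 0 ≤ θ) (h1 : θ ≤ 1) (hx : |x| ≤ B) (hy : |y| ≤ B)
    (hz : |z| ≤ B) :
    |θ ^ 2 * x + (1 + 2 * θ - 2 * θ ^ 2) * y + (1 - θ) ^ 2 * z| ≤ 2 * B := by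
  have w1 : 0 ≤ 1 + 2 * θ - 2 * θ ^ 2 := by nlinarith
  refine (abs_add_three _ _ _).trans ?_
  rw [abs_mul, abs_mul, abs_mul, abs_of_nonneg (sq_nonneg θ), abs_of_nonneg w1,
    abs_of_nonneg (sq_nonneg (1 - θ))]
  linarith [mul_le_mul_of_nonneg_left hx (sq_nonneg θ), mul_le_mul_of_nonneg_left hy w1,
    mul_le_mul_of_nonneg_left hz (sq_nonneg (1 - θ))]

set_option maxHeartbeats 1000000 in
/-- The error of the convolution quadrature with unit step for the truncated power `x₊²`. -/
lemma exists_abs_sum_weight2_mul_sq_sub_le {α : ℝ} (h0 : 0 < α) (h1 : α < 1) :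
    ∃ C : ℝ, 0 ≤ C ∧ ∀ s : ℝ, 0 < s → ∀ J : ℕ, s ≤ J →
      |∑ l ∈ range (J + 1), weight2 α l * (max (s - l) 0) ^ 2
        - 2 / Real.Gamma (3 - α) * s ^ (2 - α)| ≤ C * s ^ (-α) := by
  obtain ⟨C, hC, hS⟩ := exists_abs_partialSum_three_sub_le h0 h1
  have hΓ : 0 < Real.Gamma (3 - α) := Real.Gamma_pos_of_pos (by linarith)
  set D : ℝ := 6 * (C + 9 / 2) / Real.Gamma (3 - α) with hD
  set E : ℝ := 2 * (4 * (|weight2 α 0| + |weight2 α 1|) + 8 / Real.Gamma (3 - α)) with hE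
  refine ⟨D + E, by positivity, fun s hs J hsJ => ?_⟩
  have hsp : 0 < s ^ (-α) := by positivity
  have hDp : 0 ≤ D := by positivity
  have hEp : 0 ≤ E := by positivity
  set n := ⌊s⌋₊ with hn
  have hns : (n : ℝ) ≤ s := Nat.floor_le hs.le
  have hsn : s < n + 1 := Nat.lt_floor_add_one s
  have hnJ : n ≤ J := by
    have : (n : ℝ) ≤ J := hns.trans hsJ
    exact_mod_cast this
  have hsum : ∑ l ∈ range (J + 1), weight2 α l * (max (s - l) 0) ^ 2
      = ∑ l ∈ range (n + 1), weight2 α l * (s - l) ^ 2 := by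
    rw [← sum_subset (range_subset_range.2 (Nat.succ_le_succ hnJ))]
    · refine sum_congr rfl fun l hl => ?_
      have : (l : ℝ) ≤ n := by exact_mod_cast Nat.lt_succ_iff.1 (mem_range.1 hl)
      rw [max_eq_left (by linarith)]
    · intro l _ hl
      have : (n : ℝ) + 1 ≤ l := by exact_mod_cast Nat.le_of_not_lt (mt mem_range.2 hl)
      rw [max_eq_right (by linarith)]
      ring
  rw [hsum]
  -- For `s < 2` both terms are bounded and `s^(-α) ≥ 1/2`, so no cancellation is needed; the
  -- three-point formula requires `n ≥ 2`.
  rcases Nat.lt_or_ge n 2 with hn2 | hn2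
  · have hs2 : s ≤ 2 := by
      have : (n : ℝ) + 1 ≤ 2 := by exact_mod_cast hn2
      linarith
    have hlow : 1 ≤ 2 * s ^ (-α) := by
      have a1 : (2 : ℝ) ^ (-α) ≤ s ^ (-α) := Real.rpow_le_rpow_of_nonpos hs hs2 (by linarith)
      have a2 : (2 : ℝ) ^ (-1 : ℝ) ≤ (2 : ℝ) ^ (-α) :=
        Real.rpow_le_rpow_of_exponent_le (by norm_num) (by linarith)
      rw [Real.rpow_neg_one] at a2
      linarith
    have b1 : |∑ l ∈ range (n + 1), weight2 α l * (s - l) ^ 2|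
        ≤ 4 * (|weight2 α 0| + |weight2 α 1|) := by
      calc |∑ l ∈ range (n + 1), weight2 α l * (s - l) ^ 2|
          ≤ ∑ l ∈ range (n + 1), |weight2 α l| * 4 := by
            refine (abs_sum_le_sum_abs _ _).trans (sum_le_sum fun l hl => ?_)
            have : (l : ℝ) ≤ n := by exact_mod_cast Nat.lt_succ_iff.1 (mem_range.1 hl)
            have hl0 : (0 : ℝ) ≤ l := l.cast_nonneg
            rw [abs_mul, abs_of_nonneg (sq_nonneg (s - l))]
            gcongr
            nlinarith
        _ ≤ ∑ l ∈ range 2, |weight2 α l| * 4 :=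
            sum_le_sum_of_subset_of_nonneg (range_subset_range.2 (by omega))
              fun _ _ _ => by positivity
        _ = _ := by simp [sum_range_succ]; ring
    have b2 : s ^ (2 - α) ≤ 4 := by
      calc s ^ (2 - α) ≤ 2 ^ (2 - α) := Real.rpow_le_rpow hs.le hs2 (by linarith)
        _ ≤ (2 : ℝ) ^ (2 : ℝ) := Real.rpow_le_rpow_of_exponent_le (by norm_num) (by linarith)
        _ = 4 := by norm_num
    have b3 : |2 / Real.Gamma (3 - α) * s ^ (2 - α)| ≤ 8 / Real.Gamma (3 - α) := by
      rw [abs_of_nonneg (by positivity), div_mul_eq_mul_div]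
      gcongr
      linarith
    calc _ ≤ E / 2 * 1 := by
          refine (abs_sub _ _).trans ?_
          rw [hE]
          linarith
      _ ≤ E / 2 * (2 * s ^ (-α)) := by gcongr
      _ ≤ (D + E) * s ^ (-α) := by nlinarith
  · obtain ⟨k, hk⟩ : ∃ k, n = k + 2 := ⟨n - 2, by omega⟩
    set θ : ℝ := s - n with hθ
    have hθ0 : 0 ≤ θ := by linarith
    have hθ1 : θ ≤ 1 := by linarith
    have hkn : (n : ℝ) = k + 2 := by rw [hk]; push_cast; ring
    have hk0 : (0 : ℝ) ≤ k := k.cast_nonneg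
    have hsk : s = k + 2 + θ := by rw [hθ, hkn]; ring
    have e1 : ∑ l ∈ range (n + 1), weight2 α l * (s - l) ^ 2
        = θ ^ 2 * partialSum (partialSum (partialSum (weight2 α))) (k + 2)
        + (1 + 2 * θ - 2 * θ ^ 2) * partialSum (partialSum (partialSum (weight2 α))) (k + 1)
        + (1 - θ) ^ 2 * partialSum (partialSum (partialSum (weight2 α))) k := by
      rw [← sum_mul_sub_add_sq_eq, hk]
      refine sum_congr rfl fun l _ => ?_
      rw [hsk]
      push_cast
      ring
    rw [e1]
    have hP : 0 < ((k : ℝ) + 1) ^ (-α) := by positivity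
    have hmono : ∀ x : ℝ, (k : ℝ) + 1 ≤ x → x ^ (-α) ≤ ((k : ℝ) + 1) ^ (-α) := fun x hx =>
      Real.rpow_le_rpow_of_nonpos (by positivity) hx (by linarith)
    have hks : ((k : ℝ) + 1) ^ (-α) ≤ 3 * s ^ (-α) := by
      calc ((k : ℝ) + 1) ^ (-α) ≤ (s / 3) ^ (-α) :=
            Real.rpow_le_rpow_of_nonpos (by positivity) (by linarith) (by linarith)
        _ = 3 ^ α * s ^ (-α) := by
            rw [Real.div_rpow hs.le (by norm_num), Real.rpow_neg (by norm_num : (0 : ℝ) ≤ 3)]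
            field_simp
        _ ≤ 3 ^ (1 : ℝ) * s ^ (-α) := by
            gcongr
            norm_num
        _ = _ := by norm_num
    -- Recentres the power from `y` to `s` with its tangent. The three nodes satisfy `|y - s| ≤
    -- 3/2`, whence `9/4`.
    have comb : ∀ (S : ℝ) (y : ℝ), (k : ℝ) + 1 ≤ y → (y - s) ^ 2 ≤ 9 / 4 →
        |Real.Gamma (3 - α) * S - y ^ (2 - α)| ≤ C * ((k : ℝ) + 1) ^ (-α) →
        |Real.Gamma (3 - α) * S - s ^ (2 - α) - (2 - α) * s ^ (1 - α) * (y - s)|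
          ≤ (C + 9 / 2) * ((k : ℝ) + 1) ^ (-α) := by
      intro S y hy hys hSy
      have b := abs_rpow_sub_tangent_le (p := 2 - α) (y := y) (z := s) (m := (k : ℝ) + 1)
        (by linarith) (by linarith) (by positivity) hy (by linarith)
      rw [show 2 - α - 2 = -α by ring, show 2 - α - 1 = 1 - α by ring] at b
      have b' : 2 * (y - s) ^ 2 * ((k : ℝ) + 1) ^ (-α) ≤ 9 / 2 * ((k : ℝ) + 1) ^ (-α) := by
        gcongr
        linarith
      calc _ = |(Real.Gamma (3 - α) * S - y ^ (2 - α))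
            + (y ^ (2 - α) - s ^ (2 - α) - (2 - α) * s ^ (1 - α) * (y - s))| := by
            congr 1; ring
        _ ≤ _ := (abs_add_le _ _).trans (by linarith)
    have hS' : ∀ i : ℕ, |Real.Gamma (3 - α)
        * partialSum (partialSum (partialSum (weight2 α))) (k + i)
        - ((k : ℝ) + i + 3 / 2) ^ (2 - α)| ≤ C * ((k : ℝ) + 1) ^ (-α) := by
      intro i
      have h := hS (k + i)
      push_cast at h
      refine h.trans ?_
      have hi : (0 : ℝ) ≤ i := i.cast_nonneg
      exact mul_le_mul_of_nonneg_left (hmono _ (by linarith)) hC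
    have c0 := comb _ _ (by push_cast; linarith)
      (by rw [hsk]; push_cast; nlinarith) (hS' 2)
    have c1 := comb _ _ (by push_cast; linarith)
      (by rw [hsk]; push_cast; nlinarith) (hS' 1)
    have c2 := comb _ _ (by push_cast; linarith)
      (by rw [hsk]; push_cast; nlinarith) (hS' 0)
    rw [add_zero] at c2
    set X2 := partialSum (partialSum (partialSum (weight2 α))) (k + 2)
    set X1 := partialSum (partialSum (partialSum (weight2 α))) (k + 1)
    set X0 := partialSum (partialSum (partialSum (weight2 α))) k
    -- The three-point weights have zero first moment about `s` at the nodes `k + i + 3/2`, so the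
    -- tangent terms inserted on the right cancel.
    have key : Real.Gamma (3 - α) * (θ ^ 2 * X2 + (1 + 2 * θ - 2 * θ ^ 2) * X1 + (1 - θ) ^ 2 * X0
          - 2 / Real.Gamma (3 - α) * s ^ (2 - α))
        = θ ^ 2 * (Real.Gamma (3 - α) * X2 - s ^ (2 - α)
            - (2 - α) * s ^ (1 - α) * (k + (2 : ℕ) + 3 / 2 - s))
          + (1 + 2 * θ - 2 * θ ^ 2) * (Real.Gamma (3 - α) * X1 - s ^ (2 - α)
            - (2 - α) * s ^ (1 - α) * (k + (1 : ℕ) + 3 / 2 - s))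
          + (1 - θ) ^ 2 * (Real.Gamma (3 - α) * X0 - s ^ (2 - α)
            - (2 - α) * s ^ (1 - α) * (k + (0 : ℕ) + 3 / 2 - s)) := by
      have hm : Real.Gamma (3 - α) * (2 / Real.Gamma (3 - α)) = 2 := by field_simp
      have hk' : (k : ℝ) = s - 2 - θ := by linarith
      rw [mul_sub, ← mul_assoc, hm, hk']
      push_cast
      ring
    have fin : |Real.Gamma (3 - α) * (θ ^ 2 * X2 + (1 + 2 * θ - 2 * θ ^ 2) * X1
        + (1 - θ) ^ 2 * X0 - 2 / Real.Gamma (3 - α) * s ^ (2 - α))|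
        ≤ 2 * ((C + 9 / 2) * ((k : ℝ) + 1) ^ (-α)) := by
      rw [key]
      exact abs_threePoint_le hθ0 hθ1 c0 c1 c2
    rw [abs_mul, abs_of_pos hΓ, mul_comm, ← le_div_iff₀ hΓ] at fin
    refine fin.trans ?_
    calc 2 * ((C + 9 / 2) * ((k : ℝ) + 1) ^ (-α)) / Real.Gamma (3 - α)
        ≤ 2 * ((C + 9 / 2) * (3 * s ^ (-α))) / Real.Gamma (3 - α) := by gcongr
      _ = D * s ^ (-α) := by rw [hD]; ring
      _ ≤ (D + E) * s ^ (-α) := by nlinarith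

/-! ### Positivity of the symbol and of the Riesz sums. -/

/-- The sum of the arguments lies in `(-π, π)`, and nonnegativity of `Re (w₁ w₂)` confines it to
`[-π/2, π/2]`; multiplication by `α` keeps it there. -/
lemma re_cpow_mul_cpow_nonneg {α : ℝ} (h0 : 0 < α) (h1 : α < 1) {w₁ w₂ : ℂ} (hw₁ : 0 < w₁.re)
    (hw₂ : 0 < w₂.re) (hw : 0 ≤ (w₁ * w₂).re) : 0 ≤ (w₁ ^ (α : ℂ) * w₂ ^ (α : ℂ)).re := by
  have n1 : w₁ ≠ 0 := by rintro rfl; simp at hw₁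
  have n2 : w₂ ≠ 0 := by rintro rfl; simp at hw₂
  have a1 := abs_lt.1 (Complex.abs_arg_lt_pi_div_two_iff.2 (Or.inl hw₁))
  have a2 := abs_lt.1 (Complex.abs_arg_lt_pi_div_two_iff.2 (Or.inl hw₂))
  have hre : (w₁ * w₂).re = ‖w₁‖ * ‖w₂‖ * Real.cos (w₁.arg + w₂.arg) := by
    rw [Complex.mul_re, Real.cos_add]
    have c1 := Complex.norm_mul_cos_arg w₁
    have c2 := Complex.norm_mul_cos_arg w₂
    have s1 := Complex.norm_mul_sin_arg w₁
    have s2 := Complex.norm_mul_sin_arg w₂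
    rw [← c1, ← c2, ← s1, ← s2]
    ring
  have hcos : 0 ≤ Real.cos (w₁.arg + w₂.arg) := by
    have p : 0 < ‖w₁‖ * ‖w₂‖ := by positivity
    rw [hre] at hw
    exact nonneg_of_mul_nonneg_right hw p
  have hsum : |w₁.arg + w₂.arg| ≤ Real.pi / 2 := by
    by_contra! h
    have := Real.cos_neg_of_pi_div_two_lt_of_lt h
      (by rw [show Real.pi + Real.pi / 2 = Real.pi / 2 + Real.pi by ring]
          have : |w₁.arg + w₂.arg| < Real.pi := abs_lt.2 ⟨by linarith, by linarith⟩
          linarith [Real.pi_pos])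
    rw [Real.cos_abs] at this
    linarith
  rw [Complex.cpow_def_of_ne_zero n1, Complex.cpow_def_of_ne_zero n2, ← Complex.exp_add,
    Complex.exp_re]
  refine mul_nonneg (Real.exp_pos _).le (Real.cos_nonneg_of_mem_Icc ?_)
  have e : (Complex.log w₁ * α + Complex.log w₂ * α).im = (w₁.arg + w₂.arg) * α := by
    simp [Complex.log_im, add_mul]
  rw [e, Set.mem_Icc, ← abs_le, abs_mul, abs_of_pos h0]
  nlinarith [abs_nonneg (w₁.arg + w₂.arg), Real.pi_pos]

/-- With `x = Re z` and `|z| < 1`, `Re ((1 - z)(1 - z/3))` exceeds `(2/3)(1 - x)²`. -/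
lemma re_hasSum_weight2_nonneg {α : ℝ} (h0 : 0 < α) (h1 : α < 1) {z : ℂ} (hz : ‖z‖ < 1) :
    0 ≤ ((((3 / 2 : ℝ) ^ α : ℝ) : ℂ) * ((1 - z) ^ (α : ℂ) * (1 - z / 3) ^ (α : ℂ))).re := by
  rw [Complex.re_ofReal_mul]
  have hre : |z.re| < 1 := (Complex.abs_re_le_norm z).trans_lt hz
  have hn : z.re ^ 2 + z.im ^ 2 < 1 := by
    have h := Complex.sq_norm z
    rw [Complex.normSq_apply] at h
    nlinarith [norm_nonneg z]
  rw [abs_lt] at hre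
  have e3 : z / 3 = ((1 / 3 : ℝ) : ℂ) * z := by push_cast; ring
  refine mul_nonneg (by positivity) (re_cpow_mul_cpow_nonneg h0 h1 ?_ ?_ ?_)
  · simp; linarith
  · rw [e3]
    simp
    linarith
  · rw [e3]
    simp
    nlinarith [sq_nonneg (1 - z.re)]

lemma summable_weight2_mul {α : ℝ} (h0 : 0 < α) (h1 : α < 1) {x : ℕ → ℝ} (hx : ∀ l, |x l| ≤ 1) :
    Summable fun l => weight2 α l * x l :=
  Summable.of_norm_bounded (summable_abs_weight2 h0 h1) fun l => by
    rw [Real.norm_eq_abs, abs_mul]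
    exact mul_le_of_le_one_right (abs_nonneg _) (hx l)

/-- The real part of the generating function of the weights is nonnegative on the unit circle. -/
lemma tsum_weight2_mul_cos_nonneg {α : ℝ} (h0 : 0 < α) (h1 : α < 1) (θ : ℝ) :
    0 ≤ ∑' l : ℕ, weight2 α l * Real.cos (l * θ) := by
  -- Abel summation: positivity is known for radius `r < 1`, and absolute summability of the weights
  -- makes `f` continuous up to `r = 1`.
  set f : ℝ → ℝ := fun r => ∑' l : ℕ, weight2 α l * (r ^ l * Real.cos (l * θ)) with hf
  have hcont : ContinuousOn f (Set.Icc 0 1) := by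
    refine continuousOn_tsum (fun l => by fun_prop) (summable_abs_weight2 h0 h1) ?_
    intro l r hr
    rw [Real.norm_eq_abs, abs_mul, abs_mul, abs_pow, abs_of_nonneg hr.1]
    exact mul_le_of_le_one_right (abs_nonneg _)
      (mul_le_one₀ (pow_le_one₀ hr.1 hr.2) (abs_nonneg _) (Real.abs_cos_le_one _))
  have hpos : ∀ r ∈ Set.Ico (0 : ℝ) 1, 0 ≤ f r := by
    intro r hr
    set z : ℂ := r * Complex.exp (θ * Complex.I) with hz
    have hzn : ‖z‖ < 1 := by
      rw [hz, norm_mul, Complex.norm_exp_ofReal_mul_I, mul_one, Complex.norm_real,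
        Real.norm_eq_abs, abs_of_nonneg hr.1]
      exact hr.2
    have h := Complex.hasSum_re (hasSum_weight2_mul_pow h0 h1 hzn)
    have e : ∀ l : ℕ, ((weight2 α l : ℂ) * z ^ l).re
        = weight2 α l * (r ^ l * Real.cos (l * θ)) := by
      intro l
      rw [hz, mul_pow, ← Complex.exp_nat_mul, Complex.re_ofReal_mul, ← Complex.ofReal_pow,
        Complex.re_ofReal_mul, ← mul_assoc (l : ℂ)]
      have : (l : ℂ) * (θ : ℂ) = ((l * θ : ℝ) : ℂ) := by push_cast; ring
      rw [this, Complex.exp_ofReal_mul_I_re]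
    simp only [e] at h
    rw [hf]
    simp only
    rw [h.tsum_eq]
    exact re_hasSum_weight2_nonneg h0 h1 hzn
  have h1' : f 1 = ∑' l : ℕ, weight2 α l * Real.cos (l * θ) := by simp [hf]
  rw [← h1']
  have hcl : (1 : ℝ) ∈ closure (Set.Ico (0 : ℝ) 1) := by
    rw [closure_Ico (by norm_num)]
    simp
  have := (hcont 1 (by simp)).mono (Set.Ico_subset_Icc_self)
  have hne : (𝓝[Set.Ico (0 : ℝ) 1] 1).NeBot := mem_closure_iff_nhdsWithin_neBot.1 hcl
  exact ge_of_tendsto this (by filter_upwards [self_mem_nhdsWithin] with r hr using hpos r hr)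

lemma integral_cos_int_mul (m : ℤ) :
    ∫ θ in (0 : ℝ)..(2 * Real.pi), Real.cos (m * θ) = if m = 0 then 2 * Real.pi else 0 := by
  split_ifs with h
  · simp [h]
  · have hm : (m : ℝ) ≠ 0 := by exact_mod_cast h
    rw [intervalIntegral.integral_comp_mul_left (fun x => Real.cos x) hm, integral_cos]
    have : Real.sin (m * (2 * Real.pi)) = 0 := by
      have := Real.sin_int_mul_pi (2 * m)
      push_cast at this
      rw [← this]
      ring_nf
    simp [this]

lemma integral_cos_mul_cos (l : ℕ) (j k : ℕ) :
    ∫ θ in (0 : ℝ)..(2 * Real.pi), Real.cos (l * θ) * Real.cos (((j : ℝ) - k) * θ)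
      = Real.pi * ((if j = k + l then 1 else 0) + if k = j + l then 1 else 0) := by
  have e : ∀ θ : ℝ, Real.cos (l * θ) * Real.cos (((j : ℝ) - k) * θ)
      = 1 / 2 * (Real.cos (((l - (j - k) : ℤ) : ℝ) * θ)
        + Real.cos (((l + (j - k) : ℤ) : ℝ) * θ)) := by
    intro θ
    push_cast
    rw [sub_mul (l : ℝ), add_mul (l : ℝ), Real.cos_add, Real.cos_sub]
    ring
  simp only [e]
  rw [intervalIntegral.integral_const_mul, intervalIntegral.integral_add
    (Continuous.intervalIntegrable (by fun_prop) _ _)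
    (Continuous.intervalIntegrable (by fun_prop) _ _), integral_cos_int_mul, integral_cos_int_mul]
  have e1 : ((l : ℤ) - (j - k) = 0) ↔ j = k + l := by omega
  have e2 : ((l : ℤ) + (j - k) = 0) ↔ k = j + l := by omega
  simp only [e1, e2]
  split_ifs <;> ring

/-- The quadratic form `∑ ϖ_{j-k} w_j w_k` is nonnegative. -/
lemma weight2_quadForm_nonneg {α : ℝ} (h0 : 0 < α) (h1 : α < 1) (n : ℕ) (w : ℕ → ℝ) :
    0 ≤ ∑ l ∈ range n, weight2 α l *
      ∑ j ∈ range n, ∑ k ∈ range n, if j = k + l then w j * w k else 0 := by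
  -- `P θ = |∑ w_j e^{ijθ}|²`; the quadratic form is the mean over a period of the nonnegative
  -- symbol times `P`.
  set P : ℝ → ℝ := fun θ => ∑ j ∈ range n, ∑ k ∈ range n,
    w j * w k * Real.cos (((j : ℝ) - k) * θ) with hP
  have hPsq : ∀ θ, P θ = (∑ j ∈ range n, w j * Real.cos (j * θ)) ^ 2
      + (∑ j ∈ range n, w j * Real.sin (j * θ)) ^ 2 := by
    intro θ
    rw [hP, sq, sq, sum_mul_sum, sum_mul_sum, ← sum_add_distrib]
    refine sum_congr rfl fun j _ => ?_
    rw [← sum_add_distrib]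
    refine sum_congr rfl fun k _ => ?_
    rw [sub_mul, Real.cos_sub]
    ring
  have hPc : Continuous P := by rw [hP]; fun_prop
  have hPn : ∀ θ, 0 ≤ P θ := fun θ => by rw [hPsq]; positivity
  obtain ⟨B, hB⟩ : ∃ B, ∀ θ, |P θ| ≤ B := by
    refine ⟨∑ j ∈ range n, ∑ k ∈ range n, |w j * w k|, fun θ => ?_⟩
    refine (abs_sum_le_sum_abs _ _).trans (sum_le_sum fun j _ => ?_)
    refine (abs_sum_le_sum_abs _ _).trans (sum_le_sum fun k _ => ?_)
    rw [abs_mul]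
    exact mul_le_of_le_one_right (abs_nonneg _) (Real.abs_cos_le_one _)
  have hI : HasSum (fun l : ℕ => ∫ θ in (0 : ℝ)..(2 * Real.pi),
      weight2 α l * Real.cos (l * θ) * P θ)
      (∫ θ in (0 : ℝ)..(2 * Real.pi), (∑' l : ℕ, weight2 α l * Real.cos (l * θ)) * P θ) := by
    refine intervalIntegral.hasSum_integral_of_dominated_convergence
      (fun l _ => |weight2 α l| * B) (fun l => ?_) (fun l => ?_) ?_ ?_ ?_
    · exact (by fun_prop : Continuous fun θ : ℝ =>
        weight2 α l * Real.cos (l * θ) * P θ).aestronglyMeasurable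
    · refine Eventually.of_forall fun θ _ => ?_
      rw [Real.norm_eq_abs, abs_mul, abs_mul]
      exact mul_le_mul (mul_le_of_le_one_right (abs_nonneg _) (Real.abs_cos_le_one _)) (hB θ)
        (abs_nonneg _) (abs_nonneg _)
    · exact Eventually.of_forall fun θ _ => (summable_abs_weight2 h0 h1).mul_right B
    · exact intervalIntegrable_const
    · refine Eventually.of_forall fun θ _ => HasSum.mul_right _ ?_
      exact (summable_weight2_mul h0 h1 fun l => Real.abs_cos_le_one _).hasSum
  have hIn : 0 ≤ ∫ θ in (0 : ℝ)..(2 * Real.pi),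
      (∑' l : ℕ, weight2 α l * Real.cos (l * θ)) * P θ :=
    intervalIntegral.integral_nonneg (by positivity) fun θ _ =>
      mul_nonneg (tsum_weight2_mul_cos_nonneg h0 h1 θ) (hPn θ)
  have hterm : ∀ l : ℕ, ∫ θ in (0 : ℝ)..(2 * Real.pi), weight2 α l * Real.cos (l * θ) * P θ
      = 2 * Real.pi * (weight2 α l *
        ∑ j ∈ range n, ∑ k ∈ range n, if j = k + l then w j * w k else 0) := by
    intro l
    have e : ∀ θ : ℝ, weight2 α l * Real.cos (l * θ) * P θ = ∑ j ∈ range n, ∑ k ∈ range n,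
        weight2 α l * (w j * w k) * (Real.cos (l * θ) * Real.cos (((j : ℝ) - k) * θ)) := by
      intro θ
      rw [hP]
      simp only [mul_sum]
      refine sum_congr rfl fun j _ => sum_congr rfl fun k _ => ?_
      ring
    simp only [e]
    rw [intervalIntegral.integral_finsetSum fun j _ =>
      Continuous.intervalIntegrable (by fun_prop) _ _]
    have e2 : ∀ j : ℕ, ∫ θ in (0 : ℝ)..(2 * Real.pi), ∑ k ∈ range n,
        weight2 α l * (w j * w k) * (Real.cos (l * θ) * Real.cos (((j : ℝ) - k) * θ))
        = ∑ k ∈ range n, weight2 α l * (w j * w k) *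
          (Real.pi * ((if j = k + l then 1 else 0) + if k = j + l then 1 else 0)) := by
      intro j
      rw [intervalIntegral.integral_finsetSum fun k _ =>
        Continuous.intervalIntegrable (by fun_prop) _ _]
      refine sum_congr rfl fun k _ => ?_
      rw [intervalIntegral.integral_const_mul, integral_cos_mul_cos]
    simp only [e2]
    -- Orthogonality of the cosines produces the `l`-th form and its transpose; they agree because
    -- `w j * w k` is symmetric.
    have s1 : ∑ j ∈ range n, ∑ k ∈ range n, (if k = j + l then w j * w k else 0)
        = ∑ j ∈ range n, ∑ k ∈ range n, if j = k + l then w j * w k else 0 := by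
      rw [sum_comm]
      refine sum_congr rfl fun j _ => sum_congr rfl fun k _ => ?_
      rw [mul_comm]
    rw [two_mul, add_mul]
    nth_rewrite 2 [← s1]
    simp only [mul_sum]
    rw [← sum_add_distrib]
    refine sum_congr rfl fun j _ => ?_
    rw [← sum_add_distrib]
    refine sum_congr rfl fun k _ => ?_
    split_ifs <;> ring
  simp only [hterm] at hI
  have hfin := hasSum_sum_of_ne_finset_zero (L := SummationFilter.unconditional ℕ) (s := range n)
    (f := fun l => 2 * Real.pi *
    (weight2 α l * ∑ j ∈ range n, ∑ k ∈ range n, if j = k + l then w j * w k else 0)) <| by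
    intro l hl
    have hl : n ≤ l := by simpa using hl
    have : ∑ j ∈ range n, ∑ k ∈ range n, (if j = k + l then w j * w k else 0) = 0 := by
      refine sum_eq_zero fun j hj => sum_eq_zero fun k _ => if_neg ?_
      have := mem_range.1 hj
      omega
    rw [this]
    ring
  have := hI.unique hfin
  rw [this, ← mul_sum] at hIn
  exact nonneg_of_mul_nonneg_right hIn (by positivity)

/-- The left and the right sums are transposed triangular Toeplitz matrices, hence have the same
quadratic form. -/
lemma sum_mul_rieszSum (α : ℝ) (M : ℕ) (w : ℕ → ℝ) :
    ∑ j ∈ range (M + 1), w j * rieszSum α M w j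
      = 2 * ∑ l ∈ range (M + 1), weight2 α l *
        ∑ j ∈ range (M + 1), ∑ k ∈ range (M + 1), if j = k + l then w j * w k else 0 := by
  have q1 : ∑ j ∈ range (M + 1), w j * ∑ l ∈ range (j + 1), weight2 α l * w (j - l)
      = ∑ l ∈ range (M + 1), weight2 α l *
        ∑ j ∈ range (M + 1), ∑ k ∈ range (M + 1), if j = k + l then w j * w k else 0 := by
    simp only [mul_sum]
    rw [sum_comm (s := range (M + 1)) (t := range (M + 1))]
    refine sum_congr rfl fun j hj => ?_
    have hj := mem_range.1 hj
    rw [← sum_subset (range_subset_range.2 (show j + 1 ≤ M + 1 by omega))]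
    · refine sum_congr rfl fun l hl => ?_
      have hl := mem_range.1 hl
      rw [sum_eq_single (j - l)]
      · rw [if_pos (by omega)]
        ring
      · intro k _ hk
        rw [if_neg (by omega), mul_zero]
      · intro h
        exact absurd (mem_range.2 (by omega)) h
    · intro l _ hl
      have hl : j + 1 ≤ l := by simpa using hl
      refine sum_eq_zero fun k _ => ?_
      rw [if_neg (by omega), mul_zero]
  have q2 : ∑ j ∈ range (M + 1), w j * ∑ l ∈ range (M - j + 1), weight2 α l * w (j + l)
      = ∑ l ∈ range (M + 1), weight2 α l *
        ∑ j ∈ range (M + 1), ∑ k ∈ range (M + 1), if j = k + l then w j * w k else 0 := by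
    have sw : ∀ l, ∑ j ∈ range (M + 1), ∑ k ∈ range (M + 1), (if j = k + l then w j * w k else 0)
        = ∑ k ∈ range (M + 1), ∑ j ∈ range (M + 1), if j = k + l then w j * w k else 0 :=
      fun l => sum_comm
    simp only [sw]
    simp only [mul_sum]
    rw [sum_comm (s := range (M + 1)) (t := range (M + 1))]
    refine sum_congr rfl fun k hk => ?_
    have hk := mem_range.1 hk
    rw [← sum_subset (range_subset_range.2 (show M - k + 1 ≤ M + 1 by omega))]
    · refine sum_congr rfl fun l hl => ?_
      have hl := mem_range.1 hl
      rw [sum_eq_single (k + l)]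
      · rw [if_pos rfl]
        ring
      · intro j _ hj
        rw [if_neg hj, mul_zero]
      · intro h
        exact absurd (mem_range.2 (by omega)) h
    · intro l _ hl
      have hl : M - k + 1 ≤ l := by simpa using hl
      refine sum_eq_zero fun j hj => ?_
      have hj := mem_range.1 hj
      rw [if_neg (by omega), mul_zero]
  rw [two_mul]
  nth_rewrite 1 [← q1]
  rw [← q2, ← sum_add_distrib]
  refine sum_congr rfl fun j _ => ?_
  rw [rieszSum]
  ring

lemma sum_Ioo_eq_sum_range_succ {M : ℕ} (f : ℕ → ℝ) (h0 : f 0 = 0) (hM : f M = 0) :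
    ∑ j ∈ Ioo 0 M, f j = ∑ j ∈ range (M + 1), f j := by
  refine sum_subset (fun j hj => ?_) fun j hj hj' => ?_
  · have := mem_Ioo.1 hj
    exact mem_range.2 (by omega)
  · have h1 := mem_range.1 hj
    have h2 : ¬ (0 < j ∧ j < M) := fun h => hj' (mem_Ioo.2 h)
    rcases Nat.eq_zero_or_pos j with h | h
    · rw [h, h0]
    · rw [show j = M by omega, hM]

lemma sum_mul_rieszSum_nonneg {α : ℝ} (h0 : 0 < α) (h1 : α < 1) {M : ℕ} {w : ℕ → ℝ}
    (hw0 : w 0 = 0) (hwM : w M = 0) : 0 ≤ ∑ j ∈ Ioo 0 M, w j * rieszSum α M w j := by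
  rw [sum_Ioo_eq_sum_range_succ _ (by simp [hw0]) (by simp [hwM]), sum_mul_rieszSum]
  exact mul_nonneg zero_le_two (weight2_quadForm_nonneg h0 h1 _ _)

lemma cos_half_pi_mul_pos {α : ℝ} (h0 : 0 < α) (h1 : α < 1) : 0 < Real.cos (Real.pi * α / 2) :=
  Real.cos_pos_of_mem_Ioo ⟨by nlinarith [Real.pi_pos], by nlinarith [Real.pi_pos]⟩

lemma nu_pos {α dα h : ℝ} (h0 : 0 < α) (h1 : α < 1) (hdα : 0 < dα) (hh : 0 < h) :
    0 < nu α dα h := by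
  have := cos_half_pi_mul_pos h0 h1
  rw [nu]
  positivity

/-! ### Von Neumann stability -/

lemma summable_weight2_mul_exp {α : ℝ} (h0 : 0 < α) (h1 : α < 1) (θ : ℝ) :
    Summable fun l : ℕ => (weight2 α l : ℂ) * Complex.exp (Complex.I * l * θ) :=
  Summable.of_norm_bounded (summable_abs_weight2 h0 h1) fun l => by
    rw [norm_mul, Complex.norm_real, show Complex.I * l * θ = ((l * θ : ℝ) : ℂ) * Complex.I by
      push_cast; ring, Complex.norm_exp_ofReal_mul_I, mul_one, Real.norm_eq_abs]

lemma mode_sub_eq (c : ℂ) (θ : ℝ) (j : ℤ) (l : ℕ) :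
    c * Complex.exp (Complex.I * (j - l : ℤ) * θ)
      = c * Complex.exp (Complex.I * j * θ) * Complex.exp (Complex.I * l * (-θ : ℝ)) := by
  rw [mul_assoc c, ← Complex.exp_add]
  push_cast
  ring_nf

lemma mode_add_eq (c : ℂ) (θ : ℝ) (j : ℤ) (l : ℕ) :
    c * Complex.exp (Complex.I * (j + l : ℤ) * θ)
      = c * Complex.exp (Complex.I * j * θ) * Complex.exp (Complex.I * l * θ) := by
  rw [mul_assoc c, ← Complex.exp_add]
  push_cast
  ring_nf

/-- Fourier modes are eigenvectors: left and right shifts contribute conjugate exponentials, so only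
the cosine series survives. -/
lemma rieszSeries_mode {α : ℝ} (h0 : 0 < α) (h1 : α < 1) (c : ℂ) (θ : ℝ) (j : ℤ) :
    rieszSeries α (fun j => c * Complex.exp (Complex.I * j * θ)) j
      = c * Complex.exp (Complex.I * j * θ)
        * ((2 * ∑' l : ℕ, weight2 α l * Real.cos (l * θ) : ℝ) : ℂ) := by
  have s1 := summable_weight2_mul_exp h0 h1 (-θ)
  have s2 := summable_weight2_mul_exp h0 h1 θ
  simp only [rieszSeries, mode_sub_eq, mode_add_eq, mul_left_comm (weight2 α _ : ℂ)]
  rw [tsum_mul_left, tsum_mul_left, ← mul_add, ← s1.tsum_add s2]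
  congr 1
  push_cast
  rw [← tsum_mul_left]
  refine tsum_congr fun l => ?_
  rw [Complex.cos]
  rw [show Complex.I * l * -θ = -(l * θ) * Complex.I by ring,
    show Complex.I * l * θ = l * θ * Complex.I by ring]
  ring

/-- The Fourier symbol of the spatial part of the scheme. -/
noncomputable def symbol (α d1 d2 dα h θ : ℝ) : ℂ :=
  ⟨-(2 * d2 / h ^ 2) * (1 - Real.cos θ)
    - 2 * nu α dα h * ∑' l : ℕ, weight2 α l * Real.cos (l * θ), -(d1 / h) * Real.sin θ⟩

/-- On a mode the scheme is the scalar Crank–Nicolson step for the symbol, multiplied by the mode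
itself. -/
lemma isAmplificationFactor_iff {α d1 d2 dα h τ θ : ℝ} (h0 : 0 < α) (h1 : α < 1) (ξ : ℂ) :
    IsAmplificationFactor α d1 d2 dα h τ θ ξ ↔
      ξ * ((2 / τ : ℝ) - symbol α d1 d2 dα h θ) = (2 / τ : ℝ) + symbol α d1 d2 dα h θ := by
  have hsym : ((d2 / h ^ 2 + d1 / (2 * h) : ℝ) : ℂ) * Complex.exp (Complex.I * (1 : ℕ) * (-θ : ℝ))
      - ((2 * d2 / h ^ 2 : ℝ) : ℂ)
      + ((d2 / h ^ 2 - d1 / (2 * h) : ℝ) : ℂ) * Complex.exp (Complex.I * (1 : ℕ) * θ)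
      - (nu α dα h : ℂ) * ((2 * ∑' l : ℕ, weight2 α l * Real.cos (l * θ) : ℝ) : ℂ)
      = symbol α d1 d2 dα h θ := by
    have e1 : Complex.exp (Complex.I * (1 : ℕ) * (-θ : ℝ))
        = ((Real.cos θ : ℝ) : ℂ) - ((Real.sin θ : ℝ) : ℂ) * Complex.I := by
      rw [show Complex.I * (1 : ℕ) * (-θ : ℝ) = (-θ : ℝ) * Complex.I by push_cast; ring,
        Complex.exp_ofReal_mul_I, Real.cos_neg, Real.sin_neg]
      push_cast
      ring
    have e2 : Complex.exp (Complex.I * (1 : ℕ) * θ)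
        = ((Real.cos θ : ℝ) : ℂ) + ((Real.sin θ : ℝ) : ℂ) * Complex.I := by
      rw [show Complex.I * (1 : ℕ) * (θ : ℂ) = θ * Complex.I by push_cast; ring,
        Complex.exp_ofReal_mul_I]
    rw [e1, e2]
    apply Complex.ext
    · simp only [Complex.sub_re, Complex.add_re, Complex.re_ofReal_mul, Complex.ofReal_re, symbol,
        Complex.I_re]
      ring
    · simp only [Complex.sub_im, Complex.add_im, Complex.im_ofReal_mul, Complex.ofReal_im, symbol,
        Complex.I_im]
      ring
  have hstep : ∀ (k : ℕ) (j : ℤ),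
      (((d2 / h ^ 2 + d1 / (2 * h) : ℝ) : ℂ)
            * (ξ ^ (k + 1) * Complex.exp (Complex.I * (j - 1 : ℤ) * θ))
        - ((2 / τ + 2 * d2 / h ^ 2 : ℝ) : ℂ) * (ξ ^ (k + 1) * Complex.exp (Complex.I * j * θ))
        + ((d2 / h ^ 2 - d1 / (2 * h) : ℝ) : ℂ)
            * (ξ ^ (k + 1) * Complex.exp (Complex.I * (j + 1 : ℤ) * θ))
        - (nu α dα h : ℂ) * rieszSeries α
            (fun j => ξ ^ (k + 1) * Complex.exp (Complex.I * j * θ)) j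
      = -((d2 / h ^ 2 + d1 / (2 * h) : ℝ) : ℂ)
            * (ξ ^ k * Complex.exp (Complex.I * (j - 1 : ℤ) * θ))
        - ((2 / τ - 2 * d2 / h ^ 2 : ℝ) : ℂ) * (ξ ^ k * Complex.exp (Complex.I * j * θ))
        - ((d2 / h ^ 2 - d1 / (2 * h) : ℝ) : ℂ)
            * (ξ ^ k * Complex.exp (Complex.I * (j + 1 : ℤ) * θ))
        + (nu α dα h : ℂ) * rieszSeries α
            (fun j => ξ ^ k * Complex.exp (Complex.I * j * θ)) j) ↔
      ξ ^ k * Complex.exp (Complex.I * j * θ)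
          * (ξ * ((2 / τ : ℝ) - symbol α d1 d2 dα h θ))
        = ξ ^ k * Complex.exp (Complex.I * j * θ)
          * ((2 / τ : ℝ) + symbol α d1 d2 dα h θ) := by
    intro k j
    have m1 := fun c => mode_sub_eq c θ j 1
    have m2 := fun c => mode_add_eq c θ j 1
    rw [Nat.cast_one] at m1 m2
    rw [rieszSeries_mode h0 h1, rieszSeries_mode h0 h1, m1, m1, m2, m2, ← hsym]
    push_cast
    constructor
    · intro H
      linear_combination (-1 : ℂ) * H
    · intro H
      linear_combination (-1 : ℂ) * H
  constructor
  -- At `k = 0`, `j = 0` the mode equals `1`, so no division by a possibly vanishing power of `ξ`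
  -- occurs.
  · intro H
    have := (hstep 0 0).1 (H.step 0 0)
    simpa using this
  · intro H
    refine ⟨fun k j => ?_, fun k j => ?_, fun k j => (hstep k j).2 (by rw [H])⟩
    · simp only [mode_sub_eq, mul_left_comm (weight2 α _ : ℂ)]
      exact (summable_weight2_mul_exp h0 h1 (-θ)).mul_left _
    · simp only [mode_add_eq, mul_left_comm (weight2 α _ : ℂ)]
      exact (summable_weight2_mul_exp h0 h1 θ).mul_left _

theorem isVonNeumannStable {α d1 d2 dα h τ : ℝ} (h0 : 0 < α) (h1 : α < 1) (hd2 : 0 < d2)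
    (hdα : 0 < dα) (hh : 0 < h) (hτ : 0 < τ) : IsVonNeumannStable α d1 d2 dα h τ := by
  intro θ _
  set P := symbol α d1 d2 dα h θ with hP
  have hre : P.re ≤ 0 := by
    have hν := nu_pos h0 h1 hdα hh
    have hS := tsum_weight2_mul_cos_nonneg h0 h1 θ
    have hc : 0 ≤ 2 * d2 / h ^ 2 * (1 - Real.cos θ) :=
      mul_nonneg (by positivity) (by linarith [Real.cos_le_one θ])
    have hνS : 0 ≤ 2 * nu α dα h * ∑' l : ℕ, weight2 α l * Real.cos (l * θ) := by positivity
    simp only [hP, symbol]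
    linarith
  have hτ2 : 0 < 2 / τ := by positivity
  have hne : ((2 / τ : ℝ) : ℂ) - P ≠ 0 := by
    intro H
    have := congrArg Complex.re H
    rw [Complex.sub_re, Complex.ofReal_re, Complex.zero_re] at this
    linarith
  refine ⟨((2 / τ : ℝ) + P) / ((2 / τ : ℝ) - P), ?_, ?_, ?_⟩
  · rw [isAmplificationFactor_iff h0 h1]
    exact div_mul_cancel₀ _ hne
  · rw [norm_div]
    refine div_le_one_of_le₀ ?_ (norm_nonneg _)
    -- With `c = 2/τ`, `|c + P|² - |c - P|² = 4c Re P ≤ 0`.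
    rw [← sq_le_sq₀ (norm_nonneg _) (norm_nonneg _), Complex.sq_norm, Complex.sq_norm,
      Complex.normSq_apply, Complex.normSq_apply]
    simp only [Complex.add_re, Complex.sub_re, Complex.ofReal_re, Complex.add_im, Complex.sub_im,
      Complex.ofReal_im]
    nlinarith
  · intro ζ hζ
    rw [isAmplificationFactor_iff h0 h1] at hζ
    rw [eq_div_iff hne, hζ]

/-! ### The spatial operator of the scheme -/

/-- The discretization of `-d₁ ∂ₓ + d₂ ∂ₓ² + d_α ∂^α/∂|x|^α` used by the scheme. -/
noncomputable def spatialOp (α d1 d2 dα h : ℝ) (M : ℕ) (w : ℕ → ℝ) (j : ℕ) : ℝ :=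
  (d2 / h ^ 2 + d1 / (2 * h)) * w (j - 1) - 2 * d2 / h ^ 2 * w j
    + (d2 / h ^ 2 - d1 / (2 * h)) * w (j + 1) - nu α dα h * rieszSum α M w j

lemma rieszSum_linear (α : ℝ) (M : ℕ) (c : ℝ) (v w : ℕ → ℝ) (j : ℕ) :
    rieszSum α M (fun i => v i + c * w i) j = rieszSum α M v j + c * rieszSum α M w j := by
  simp only [rieszSum, mul_add, sum_add_distrib, mul_sum, mul_left_comm c]
  ring

lemma spatialOp_linear (α d1 d2 dα h : ℝ) (M : ℕ) (c : ℝ) (v w : ℕ → ℝ) (j : ℕ) :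
    spatialOp α d1 d2 dα h M (fun i => v i + c * w i) j
      = spatialOp α d1 d2 dα h M v j + c * spatialOp α d1 d2 dα h M w j := by
  simp only [spatialOp, rieszSum_linear]
  ring

lemma sum_Ioo_zero_succ (m : ℕ) (f : ℕ → ℝ) :
    ∑ j ∈ Ioo 0 (m + 1), f j = ∑ i ∈ range m, f (i + 1) := by
  have : Ioo 0 (m + 1) = Ico 1 (m + 1) := by ext; simp; omega
  rw [this, sum_Ico_eq_sum_range]
  simp [add_comm]

/-- Summation by parts: the drift is skew and disappears, the diffusion gives the squared
differences, and the Riesz sums enter with a favourable sign. -/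
lemma sum_mul_spatialOp_le {α d1 d2 dα h : ℝ} (h0 : 0 < α) (h1 : α < 1) (hdα : 0 < dα)
    (hh : 0 < h) {M : ℕ} {w : ℕ → ℝ} (hw0 : w 0 = 0) (hwM : w M = 0) :
    ∑ j ∈ Ioo 0 M, w j * spatialOp α d1 d2 dα h M w j
      ≤ -(d2 / h ^ 2) * ∑ i ∈ range M, (w (i + 1) - w i) ^ 2 := by
  have hR : 0 ≤ nu α dα h * ∑ j ∈ Ioo 0 M, w j * rieszSum α M w j :=
    mul_nonneg (nu_pos h0 h1 hdα hh).le (sum_mul_rieszSum_nonneg h0 h1 hw0 hwM)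
  cases M with
  | zero => simp
  | succ m =>
    have e : ∑ j ∈ Ioo 0 (m + 1), w j * spatialOp α d1 d2 dα h (m + 1) w j
        = (d2 / h ^ 2 + d1 / (2 * h)) * ∑ j ∈ Ioo 0 (m + 1), w j * w (j - 1)
          - 2 * d2 / h ^ 2 * ∑ j ∈ Ioo 0 (m + 1), w j ^ 2
          + (d2 / h ^ 2 - d1 / (2 * h)) * ∑ j ∈ Ioo 0 (m + 1), w j * w (j + 1)
          - nu α dα h * ∑ j ∈ Ioo 0 (m + 1), w j * rieszSum α (m + 1) w j := by
      simp only [mul_sum, ← sum_add_distrib, ← sum_sub_distrib]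
      refine sum_congr rfl fun j _ => ?_
      rw [spatialOp]
      ring
    have s1 : ∑ j ∈ Ioo 0 (m + 1), w j * w (j - 1)
        = ∑ i ∈ range (m + 1), w (i + 1) * w i := by
      rw [sum_Ioo_zero_succ, sum_range_succ, hwM]
      simp
    have s2 : ∑ j ∈ Ioo 0 (m + 1), w j * w (j + 1)
        = ∑ i ∈ range (m + 1), w (i + 1) * w i := by
      rw [sum_Ioo_zero_succ, sum_range_succ', hw0]
      simp [mul_comm]
    have s3 : ∑ i ∈ range (m + 1), w (i + 1) ^ 2 = ∑ j ∈ Ioo 0 (m + 1), w j ^ 2 := by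
      rw [sum_Ioo_zero_succ, sum_range_succ, hwM]
      simp
    have s4 : ∑ i ∈ range (m + 1), w i ^ 2 = ∑ j ∈ Ioo 0 (m + 1), w j ^ 2 := by
      rw [sum_Ioo_zero_succ, sum_range_succ', hw0]
      simp
    have s5 : ∑ i ∈ range (m + 1), (w (i + 1) - w i) ^ 2
        = 2 * ∑ j ∈ Ioo 0 (m + 1), w j ^ 2 - 2 * ∑ i ∈ range (m + 1), w (i + 1) * w i := by
      rw [two_mul, mul_sum]
      nth_rewrite 1 [← s3]
      rw [← s4, ← sum_add_distrib, ← sum_sub_distrib]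
      refine sum_congr rfl fun i _ => ?_
      ring
    rw [e, s1, s2, s5]
    exact le_of_sub_nonneg (hR.trans_eq (by ring))

/-- Discrete Sobolev inequality: telescope from the zero boundary value and apply Cauchy–Schwarz. -/
lemma sq_le_mul_sum_sq_sub {w : ℕ → ℝ} (hw0 : w 0 = 0) {j M : ℕ} (hj : j ≤ M) :
    w j ^ 2 ≤ M * ∑ i ∈ range M, (w (i + 1) - w i) ^ 2 := by
  have e : w j = ∑ i ∈ range j, (w (i + 1) - w i) := by rw [sum_range_sub, hw0, sub_zero]
  have hM : (j : ℝ) ≤ M := by exact_mod_cast hj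
  calc w j ^ 2 = (∑ i ∈ range j, (w (i + 1) - w i)) ^ 2 := by rw [← e]
    _ ≤ (range j).card * ∑ i ∈ range j, (w (i + 1) - w i) ^ 2 := sq_sum_le_card_mul_sum_sq
    _ ≤ M * ∑ i ∈ range M, (w (i + 1) - w i) ^ 2 := by
        rw [card_range]
        exact mul_le_mul hM (sum_le_sum_of_subset_of_nonneg (range_subset_range.2 hj)
          fun _ _ _ => sq_nonneg _) (sum_nonneg fun _ _ => sq_nonneg _) (by positivity)

/-- Discrete energy estimate for the Crank–Nicolson scheme with residual `R`. -/
lemma energy_estimate {α d1 d2 dα h τ : ℝ} (h0 : 0 < α) (h1 : α < 1) (hd2 : 0 < d2)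
    (hdα : 0 < dα) (hh : 0 < h) (hτ : 0 < τ) {M N : ℕ} (hM : 0 < M) {e R : ℕ → ℕ → ℝ} {A : ℝ}
    (hleft : ∀ k ≤ N, e k 0 = 0) (hright : ∀ k ≤ N, e k M = 0)
    (hstep : ∀ k < N, ∀ j ∈ Ioo 0 M, 2 / τ * (e (k + 1) j - e k j)
      - (spatialOp α d1 d2 dα h M (e (k + 1)) j + spatialOp α d1 d2 dα h M (e k) j) = R k j)
    (hR : ∀ k < N, h * ∑ j ∈ Ioo 0 M, |R k j| ≤ A) (k : ℕ) (hk : k ≤ N) :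
    h * ∑ j ∈ Ioo 0 M, e k j ^ 2
      ≤ h * ∑ j ∈ Ioo 0 M, e 0 j ^ 2 + k * τ * (A ^ 2 * (M * h) / (8 * d2)) := by
  induction k with
  | zero => simp
  | succ k ih =>
    have hkN : k < N := hk
    have ih := ih hkN.le
    -- Testing with the sum of both levels turns the time difference into a difference of squares.
    -- The factor `1` fits `spatialOp_linear`.
    set w : ℕ → ℝ := fun j => e (k + 1) j + 1 * e k j with hw
    have hw0 : w 0 = 0 := by simp [hw, hleft _ hk, hleft _ hkN.le]
    have hwM : w M = 0 := by simp [hw, hright _ hk, hright _ hkN.le]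
    have hop := sum_mul_spatialOp_le (d1 := d1) (d2 := d2) h0 h1 hdα hh hw0 hwM
    set D := ∑ i ∈ range M, (w (i + 1) - w i) ^ 2 with hD
    have hD0 : 0 ≤ D := sum_nonneg fun _ _ => sq_nonneg _
    have hMp : (0 : ℝ) < M := by exact_mod_cast hM
    have hid : 2 / τ * (∑ j ∈ Ioo 0 M, e (k + 1) j ^ 2 - ∑ j ∈ Ioo 0 M, e k j ^ 2)
        = ∑ j ∈ Ioo 0 M, w j * spatialOp α d1 d2 dα h M w j + ∑ j ∈ Ioo 0 M, w j * R k j := by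
      rw [← sum_sub_distrib, mul_sum, ← sum_add_distrib]
      refine sum_congr rfl fun j hj => ?_
      rw [← hstep k hkN j hj, hw, spatialOp_linear]
      ring
    set s := Real.sqrt (M * D) with hs
    have hs2 : s ^ 2 = M * D := Real.sq_sqrt (by positivity)
    -- Pairing `L^∞` with `L¹`: the residual is singular near the boundary and uniformly controlled
    -- only in `L¹`.
    have hwR : ∑ j ∈ Ioo 0 M, w j * R k j ≤ s * ∑ j ∈ Ioo 0 M, |R k j| := by
      rw [mul_sum]
      refine sum_le_sum fun j hj => ?_
      have hjM := (mem_Ioo.1 hj).2.le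
      have : |w j| ≤ s := Real.abs_le_sqrt (sq_le_mul_sum_sq_sub hw0 hjM)
      calc w j * R k j ≤ |w j| * |R k j| := by
            rw [← abs_mul]
            exact le_abs_self _
        _ ≤ _ := mul_le_mul_of_nonneg_right this (abs_nonneg _)
    have hsA : h * (s * ∑ j ∈ Ioo 0 M, |R k j|) ≤ s * A := by
      have := mul_le_mul_of_nonneg_left (hR k hkN) (Real.sqrt_nonneg (M * D))
      rw [← hs] at this
      linarith
    -- Young's inequality, balanced so that `s² = M D` is absorbed exactly by the diffusion term.
    have hamgm : s * A ≤ h * (d2 / h ^ 2 * D) + A ^ 2 * (M * h) / (4 * d2) := by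
      have hDe : D = s ^ 2 / M := by rw [hs2]; field_simp
      rw [hDe, ← sub_nonneg]
      have : h * (d2 / h ^ 2 * (s ^ 2 / M)) + A ^ 2 * (M * h) / (4 * d2) - s * A
          = (2 * d2 * s - A * M * h) ^ 2 / (4 * d2 * M * h) := by
        field_simp
        ring
      rw [this]
      positivity
    have key : 2 / τ * (h * ∑ j ∈ Ioo 0 M, e (k + 1) j ^ 2 - h * ∑ j ∈ Ioo 0 M, e k j ^ 2)
        ≤ A ^ 2 * (M * h) / (4 * d2) := by
      calc _ = h * (2 / τ * (∑ j ∈ Ioo 0 M, e (k + 1) j ^ 2 - ∑ j ∈ Ioo 0 M, e k j ^ 2)) := by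
            ring
        _ ≤ h * (-(d2 / h ^ 2) * D + s * ∑ j ∈ Ioo 0 M, |R k j|) := by
            rw [hid]
            exact mul_le_mul_of_nonneg_left (add_le_add hop hwR) hh.le
        _ ≤ _ := by linarith
    rw [div_mul_eq_mul_div, div_le_iff₀ hτ] at key
    push_cast
    have e8 : A ^ 2 * (M * h) / (4 * d2) * τ = 2 * (τ * (A ^ 2 * (M * h) / (8 * d2))) := by
      field_simp
      ring
    linarith

/-! ### Solvability and stability -/

lemma step_iff {α d1 d2 dα h τ : ℝ} {M : ℕ} (U V : ℕ → ℝ) (σ : ℝ) (j : ℕ) :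
    ((d2 / h ^ 2 + d1 / (2 * h)) * V (j - 1) - (2 / τ + 2 * d2 / h ^ 2) * V j
        + (d2 / h ^ 2 - d1 / (2 * h)) * V (j + 1) - nu α dα h * rieszSum α M V j
      = -(d2 / h ^ 2 + d1 / (2 * h)) * U (j - 1) - (2 / τ - 2 * d2 / h ^ 2) * U j
        - (d2 / h ^ 2 - d1 / (2 * h)) * U (j + 1) + nu α dα h * rieszSum α M U j - 2 * σ) ↔
    2 / τ * (V j - U j) - (spatialOp α d1 d2 dα h M V j + spatialOp α d1 d2 dα h M U j)
      = 2 * σ := by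
  simp only [spatialOp]
  constructor <;> intro H <;> linear_combination (-1 : ℝ) * H

lemma eq_zero_of_implicit_eq_zero {α d1 d2 dα h τ : ℝ} (h0 : 0 < α) (h1 : α < 1) (hd2 : 0 < d2)
    (hdα : 0 < dα) (hh : 0 < h) (hτ : 0 < τ) {M : ℕ} {w : ℕ → ℝ} (hw0 : w 0 = 0) (hwM : w M = 0)
    (hw : ∀ j ∈ Ioo 0 M, 2 / τ * w j - spatialOp α d1 d2 dα h M w j = 0) :
    ∀ j ∈ Ioo 0 M, w j = 0 := by
  have hop := sum_mul_spatialOp_le (d1 := d1) (d2 := d2) h0 h1 hdα hh hw0 hwM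
  have e : ∑ j ∈ Ioo 0 M, w j * spatialOp α d1 d2 dα h M w j
      = 2 / τ * ∑ j ∈ Ioo 0 M, w j ^ 2 := by
    rw [mul_sum]
    refine sum_congr rfl fun j hj => ?_
    rw [← sub_eq_zero.1 (hw j hj)]
    ring
  have hD : 0 ≤ d2 / h ^ 2 * ∑ i ∈ range M, (w (i + 1) - w i) ^ 2 :=
    mul_nonneg (by positivity) (sum_nonneg fun _ _ => sq_nonneg _)
  have hS : ∑ j ∈ Ioo 0 M, w j ^ 2 = 0 := by
    have hτ2 : 0 < 2 / τ := by positivity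
    have hn : 0 ≤ ∑ j ∈ Ioo 0 M, w j ^ 2 := sum_nonneg fun _ _ => sq_nonneg _
    rw [e] at hop
    nlinarith
  intro j hj
  have := (sum_eq_zero_iff_of_nonneg fun _ _ => sq_nonneg _).1 hS j hj
  exact pow_eq_zero_iff two_ne_zero |>.1 this

/-- Extension by zero of a function on the interior nodes. -/
noncomputable def extendZero (M : ℕ) (x : Ioo 0 M → ℝ) (j : ℕ) : ℝ :=
  if hj : j ∈ Ioo 0 M then x ⟨j, hj⟩ else 0

/-- One implicit step is a square linear system on the interior nodes; dissipativity makes it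
injective, hence surjective. -/
lemma exists_implicit_eq {α d1 d2 dα h τ : ℝ} (h0 : 0 < α) (h1 : α < 1) (hd2 : 0 < d2)
    (hdα : 0 < dα) (hh : 0 < h) (hτ : 0 < τ) (M : ℕ) (g : ℕ → ℝ) :
    ∃ w : ℕ → ℝ, w 0 = 0 ∧ w M = 0 ∧
      ∀ j ∈ Ioo 0 M, 2 / τ * w j - spatialOp α d1 d2 dα h M w j = g j := by
  have hext : ∀ (c : ℝ) (x y : Ioo 0 M → ℝ), extendZero M (x + c • y)
      = fun j => extendZero M x j + c * extendZero M y j := by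
    intro c x y
    ext j
    simp only [extendZero]
    split_ifs <;> simp
  have hz : ∀ x : Ioo 0 M → ℝ, extendZero M x 0 = 0 ∧ extendZero M x M = 0 := fun x => by
    simp [extendZero]
  have hlin : ∀ (c : ℝ) (x y : Ioo 0 M → ℝ) (j : ℕ),
      2 / τ * extendZero M (x + c • y) j - spatialOp α d1 d2 dα h M (extendZero M (x + c • y)) j
      = (2 / τ * extendZero M x j - spatialOp α d1 d2 dα h M (extendZero M x) j)
        + c * (2 / τ * extendZero M y j - spatialOp α d1 d2 dα h M (extendZero M y) j) := by
    intro c x y j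
    rw [hext, spatialOp_linear]
    ring
  let T : (Ioo 0 M → ℝ) →ₗ[ℝ] (Ioo 0 M → ℝ) :=
    { toFun := fun x j => 2 / τ * extendZero M x j - spatialOp α d1 d2 dα h M (extendZero M x) j
      map_add' := fun x y => by
        ext j
        have := hlin 1 x y j
        rw [one_smul, one_mul] at this
        exact this
      map_smul' := fun c x => by
        ext j
        have h2 := hlin c 0 x j
        have h3 := hlin 1 0 0 j
        rw [one_smul, one_mul, add_zero] at h3
        rw [zero_add] at h2
        simp only [Pi.smul_apply, smul_eq_mul, RingHom.id_apply]
        linarith }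
  have hinj : Function.Injective T := by
    rw [← LinearMap.ker_eq_bot, LinearMap.ker_eq_bot']
    intro x hx
    have := eq_zero_of_implicit_eq_zero (d1 := d1) h0 h1 hd2 hdα hh hτ (hz x).1 (hz x).2
      fun j hj => congrFun hx ⟨j, hj⟩
    ext ⟨j, hj⟩
    have := this j hj
    simpa [extendZero, hj, mem_Ioo.1 hj] using this
  obtain ⟨x, hx⟩ := (LinearMap.injective_iff_surjective.1 hinj) fun j => g j
  exact ⟨extendZero M x, (hz x).1, (hz x).2, fun j hj => congrFun hx ⟨j, hj⟩⟩

theorem isL2Stable {α d1 d2 dα h τ : ℝ} (h0 : 0 < α) (h1 : α < 1) (hd2 : 0 < d2)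
    (hdα : 0 < dα) (hh : 0 < h) (hτ : 0 < τ) {M : ℕ} (hM : 0 < M) (N : ℕ) :
    IsL2Stable α d1 d2 dα h τ M N := by
  intro v w σ U V hU hV k hk
  have hlin : ∀ (k j : ℕ), spatialOp α d1 d2 dα h M (fun i => V k i - U k i) j
      = spatialOp α d1 d2 dα h M (V k) j - spatialOp α d1 d2 dα h M (U k) j := by
    intro k j
    have := spatialOp_linear α d1 d2 dα h M (-1) (V k) (U k) j
    simpa only [neg_one_mul, ← sub_eq_add_neg] using this
  -- The difference of two solutions with the same source has zero residual, so the energy does not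
  -- grow.
  have hE := energy_estimate (d1 := d1) (R := fun _ _ => 0) (A := 0)
    (e := fun k j => V k j - U k j) h0 h1 hd2 hdα hh hτ hM
    (fun k hk => by simp [hU.boundary_left k hk, hV.boundary_left k hk])
    (fun k hk => by simp [hU.boundary_right k hk, hV.boundary_right k hk])
    (fun k hk j hj => by
      have hj := mem_Ioo.1 hj
      have a1 := (step_iff _ _ _ _).1 (hU.step k hk j hj.1 hj.2)
      have a2 := (step_iff _ _ _ _).1 (hV.step k hk j hj.1 hj.2)
      rw [hlin, hlin]
      linarith)
    (by simp) k hk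
  have e0 : ∑ j ∈ Ioo 0 M, (w j - v j) ^ 2 = ∑ j ∈ Ioo 0 M, (V 0 j - U 0 j) ^ 2 :=
    sum_congr rfl fun j hj => by
      have hj := mem_Ioo.1 hj
      rw [hU.initial j hj.1 hj.2, hV.initial j hj.1 hj.2]
  refine Real.sqrt_le_sqrt ?_
  rw [e0]
  simpa using hE

theorem isUniquelySolvable {α d1 d2 dα h τ : ℝ} (h0 : 0 < α) (h1 : α < 1) (hd2 : 0 < d2)
    (hdα : 0 < dα) (hh : 0 < h) (hτ : 0 < τ) {M : ℕ} (hM : 0 < M) (N : ℕ) :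
    IsUniquelySolvable α d1 d2 dα h τ M N := by
  intro v σ
  choose F hF0 hFM hF using exists_implicit_eq (d1 := d1) h0 h1 hd2 hdα hh hτ M
  -- `v` is cut off outside the interior nodes, since its values at the boundary nodes are
  -- unconstrained.
  let U : ℕ → ℕ → ℝ := fun k => Nat.rec (fun j => if j ∈ Ioo 0 M then v j else 0)
    (fun k W => F fun j => 2 / τ * W j + spatialOp α d1 d2 dα h M W j + 2 * σ k j) k
  have hUs : ∀ k, U (k + 1) = F fun j =>
    2 / τ * U k j + spatialOp α d1 d2 dα h M (U k) j + 2 * σ k j := fun _ => rfl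
  have hU : IsSchemeSolution α d1 d2 dα h τ M N v σ U := by
    refine ⟨fun j hj hjM => if_pos (mem_Ioo.2 ⟨hj, hjM⟩), fun k _ => ?_, fun k _ => ?_,
      fun k _ j hj hjM => ?_⟩
    · cases k with
      | zero => exact if_neg (by simp)
      | succ k => rw [hUs, hF0]
    · cases k with
      | zero => exact if_neg (by simp)
      | succ k => rw [hUs, hFM]
    · rw [step_iff, hUs]
      have := hF (fun j => 2 / τ * U k j + spatialOp α d1 d2 dα h M (U k) j + 2 * σ k j) j
        (mem_Ioo.2 ⟨hj, hjM⟩)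
      linarith
  refine ⟨U, hU, fun V hV k hk j hj => ?_⟩
  rcases Nat.eq_zero_or_pos j with rfl | hj0
  · rw [hU.boundary_left k hk, hV.boundary_left k hk]
  rcases hj.eq_or_lt with rfl | hjM
  · rw [hU.boundary_right k hk, hV.boundary_right k hk]
  -- Uniqueness is stability for equal initial values.
  have hs := isL2Stable (d1 := d1) h0 h1 hd2 hdα hh hτ hM N v v σ U V hU hV k hk
  simp only [discreteL2, sub_self, ne_eq, OfNat.ofNat_ne_zero, not_false_eq_true, zero_pow,
    sum_const_zero, mul_zero, Real.sqrt_zero] at hs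
  have hle := Real.sqrt_eq_zero'.1 (le_antisymm hs (Real.sqrt_nonneg _))
  have hn : 0 ≤ ∑ j ∈ Ioo 0 M, (V k j - U k j) ^ 2 := sum_nonneg fun _ _ => sq_nonneg _
  have hz : ∑ j ∈ Ioo 0 M, (V k j - U k j) ^ 2 = 0 := by nlinarith
  have := (sum_eq_zero_iff_of_nonneg fun _ _ => sq_nonneg _).1 hz j (mem_Ioo.2 ⟨hj0, hjM⟩)
  exact sub_eq_zero.1 (pow_eq_zero_iff two_ne_zero |>.1 this)

/-! ### Fractional derivatives of smooth functions on an interval -/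

/-- `f₁` is a derivative of `f` on `[a,b]`, one-sided at the end points. -/
def HasDerivOnIcc (a b : ℝ) (f f₁ : ℝ → ℝ) : Prop :=
  ∀ x ∈ Set.Icc a b, HasDerivWithinAt f (f₁ x) (Set.Icc a b) x

lemma HasDerivOnIcc.continuousOn {a b : ℝ} {f f₁ : ℝ → ℝ} (h : HasDerivOnIcc a b f f₁) :
    ContinuousOn f (Set.Icc a b) := fun x hx => (h x hx).continuousWithinAt

lemma HasDerivOnIcc.hasDerivAt {a b : ℝ} {f f₁ : ℝ → ℝ} (h : HasDerivOnIcc a b f f₁) {x : ℝ}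
    (hx : x ∈ Set.Ioo a b) : HasDerivAt f (f₁ x) x :=
  (h x (Set.Ioo_subset_Icc_self hx)).hasDerivAt (Icc_mem_nhds hx.1 hx.2)

lemma HasDerivOnIcc.mono {a b c d : ℝ} {f f₁ : ℝ → ℝ} (h : HasDerivOnIcc a b f f₁)
    (hac : a ≤ c) (hdb : d ≤ b) : HasDerivOnIcc c d f f₁ := fun x hx =>
  (h x ⟨hac.trans hx.1, hx.2.trans hdb⟩).mono (Set.Icc_subset_Icc hac hdb)

lemma HasDerivOnIcc.reflect {a b : ℝ} {f f₁ : ℝ → ℝ} (h : HasDerivOnIcc a b f f₁) :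
    HasDerivOnIcc a b (fun x => f (a + b - x)) (fun x => -f₁ (a + b - x)) := by
  intro x hx
  have hx' : a + b - x ∈ Set.Icc a b := ⟨by linarith [hx.2], by linarith [hx.1]⟩
  have hd : HasDerivWithinAt (fun x : ℝ => a + b - x) (-1) (Set.Icc a b) x :=
    ((hasDerivAt_id x).const_sub (a + b)).hasDerivWithinAt
  have := (h _ hx').comp x hd (fun y hy => ⟨by linarith [hy.2], by linarith [hy.1]⟩)
  rw [mul_neg_one] at this
  exact this

/-- Constant extension of a function from `[a,b]` to the line. -/
noncomputable def extendConst (a b : ℝ) (f : ℝ → ℝ) (x : ℝ) : ℝ := f (max a (min x b))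

lemma extendConst_eq {a b x : ℝ} (f : ℝ → ℝ) (hx : x ∈ Set.Icc a b) :
    extendConst a b f x = f x := by
  rw [extendConst, min_eq_left hx.2, max_eq_right hx.1]

lemma extendConst_of_le {a b x : ℝ} (f : ℝ → ℝ) (hx : x ≤ a) : extendConst a b f x = f a := by
  rw [extendConst, max_eq_left ((min_le_left _ _).trans hx)]

lemma clamp_mem {a b : ℝ} (hab : a ≤ b) (x : ℝ) : max a (min x b) ∈ Set.Icc a b :=
  ⟨le_max_left _ _, max_le hab (min_le_right _ _)⟩

lemma continuous_extendConst {a b : ℝ} (hab : a ≤ b) {f : ℝ → ℝ}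
    (hf : ContinuousOn f (Set.Icc a b)) : Continuous (extendConst a b f) :=
  hf.comp_continuous (by fun_prop) (clamp_mem hab)

/-- The vanishing slope at `a` makes the constant extension differentiable across `a`. A kink may
remain at `b`, hence `x < b`. -/
lemma hasDerivAt_extendConst {a b x : ℝ} (hab : a < b) {f f₁ : ℝ → ℝ}
    (hf : HasDerivOnIcc a b f f₁) (h1a : f₁ a = 0) (hx : x < b) :
    HasDerivAt (extendConst a b f) (extendConst a b f₁ x) x := by
  rcases lt_trichotomy x a with h | h | h
  · rw [extendConst_of_le _ h.le, h1a]
    refine (hasDerivAt_const x (f a)).congr_of_eventuallyEq ?_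
    filter_upwards [Iio_mem_nhds h] with y hy using extendConst_of_le f (le_of_lt hy)
  · subst h
    rw [extendConst_of_le _ le_rfl, h1a]
    have l : HasDerivWithinAt (extendConst x b f) 0 (Set.Iic x) x :=
      (hasDerivWithinAt_const x _ (f x)).congr (fun y hy => extendConst_of_le f hy)
        (extendConst_of_le f le_rfl)
    have r : HasDerivWithinAt (extendConst x b f) 0 (Set.Icc x b) x := by
      have := hf x ⟨le_rfl, hx.le⟩
      rw [h1a] at this
      exact this.congr (fun y hy => extendConst_eq f hy) (extendConst_of_le f le_rfl)
    refine (l.union r).hasDerivAt ?_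
    filter_upwards [Iio_mem_nhds hx] with y hy
    rcases le_total y x with h | h
    · exact Or.inl h
    · exact Or.inr ⟨h, le_of_lt hy⟩
  · rw [extendConst_eq _ ⟨h.le, hx.le⟩]
    refine (hf.hasDerivAt ⟨h, hx⟩).congr_of_eventuallyEq ?_
    filter_upwards [Ioo_mem_nhds h hx] with y hy using extendConst_eq f ⟨hy.1.le, hy.2.le⟩

lemma exists_abs_le_of_continuousOn {a b : ℝ} {f : ℝ → ℝ} (hf : ContinuousOn f (Set.Icc a b)) :
    ∃ B, 0 ≤ B ∧ ∀ x ∈ Set.Icc a b, |f x| ≤ B := by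
  obtain ⟨B, hB⟩ := isCompact_Icc.exists_bound_of_continuousOn hf
  exact ⟨max B 0, le_max_right _ _, fun x hx => (hB x hx).trans (le_max_left _ _)⟩

/-- The left fractional integral of order `1 - α` of `g`; for `g = f'` with `f a = 0` this is the
Riemann–Liouville derivative of `f`. -/
noncomputable def fracInt (α a : ℝ) (g : ℝ → ℝ) (x : ℝ) : ℝ :=
  1 / Real.Gamma (1 - α) * ∫ s in (0 : ℝ)..(x - a), s ^ (-α) * g (x - s)

/-- Replaces the moving upper limit by the fixed one `b - a`, which prepares differentiation under
the integral sign. -/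
lemma integral_extendConst {α a b x : ℝ} (hα1 : α < 1) (hab : a < b) {g : ℝ → ℝ}
    (hg : ContinuousOn g (Set.Icc a b)) (hga : g a = 0) (hx : x ∈ Set.Ioo a b) :
    ∫ s in (0 : ℝ)..(b - a), s ^ (-α) * extendConst a b g (x - s)
      = ∫ s in (0 : ℝ)..(x - a), s ^ (-α) * g (x - s) := by
  have hc := continuous_extendConst hab.le hg
  have hi : ∀ c d : ℝ, IntervalIntegrable (fun s : ℝ => s ^ (-α) * extendConst a b g (x - s))
      MeasureTheory.volume c d := fun c d =>
    (intervalIntegral.intervalIntegrable_rpow' (by linarith)).mul_continuousOn (by fun_prop)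
  rw [← intervalIntegral.integral_add_adjacent_intervals (hi 0 (x - a)) (hi (x - a) (b - a))]
  have z : ∫ s in (x - a)..(b - a), s ^ (-α) * extendConst a b g (x - s) = 0 := by
    rw [intervalIntegral.integral_congr (g := fun _ => 0)]
    · simp
    · intro s hs
      rw [Set.uIcc_of_le (by linarith [hx.2])] at hs
      simp [extendConst_of_le g (show x - s ≤ a by linarith [hs.1]), hga]
  rw [z, add_zero]
  refine intervalIntegral.integral_congr fun s hs => ?_
  rw [Set.uIcc_of_le (by linarith [hx.1])] at hs
  rw [extendConst_eq g ⟨by linarith [hs.2], by linarith [hs.1, hx.2]⟩]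

/-- After the substitution `s = y - ξ` the singular kernel no longer depends on `y`, and dominated
differentiation falls on the smooth factor only. -/
lemma rlLeft_eq_fracInt {α a b x : ℝ} (hα1 : α < 1) (hab : a < b) {f f₁ : ℝ → ℝ}
    (hf : HasDerivOnIcc a b f f₁) (hf₁ : ContinuousOn f₁ (Set.Icc a b)) (hfa : f a = 0)
    (h1a : f₁ a = 0) (hx : x ∈ Set.Ioo a b) : rlLeft α a f x = fracInt α a f₁ x := by
  obtain ⟨B, hB0, hB⟩ := exists_abs_le_of_continuousOn hf₁
  have hc := continuous_extendConst hab.le hf.continuousOn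
  have hc₁ := continuous_extendConst hab.le hf₁
  have hpow : ∀ c d : ℝ, IntervalIntegrable (fun s : ℝ => s ^ (-α)) MeasureTheory.volume c d :=
    fun c d => intervalIntegral.intervalIntegrable_rpow' (by linarith)
  have hi : ∀ y : ℝ, IntervalIntegrable (fun s : ℝ => s ^ (-α) * extendConst a b f (y - s))
      MeasureTheory.volume 0 (b - a) := fun y =>
    (hpow _ _).mul_continuousOn (by fun_prop)
  have hi₁ : IntervalIntegrable (fun s : ℝ => s ^ (-α) * extendConst a b f₁ (x - s))
      MeasureTheory.volume 0 (b - a) := (hpow _ _).mul_continuousOn (by fun_prop)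
  have hd := (intervalIntegral.hasDerivAt_integral_of_dominated_loc_of_deriv_le
    (μ := MeasureTheory.volume) (a := 0) (b := b - a) (x₀ := x) (s := Set.Iio b)
    (F := fun y s => s ^ (-α) * extendConst a b f (y - s))
    (F' := fun y s => s ^ (-α) * extendConst a b f₁ (y - s))
    (bound := fun s => s ^ (-α) * B) (Iio_mem_nhds hx.2)
    (Eventually.of_forall fun y => (intervalIntegrable_iff.1 (hi y)).aestronglyMeasurable) (hi x)
    (intervalIntegrable_iff.1 hi₁).aestronglyMeasurable
    (Eventually.of_forall fun s hs y hy => by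
      rw [Set.uIoc_of_le (by linarith)] at hs
      rw [Real.norm_eq_abs, abs_mul, abs_of_nonneg (Real.rpow_nonneg hs.1.le _)]
      exact mul_le_mul_of_nonneg_left (hB _ (clamp_mem hab.le _)) (Real.rpow_nonneg hs.1.le _))
    ((hpow _ _).mul_const B)
    (Eventually.of_forall fun s hs y hy => by
      rw [Set.uIoc_of_le (by linarith)] at hs
      have hy : y < b := hy
      exact ((hasDerivAt_extendConst hab hf h1a (show y - s < b by linarith [hs.1])).comp_sub_const
        y s).const_mul _)).2
  have he : (fun y : ℝ => ∫ ξ in a..y, (y - ξ) ^ (-α) * f ξ)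
      =ᶠ[𝓝 x] fun y => ∫ s in (0 : ℝ)..(b - a), s ^ (-α) * extendConst a b f (y - s) := by
    filter_upwards [Ioo_mem_nhds hx.1 hx.2] with y hy
    rw [integral_extendConst hα1 hab hf.continuousOn hfa hy]
    have := intervalIntegral.integral_comp_sub_left (a := a) (b := y)
      (fun s => s ^ (-α) * f (y - s)) y
    simp only [sub_sub_cancel, sub_self] at this
    exact this
  rw [rlLeft, he.deriv_eq, hd.deriv, integral_extendConst hα1 hab hf₁ h1a hx, fracInt]

/-- Reflection of the interval; the sign from the chain rule cancels that of the right derivative.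
-/
lemma rlRight_eq_rlLeft (α a b : ℝ) (f : ℝ → ℝ) (x : ℝ) :
    rlRight α b f x = rlLeft α a (fun y => f (a + b - y)) (a + b - x) := by
  have e : (fun y : ℝ => ∫ ξ in y..b, (ξ - y) ^ (-α) * f ξ)
      = fun y => (fun z : ℝ => ∫ η in a..z, (z - η) ^ (-α) * f (a + b - η)) (a + b - y) := by
    ext y
    have := intervalIntegral.integral_comp_sub_left (a := a) (b := a + b - y)
      (fun ξ => (ξ - y) ^ (-α) * f ξ) (a + b)
    rw [sub_sub_cancel, add_sub_cancel_left] at this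
    rw [← this]
    refine intervalIntegral.integral_congr fun η _ => ?_
    rw [show a + b - η - y = a + b - y - η by ring]
  have hd := deriv_comp_const_sub (fun z : ℝ => ∫ η in a..z, (z - η) ^ (-α) * f (a + b - η))
    (a + b) x
  rw [rlRight, rlLeft, e, hd]
  ring

/-- Integration by parts: `s^(r+1)` vanishes at `s = 0`, so only the boundary term at `a` remains.
Applied repeatedly, it gives both `fracInt_eq` and Taylor's formula in matching form. -/
lemma integral_rpow_mul_eq {r a x : ℝ} (hr : -1 < r) (hax : a ≤ x) {g g₁ : ℝ → ℝ}
    (hg : HasDerivOnIcc a x g g₁) (hg₁ : ContinuousOn g₁ (Set.Icc a x)) :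
    ∫ s in (0 : ℝ)..(x - a), s ^ r * g (x - s)
      = (g a * (x - a) ^ (r + 1) + ∫ s in (0 : ℝ)..(x - a), s ^ (r + 1) * g₁ (x - s))
        / (r + 1) := by
  have hr1 : r + 1 ≠ 0 := by linarith
  have hmaps : Set.MapsTo (fun s : ℝ => x - s) (Set.uIcc 0 (x - a)) (Set.Icc a x) := by
    intro s hs
    rw [Set.uIcc_of_le (by linarith)] at hs
    exact ⟨by linarith [hs.2], by linarith [hs.1]⟩
  have hu : ContinuousOn (fun s => g (x - s)) (Set.uIcc 0 (x - a)) :=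
    hg.continuousOn.comp (by fun_prop) hmaps
  have hu' : ContinuousOn (fun s => -g₁ (x - s)) (Set.uIcc 0 (x - a)) :=
    (hg₁.comp (by fun_prop) hmaps).neg
  have hv : Continuous fun s : ℝ => s ^ (r + 1) / (r + 1) :=
    (Real.continuous_rpow_const (by linarith)).div_const _
  have h := intervalIntegral.integral_mul_deriv_eq_deriv_mul_of_hasDerivAt (a := 0) (b := x - a)
    (u := fun s => g (x - s)) (u' := fun s => -g₁ (x - s)) (v := fun s => s ^ (r + 1) / (r + 1))
    (v' := fun s => s ^ r) hu hv.continuousOn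
    (fun s hs => by
      rw [min_eq_left (by linarith), max_eq_right (by linarith)] at hs
      have := hg.hasDerivAt (x := x - s) ⟨by linarith [hs.2], by linarith [hs.1]⟩
      exact this.comp_const_sub x s)
    (fun s hs => by
      rw [min_eq_left (by linarith), max_eq_right (by linarith)] at hs
      have := (Real.hasDerivAt_rpow_const (x := s) (p := r + 1) (Or.inl hs.1.ne')).div_const (r + 1)
      rw [add_sub_cancel_right, mul_div_cancel_left₀ _ hr1] at this
      exact this)
    hu'.intervalIntegrable (intervalIntegral.intervalIntegrable_rpow' hr)
  simp only [sub_sub_cancel, Real.zero_rpow hr1, zero_div, mul_zero, sub_zero] at h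
  have e1 : ∫ s in (0 : ℝ)..(x - a), s ^ r * g (x - s)
      = ∫ s in (0 : ℝ)..(x - a), g (x - s) * s ^ r := by
    simp only [mul_comm]
  have e2 : ∫ s in (0 : ℝ)..(x - a), -g₁ (x - s) * (s ^ (r + 1) / (r + 1))
      = -((∫ s in (0 : ℝ)..(x - a), s ^ (r + 1) * g₁ (x - s)) / (r + 1)) := by
    rw [← intervalIntegral.integral_div, ← intervalIntegral.integral_neg]
    refine intervalIntegral.integral_congr fun s _ => ?_
    ring
  rw [e1, h, e2]
  ring

/-- The fractional derivative in terms of the third derivative. -/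
lemma fracInt_eq {α a x : ℝ} (hα0 : 0 < α) (hα1 : α < 1) (hax : a ≤ x) {f₁ f₂ f₃ : ℝ → ℝ}
    (h₁ : HasDerivOnIcc a x f₁ f₂) (h₂ : HasDerivOnIcc a x f₂ f₃)
    (h₃ : ContinuousOn f₃ (Set.Icc a x)) (h1a : f₁ a = 0) :
    fracInt α a f₁ x = 1 / Real.Gamma (3 - α) * (f₂ a * (x - a) ^ (2 - α)
      + ∫ s in (0 : ℝ)..(x - a), s ^ (2 - α) * f₃ (x - s)) := by
  have e1 : Real.Gamma (2 - α) = (1 - α) * Real.Gamma (1 - α) := by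
    rw [← Real.Gamma_add_one (by linarith)]
    ring_nf
  have e2 : Real.Gamma (3 - α) = (2 - α) * Real.Gamma (2 - α) := by
    rw [← Real.Gamma_add_one (by linarith)]
    ring_nf
  have hΓ : Real.Gamma (1 - α) ≠ 0 := (Real.Gamma_pos_of_pos (by linarith)).ne'
  have n1 : (1 - α) ≠ 0 := by linarith
  have n2 : (2 - α) ≠ 0 := by linarith
  rw [fracInt, integral_rpow_mul_eq (by linarith) hax h₁ h₂.continuousOn, h1a,
    show -α + 1 = 1 - α by ring, integral_rpow_mul_eq (by linarith) hax h₂ h₃,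
    show 1 - α + 1 = 2 - α by ring, e2, e1, zero_mul, zero_add]
  field_simp

/-- Taylor's formula of second order with vanishing value and slope at `a`. -/
lemma eq_taylor_integral {a y : ℝ} (hay : a ≤ y) {f f₁ f₂ f₃ : ℝ → ℝ}
    (h₀ : HasDerivOnIcc a y f f₁) (h₁ : HasDerivOnIcc a y f₁ f₂) (h₂ : HasDerivOnIcc a y f₂ f₃)
    (h₃ : ContinuousOn f₃ (Set.Icc a y)) (hfa : f a = 0) (h1a : f₁ a = 0) :
    f y = 1 / 2 * (f₂ a * (y - a) ^ 2 + ∫ s in (0 : ℝ)..(y - a), s ^ 2 * f₃ (y - s)) := by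
  have ftc : ∫ t in a..y, f₁ t = f y - f a :=
    intervalIntegral.integral_eq_sub_of_hasDerivAt_of_le hay h₀.continuousOn
      (fun t ht => h₀.hasDerivAt ht) (by
        refine ContinuousOn.intervalIntegrable ?_
        rw [Set.uIcc_of_le hay]
        exact h₁.continuousOn)
  rw [hfa, sub_zero] at ftc
  have p1 := integral_rpow_mul_eq (r := 0) (by norm_num) hay h₁ h₂.continuousOn
  have p2 := integral_rpow_mul_eq (r := 1) (by norm_num) hay h₂ h₃
  norm_num at p1 p2
  rw [← ftc, p1, h1a, p2]
  ring

/-- The local error of the quadrature kernel. -/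
lemma exists_abs_kernel_le {α : ℝ} (h0 : 0 < α) (h1 : α < 1) :
    ∃ C : ℝ, 0 ≤ C ∧ ∀ h : ℝ, 0 < h → ∀ s : ℝ, 0 < s → ∀ J : ℕ, s ≤ J * h →
      |h ^ (-α) * ∑ l ∈ range (J + 1), weight2 α l * (max (s - l * h) 0) ^ 2
        - 2 / Real.Gamma (3 - α) * s ^ (2 - α)| ≤ C * h ^ 2 * s ^ (-α) := by
  obtain ⟨C, hC, hK⟩ := exists_abs_sum_weight2_mul_sq_sub_le h0 h1
  refine ⟨C, hC, fun h hh s hs J hsJ => ?_⟩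
  have hb := hK (s / h) (by positivity) J (by rwa [div_le_iff₀ hh])
  have hmax : ∀ l : ℕ, max (s - l * h) 0 = h * max (s / h - l) 0 := by
    intro l
    rw [mul_max_of_nonneg _ _ hh.le, mul_zero]
    congr 1
    field_simp
  have hpow : h ^ (2 - α) = h ^ (-α) * h ^ 2 := by
    rw [← Real.rpow_natCast, ← Real.rpow_add hh]
    congr 1
    push_cast
    ring
  have e : h ^ (-α) * ∑ l ∈ range (J + 1), weight2 α l * (max (s - l * h) 0) ^ 2
        - 2 / Real.Gamma (3 - α) * s ^ (2 - α)
      = h ^ (2 - α) * (∑ l ∈ range (J + 1), weight2 α l * (max (s / h - l) 0) ^ 2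
        - 2 / Real.Gamma (3 - α) * (s / h) ^ (2 - α)) := by
    -- Homogeneity reduces the step `h` to the step `1` at the point `s / h`.
    have e1 : h ^ (2 - α) * (s / h) ^ (2 - α) = s ^ (2 - α) := by
      rw [← Real.mul_rpow hh.le (by positivity)]
      congr 1
      field_simp
    rw [mul_sub, mul_left_comm, e1, hpow, mul_sum, mul_sum]
    congr 1
    refine sum_congr rfl fun l _ => ?_
    rw [hmax]
    ring
  rw [e, abs_mul, abs_of_pos (by positivity)]
  calc h ^ (2 - α) * _ ≤ h ^ (2 - α) * (C * (s / h) ^ (-α)) := by gcongr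
    _ = C * h ^ 2 * s ^ (-α) := by
      rw [hpow, Real.div_rpow hs.le hh.le]
      field_simp

/-- Puts the Taylor remainders at all nodes `x - c` on one interval, with `c` appearing only in the
truncated square. -/
lemma integral_sq_shift {L c x : ℝ} (hc0 : 0 ≤ c) (hcL : c ≤ L) {g : ℝ → ℝ}
    (hg : ContinuousOn (fun s => g (x - s)) (Set.Icc 0 L)) :
    ∫ s in (0 : ℝ)..(L - c), s ^ 2 * g (x - c - s)
      = ∫ s in (0 : ℝ)..L, (max (s - c) 0) ^ 2 * g (x - s) := by
  have hi : ∀ u v : ℝ, 0 ≤ u → u ≤ v → v ≤ L → IntervalIntegrable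
      (fun s => (max (s - c) 0) ^ 2 * g (x - s)) MeasureTheory.volume u v := by
    intro u v hu huv hv
    refine ContinuousOn.intervalIntegrable ?_
    rw [Set.uIcc_of_le huv]
    exact ContinuousOn.mul (by fun_prop) (hg.mono (Set.Icc_subset_Icc hu hv))
  rw [← intervalIntegral.integral_add_adjacent_intervals (hi 0 c le_rfl hc0 hcL)
    (hi c L hc0 hcL le_rfl)]
  have z : ∫ s in (0 : ℝ)..c, (max (s - c) 0) ^ 2 * g (x - s) = 0 := by
    rw [intervalIntegral.integral_congr (g := fun _ => 0)]
    · simp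
    · intro s hs
      rw [Set.uIcc_of_le hc0] at hs
      simp [max_eq_right (show s - c ≤ 0 by linarith [hs.2])]
  have t := intervalIntegral.integral_comp_sub_right (a := c) (b := L)
    (fun s => s ^ 2 * g (x - c - s)) c
  rw [sub_self] at t
  rw [z, zero_add, ← t]
  refine intervalIntegral.integral_congr fun s hs => ?_
  rw [Set.uIcc_of_le hcL] at hs
  rw [max_eq_left (by linarith [hs.1]), show x - c - (s - c) = x - s by ring]

/-- Second-order consistency of the convolution quadrature. -/
lemma exists_quadrature_error {α : ℝ} (h0 : 0 < α) (h1 : α < 1) :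
    ∃ C : ℝ, 0 ≤ C ∧ ∀ (a b B : ℝ) (f f₁ f₂ f₃ : ℝ → ℝ), HasDerivOnIcc a b f f₁ →
      HasDerivOnIcc a b f₁ f₂ → HasDerivOnIcc a b f₂ f₃ → ContinuousOn f₃ (Set.Icc a b) →
      f a = 0 → f₁ a = 0 → (∀ x ∈ Set.Icc a b, |f₂ x| ≤ B) → (∀ x ∈ Set.Icc a b, |f₃ x| ≤ B) →
      ∀ (h : ℝ) (j : ℕ), 0 < h → 0 < j → a + j * h ≤ b →
        |h ^ (-α) * ∑ l ∈ range (j + 1), weight2 α l * f (a + j * h - l * h)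
          - fracInt α a f₁ (a + j * h)| ≤ C * B * (1 + (b - a)) * h ^ 2 * (j * h) ^ (-α) := by
  obtain ⟨C, hC, hK⟩ := exists_abs_kernel_le h0 h1
  refine ⟨C / (1 - α), div_nonneg hC (by linarith), ?_⟩
  intro a b B f f₁ f₂ f₃ d₀ d₁ d₂ c₃ hfa h1a hB₂ hB₃ h j hh hj hjb
  set L : ℝ := j * h with hL
  have hj1 : (0 : ℝ) < j := by exact_mod_cast hj
  have hL0 : 0 < L := by positivity
  have hab : a ≤ b := by linarith
  have hB0 : 0 ≤ B := (abs_nonneg _).trans (hB₂ a ⟨le_rfl, hab⟩)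
  set x : ℝ := a + L with hx
  have hxa : x - a = L := by rw [hx]; ring
  set E : ℝ → ℝ := fun s => h ^ (-α) * ∑ l ∈ range (j + 1), weight2 α l * (max (s - l * h) 0) ^ 2
        - 2 / Real.Gamma (3 - α) * s ^ (2 - α) with hE
  have hgc : ContinuousOn (fun s => f₃ (x - s)) (Set.Icc 0 L) :=
    c₃.comp (by fun_prop) fun s hs => ⟨by linarith [hs.2], by linarith [hs.1]⟩
  have hfy : ∀ l ∈ range (j + 1), f (x - l * h) = 1 / 2 * (f₂ a * (max (L - l * h) 0) ^ 2
      + ∫ s in (0 : ℝ)..L, (max (s - l * h) 0) ^ 2 * f₃ (x - s)) := by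
    intro l hl
    have hlj : (l : ℝ) ≤ j := by exact_mod_cast Nat.lt_succ_iff.1 (mem_range.1 hl)
    have hl0 : 0 ≤ (l : ℝ) * h := by positivity
    have hlL : (l : ℝ) * h ≤ L := by rw [hL]; gcongr
    have hyb : x - l * h ≤ b := by linarith
    have hT := eq_taylor_integral (a := a) (y := x - l * h) (by linarith)
      (d₀.mono le_rfl hyb) (d₁.mono le_rfl hyb) (d₂.mono le_rfl hyb)
      (c₃.mono (Set.Icc_subset_Icc le_rfl hyb)) hfa h1a
    rw [show x - l * h - a = L - l * h by linarith, integral_sq_shift hl0 hlL hgc] at hT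
    rw [hT, max_eq_left (by linarith)]
  have hint : ∀ F : ℝ → ℝ, Continuous F →
      IntervalIntegrable (fun s => F s * f₃ (x - s)) MeasureTheory.volume 0 L := by
    intro F hF
    refine ContinuousOn.intervalIntegrable ?_
    rw [Set.uIcc_of_le hL0.le]
    exact hF.continuousOn.mul hgc
  have hpc : Continuous fun s : ℝ => s ^ (2 - α) := Real.continuous_rpow_const (by linarith)
  have hsumI : ∑ l ∈ range (j + 1), weight2 α l
        * ∫ s in (0 : ℝ)..L, (max (s - l * h) 0) ^ 2 * f₃ (x - s)
      = ∫ s in (0 : ℝ)..L,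
        (∑ l ∈ range (j + 1), weight2 α l * (max (s - l * h) 0) ^ 2) * f₃ (x - s) := by
    have : ∀ s, (∑ l ∈ range (j + 1), weight2 α l * (max (s - l * h) 0) ^ 2) * f₃ (x - s)
        = ∑ l ∈ range (j + 1), weight2 α l * ((max (s - l * h) 0) ^ 2 * f₃ (x - s)) := by
      intro s
      rw [sum_mul]
      exact sum_congr rfl fun _ _ => by ring
    simp only [this]
    rw [intervalIntegral.integral_finsetSum fun l _ => (hint _ (by fun_prop)).const_mul _]
    simp only [intervalIntegral.integral_const_mul]
  -- Peano kernel form: the quadrature error of `f` is a superposition of the errors `E` for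
  -- truncated squares.
  have hmain : h ^ (-α) * ∑ l ∈ range (j + 1), weight2 α l * f (x - l * h) - fracInt α a f₁ x
      = 1 / 2 * (f₂ a * E L + ∫ s in (0 : ℝ)..L, E s * f₃ (x - s)) := by
    have hEint : ∫ s in (0 : ℝ)..L, E s * f₃ (x - s)
        = h ^ (-α) * (∫ s in (0 : ℝ)..L,
          (∑ l ∈ range (j + 1), weight2 α l * (max (s - l * h) 0) ^ 2) * f₃ (x - s))
          - 2 / Real.Gamma (3 - α) * ∫ s in (0 : ℝ)..L, s ^ (2 - α) * f₃ (x - s) := by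
      rw [← intervalIntegral.integral_const_mul, ← intervalIntegral.integral_const_mul,
        ← intervalIntegral.integral_sub ((hint _ (by fun_prop)).const_mul _)
          ((hint _ hpc).const_mul _)]
      refine intervalIntegral.integral_congr fun s _ => ?_
      simp only [hE]
      ring
    have hsumf : ∑ l ∈ range (j + 1), weight2 α l * f (x - l * h)
        = 1 / 2 * (f₂ a * ∑ l ∈ range (j + 1), weight2 α l * (max (L - l * h) 0) ^ 2
          + ∑ l ∈ range (j + 1), weight2 α l
            * ∫ s in (0 : ℝ)..L, (max (s - l * h) 0) ^ 2 * f₃ (x - s)) := by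
      rw [mul_sum, ← sum_add_distrib, mul_sum]
      refine sum_congr rfl fun l hl => ?_
      rw [hfy l hl]
      ring
    rw [hsumf, hsumI, fracInt_eq h0 h1 (by linarith) (d₁.mono le_rfl hjb) (d₂.mono le_rfl hjb)
      (c₃.mono (Set.Icc_subset_Icc le_rfl hjb)) h1a, hxa, hEint]
    simp only [hE]
    ring
  have hEb : ∀ s, 0 < s → s ≤ L → |E s| ≤ C * h ^ 2 * s ^ (-α) := fun s hs hsL =>
    hK h hh s hs j hsL
  have b1 : |f₂ a * E L| ≤ B * (C * h ^ 2 * L ^ (-α)) := by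
    rw [abs_mul]
    exact mul_le_mul (hB₂ a ⟨le_rfl, hab⟩) (hEb L hL0 le_rfl) (abs_nonneg _) hB0
  -- Integrability of `s^(-α)` keeps this term of order `h²`.
  have b2 : |∫ s in (0 : ℝ)..L, E s * f₃ (x - s)|
      ≤ C * h ^ 2 * B * (L ^ (1 - α) / (1 - α)) := by
    have hb : ∀ s ∈ Set.Ioc (0 : ℝ) L, ‖E s * f₃ (x - s)‖ ≤ C * h ^ 2 * B * s ^ (-α) := by
      intro s hs
      rw [Real.norm_eq_abs, abs_mul]
      calc |E s| * |f₃ (x - s)| ≤ (C * h ^ 2 * s ^ (-α)) * B :=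
            mul_le_mul (hEb s hs.1 hs.2) (hB₃ _ ⟨by linarith [hs.2], by linarith [hs.1]⟩)
              (abs_nonneg _) (by have := Real.rpow_nonneg hs.1.le (-α); positivity)
        _ = _ := by ring
    have := intervalIntegral.norm_integral_le_of_norm_le hL0.le
      (Eventually.of_forall fun s hs => hb s hs)
      ((intervalIntegral.intervalIntegrable_rpow' (a := 0) (b := L) (r := -α)
        (by linarith)).const_mul (C * h ^ 2 * B))
    rw [Real.norm_eq_abs, intervalIntegral.integral_const_mul, integral_rpow
      (Or.inl (by linarith)), Real.zero_rpow (by linarith), sub_zero,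
      show -α + 1 = 1 - α by ring] at this
    exact this
  have hLs : L ^ (1 - α) = L * L ^ (-α) := by
    rw [sub_eq_add_neg, Real.rpow_add hL0, Real.rpow_one]
  have hLp : 0 < L ^ (-α) := by positivity
  have ha1 : 0 < 1 - α := by linarith
  rw [hmain, abs_mul, abs_of_pos (by norm_num : (0 : ℝ) < 1 / 2)]
  have hX : 0 ≤ C * B * h ^ 2 * L ^ (-α) := by positivity
  have c1 : C * h ^ 2 * B * (L ^ (1 - α) / (1 - α))
      ≤ (C * B * h ^ 2 * L ^ (-α)) * ((b - a) / (1 - α)) := by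
    rw [hLs]
    calc _ = (C * B * h ^ 2 * L ^ (-α)) * (L / (1 - α)) := by ring
      _ ≤ _ := by
        gcongr
        linarith
  have c2 : C * B * h ^ 2 * L ^ (-α) ≤ (C * B * h ^ 2 * L ^ (-α)) * (1 / (1 - α)) := by
    refine le_mul_of_one_le_right hX ?_
    rw [le_div_iff₀ ha1]
    linarith
  have hba : 0 ≤ b - a := by linarith
  have c3 : 0 ≤ (C * B * h ^ 2 * L ^ (-α)) * ((b - a) / (1 - α)) := by positivity
  calc _ ≤ 1 / 2 * (B * (C * h ^ 2 * L ^ (-α)) + C * h ^ 2 * B * (L ^ (1 - α) / (1 - α))) := by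
        gcongr
        exact (abs_add_le _ _).trans (add_le_add b1 b2)
    _ ≤ (C * B * h ^ 2 * L ^ (-α)) * (1 / (1 - α))
        + (C * B * h ^ 2 * L ^ (-α)) * ((b - a) / (1 - α)) := by nlinarith
    _ = _ := by ring

/-! ### Taylor estimates -/

lemma HasDerivOnIcc.sub_hasDerivAt {c d : ℝ} {g g₁ p p₁ : ℝ → ℝ} (h : HasDerivOnIcc c d g g₁)
    (hp : ∀ z, HasDerivAt p (p₁ z) z) :
    HasDerivOnIcc c d (fun z => g z - p z) (fun z => g₁ z - p₁ z) :=
  fun z hz => (h z hz).sub (hp z).hasDerivWithinAt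

/-- Mean value inequality on the segment from `x` to `y`. Iterating it yields Taylor bounds without
factorials, which suffices here. -/
lemma HasDerivOnIcc.abs_le_mul_pow {c d B x : ℝ} {g g₁ : ℝ → ℝ} {n : ℕ}
    (h : HasDerivOnIcc c d g g₁) (hx : x ∈ Set.Icc c d) (hgx : g x = 0) (hB : 0 ≤ B)
    (hb : ∀ z ∈ Set.Icc c d, |g₁ z| ≤ B * |z - x| ^ n) :
    ∀ y ∈ Set.Icc c d, |g y| ≤ B * |y - x| ^ (n + 1) := by
  intro y hy
  have hsub : Set.uIcc x y ⊆ Set.Icc c d := Set.OrdConnected.uIcc_subset Set.ordConnected_Icc hx hy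
  have := (convex_uIcc x y).norm_image_sub_le_of_norm_hasDerivWithin_le (f := g) (f' := g₁)
    (C := B * |y - x| ^ n) (fun z hz => (h z (hsub hz)).mono hsub) (fun z hz => by
      refine (hb z (hsub hz)).trans ?_
      gcongr ?_ * ?_ ^ n
      exact Set.abs_sub_left_of_mem_uIcc hz) Set.left_mem_uIcc Set.right_mem_uIcc
  rw [hgx, sub_zero, Real.norm_eq_abs, Real.norm_eq_abs] at this
  rw [pow_succ, ← mul_assoc]
  exact this

lemma HasDerivOnIcc.abs_taylor_two_le {c d B x : ℝ} {g g₁ g₂ : ℝ → ℝ}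
    (h : HasDerivOnIcc c d g g₁) (h₁ : HasDerivOnIcc c d g₁ g₂) (hx : x ∈ Set.Icc c d)
    (hb : ∀ z ∈ Set.Icc c d, |g₂ z| ≤ B) :
    ∀ y ∈ Set.Icc c d, |g y - (g x + g₁ x * (y - x))| ≤ B * |y - x| ^ 2 := by
  have hB : 0 ≤ B := (abs_nonneg _).trans (hb x hx)
  have s1 := (h₁.sub_hasDerivAt (p := fun _ => g₁ x) (p₁ := fun _ => 0)
    (fun z => hasDerivAt_const z _)).abs_le_mul_pow (n := 0) (B := B) hx (sub_self _) hB
    (by simpa using hb)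
  refine (h.sub_hasDerivAt (p := fun y => g x + g₁ x * (y - x)) (p₁ := fun _ => g₁ x)
    (fun z => ?_)).abs_le_mul_pow (n := 1) hx (by simp) hB s1
  simpa using (((hasDerivAt_id z).sub_const x).const_mul (g₁ x)).const_add (g x)

lemma HasDerivOnIcc.abs_taylor_three_le {c d B x : ℝ} {g g₁ g₂ g₃ : ℝ → ℝ}
    (h : HasDerivOnIcc c d g g₁) (h₁ : HasDerivOnIcc c d g₁ g₂) (h₂ : HasDerivOnIcc c d g₂ g₃)
    (hx : x ∈ Set.Icc c d) (hb : ∀ z ∈ Set.Icc c d, |g₃ z| ≤ B) :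
    ∀ y ∈ Set.Icc c d, |g y - (g x + g₁ x * (y - x) + g₂ x * (y - x) ^ 2 / 2)|
      ≤ B * |y - x| ^ 3 := by
  have hB : 0 ≤ B := (abs_nonneg _).trans (hb x hx)
  refine (h.sub_hasDerivAt (p := fun y => g x + g₁ x * (y - x) + g₂ x * (y - x) ^ 2 / 2)
    (p₁ := fun y => g₁ x + g₂ x * (y - x)) (fun z => ?_)).abs_le_mul_pow (n := 2) hx (by simp) hB
    (h₁.abs_taylor_two_le h₂ hx hb)
  have d0 : HasDerivAt (fun y : ℝ => y - x) 1 z := (hasDerivAt_id z).sub_const x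
  have := ((d0.const_mul (g₁ x)).const_add (g x)).add
    (((d0.pow 2).const_mul (g₂ x)).div_const 2)
  convert! this using 1
  simp
  ring

lemma HasDerivOnIcc.abs_taylor_four_le {c d B x : ℝ} {g g₁ g₂ g₃ g₄ : ℝ → ℝ}
    (h : HasDerivOnIcc c d g g₁) (h₁ : HasDerivOnIcc c d g₁ g₂) (h₂ : HasDerivOnIcc c d g₂ g₃)
    (h₃ : HasDerivOnIcc c d g₃ g₄) (hx : x ∈ Set.Icc c d) (hb : ∀ z ∈ Set.Icc c d, |g₄ z| ≤ B) :
    ∀ y ∈ Set.Icc c d, |g y - (g x + g₁ x * (y - x) + g₂ x * (y - x) ^ 2 / 2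
      + g₃ x * (y - x) ^ 3 / 6)| ≤ B * |y - x| ^ 4 := by
  have hB : 0 ≤ B := (abs_nonneg _).trans (hb x hx)
  refine (h.sub_hasDerivAt (p := fun y => g x + g₁ x * (y - x) + g₂ x * (y - x) ^ 2 / 2
      + g₃ x * (y - x) ^ 3 / 6)
    (p₁ := fun y => g₁ x + g₂ x * (y - x) + g₃ x * (y - x) ^ 2 / 2)
    (fun z => ?_)).abs_le_mul_pow (n := 3) hx (by simp) hB (h₁.abs_taylor_three_le h₂ h₃ hx hb)
  have d0 : HasDerivAt (fun y : ℝ => y - x) 1 z := (hasDerivAt_id z).sub_const x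
  have := (((d0.const_mul (g₁ x)).const_add (g x)).add
    (((d0.pow 2).const_mul (g₂ x)).div_const 2)).add (((d0.pow 3).const_mul (g₃ x)).div_const 6)
  convert! this using 1
  simp
  ring

section symmetricDifferences

variable {c d B x δ : ℝ} {g g₁ g₂ g₃ g₄ : ℝ → ℝ}

lemma HasDerivOnIcc.abs_second_difference_le (h : HasDerivOnIcc c d g g₁)
    (h₁ : HasDerivOnIcc c d g₁ g₂) (hδ : 0 ≤ δ) (hl : x - δ ∈ Set.Icc c d)
    (hr : x + δ ∈ Set.Icc c d) (hb : ∀ z ∈ Set.Icc c d, |g₂ z| ≤ B) :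
    |g (x + δ) + g (x - δ) - 2 * g x| ≤ 2 * B * δ ^ 2 := by
  have hx : x ∈ Set.Icc c d := ⟨by linarith [hl.1], by linarith [hr.2]⟩
  have a1 := h.abs_taylor_two_le h₁ hx hb _ hl
  have a2 := h.abs_taylor_two_le h₁ hx hb _ hr
  simp only [sub_sub_cancel_left, add_sub_cancel_left, abs_neg, abs_of_nonneg hδ] at a1 a2
  rw [abs_le] at a1 a2 ⊢
  constructor <;> linarith [a1.1, a1.2, a2.1, a2.2]

lemma HasDerivOnIcc.abs_central_difference_le (h : HasDerivOnIcc c d g g₁)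
    (h₁ : HasDerivOnIcc c d g₁ g₂) (h₂ : HasDerivOnIcc c d g₂ g₃) (hδ : 0 ≤ δ)
    (hl : x - δ ∈ Set.Icc c d) (hr : x + δ ∈ Set.Icc c d) (hb : ∀ z ∈ Set.Icc c d, |g₃ z| ≤ B) :
    |g (x + δ) - g (x - δ) - 2 * δ * g₁ x| ≤ 2 * B * δ ^ 3 := by
  have hx : x ∈ Set.Icc c d := ⟨by linarith [hl.1], by linarith [hr.2]⟩
  have a1 := h.abs_taylor_three_le h₁ h₂ hx hb _ hl
  have a2 := h.abs_taylor_three_le h₁ h₂ hx hb _ hr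
  simp only [sub_sub_cancel_left, add_sub_cancel_left, abs_neg, abs_of_nonneg hδ] at a1 a2
  rw [abs_le] at a1 a2 ⊢
  constructor <;> linarith [a1.1, a1.2, a2.1, a2.2]

lemma HasDerivOnIcc.abs_second_central_difference_le (h : HasDerivOnIcc c d g g₁)
    (h₁ : HasDerivOnIcc c d g₁ g₂) (h₂ : HasDerivOnIcc c d g₂ g₃) (h₃ : HasDerivOnIcc c d g₃ g₄)
    (hδ : 0 ≤ δ) (hl : x - δ ∈ Set.Icc c d) (hr : x + δ ∈ Set.Icc c d)
    (hb : ∀ z ∈ Set.Icc c d, |g₄ z| ≤ B) :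
    |g (x - δ) - 2 * g x + g (x + δ) - δ ^ 2 * g₂ x| ≤ 2 * B * δ ^ 4 := by
  have hx : x ∈ Set.Icc c d := ⟨by linarith [hl.1], by linarith [hr.2]⟩
  have a1 := h.abs_taylor_four_le h₁ h₂ h₃ hx hb _ hl
  have a2 := h.abs_taylor_four_le h₁ h₂ h₃ hx hb _ hr
  simp only [sub_sub_cancel_left, add_sub_cancel_left, abs_neg, abs_of_nonneg hδ] at a1 a2
  rw [abs_le] at a1 a2 ⊢
  constructor <;> linarith [a1.1, a1.2, a2.1, a2.2]

end symmetricDifferences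

lemma HasDerivOnIcc.iteratedDeriv_two {a b x : ℝ} {f f₁ f₂ : ℝ → ℝ} (h : HasDerivOnIcc a b f f₁)
    (h₁ : HasDerivOnIcc a b f₁ f₂) (hx : x ∈ Set.Ioo a b) : iteratedDeriv 2 f x = f₂ x := by
  have e : deriv f =ᶠ[𝓝 x] f₁ := by
    filter_upwards [Ioo_mem_nhds hx.1 hx.2] with y hy using (h.hasDerivAt hy).deriv
  rw [iteratedDeriv_succ, iteratedDeriv_one, e.deriv_eq, (h₁.hasDerivAt hx).deriv]

/-! ### Partial derivatives on a rectangle -/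

/-- Restricting the derivative within the rectangle to horizontal and vertical lines gives partial
derivatives up to the boundary, one-sided there, with one order of smoothness less. -/
lemma exists_partial_derivs {a b T : ℝ} (hab : a < b) (hT : 0 < T) {n : ℕ} {F : ℝ × ℝ → ℝ}
    (hF : ContDiffOn ℝ (n + 1 : ℕ) F (Set.Icc a b ×ˢ Set.Icc 0 T)) :
    ∃ Fx Ft : ℝ × ℝ → ℝ, ContDiffOn ℝ n Fx (Set.Icc a b ×ˢ Set.Icc 0 T) ∧
      ContDiffOn ℝ n Ft (Set.Icc a b ×ˢ Set.Icc 0 T) ∧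
      (∀ t ∈ Set.Icc 0 T, HasDerivOnIcc a b (fun x => F (x, t)) fun x => Fx (x, t)) ∧
      ∀ x ∈ Set.Icc a b, HasDerivOnIcc 0 T (fun t => F (x, t)) fun t => Ft (x, t) := by
  set S := Set.Icc a b ×ˢ Set.Icc 0 T with hS
  have hu : UniqueDiffOn ℝ S := (uniqueDiffOn_Icc hab).prod (uniqueDiffOn_Icc hT)
  have hd : ContDiffOn ℝ n (fderivWithin ℝ F S) S :=
    hF.fderivWithin hu (by norm_cast)
  have hdiff : ∀ p ∈ S, HasFDerivWithinAt F (fderivWithin ℝ F S p) S p := fun p hp =>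
    (hF.differentiableOn (by norm_cast) p hp).hasFDerivWithinAt
  refine ⟨fun p => fderivWithin ℝ F S p (1, 0), fun p => fderivWithin ℝ F S p (0, 1),
    hd.clm_apply contDiffOn_const, hd.clm_apply contDiffOn_const, ?_, ?_⟩
  · intro t ht x hx
    have hγ : HasDerivWithinAt (fun x : ℝ => (x, t)) (1, 0) (Set.Icc a b) x :=
      ((hasDerivAt_id x).prodMk (hasDerivAt_const x t)).hasDerivWithinAt
    have hm : Set.MapsTo (fun x : ℝ => (x, t)) (Set.Icc a b) S := fun y hy => ⟨hy, ht⟩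
    exact (hdiff (x, t) ⟨hx, ht⟩).comp_hasDerivWithinAt x hγ hm
  · intro x hx t ht
    have hγ : HasDerivWithinAt (fun t : ℝ => (x, t)) (0, 1) (Set.Icc 0 T) t :=
      ((hasDerivAt_const t x).prodMk (hasDerivAt_id t)).hasDerivWithinAt
    have hm : Set.MapsTo (fun t : ℝ => (x, t)) (Set.Icc 0 T) S := fun y hy => ⟨hx, hy⟩
    exact (hdiff (x, t) ⟨hx, ht⟩).comp_hasDerivWithinAt t hγ hm

lemma exists_abs_le_on_rectangle {a b T : ℝ} {F : ℝ × ℝ → ℝ}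
    (hF : ContinuousOn F (Set.Icc a b ×ˢ Set.Icc 0 T)) :
    ∃ B, 0 ≤ B ∧ ∀ x ∈ Set.Icc a b, ∀ t ∈ Set.Icc 0 T, |F (x, t)| ≤ B := by
  obtain ⟨B, hB⟩ := (isCompact_Icc.prod isCompact_Icc).exists_bound_of_continuousOn hF
  exact ⟨max B 0, le_max_right _ _, fun x hx t ht =>
    (hB (x, t) ⟨hx, ht⟩).trans (le_max_left _ _)⟩

/-! ### Consistency -/

lemma fracInt_integrable {α a b x : ℝ} (hα1 : α < 1) (hx : x ∈ Set.Icc a b) {g : ℝ → ℝ}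
    (hg : ContinuousOn g (Set.Icc a b)) :
    IntervalIntegrable (fun s => s ^ (-α) * g (x - s)) MeasureTheory.volume 0 (x - a) := by
  refine (intervalIntegral.intervalIntegrable_rpow' (by linarith)).mul_continuousOn ?_
  rw [Set.uIcc_of_le (by linarith [hx.1])]
  exact hg.comp (by fun_prop) fun s hs => ⟨by linarith [hs.2], by linarith [hs.1, hx.2]⟩

lemma fracInt_linear {α a b x : ℝ} (hα1 : α < 1) (hx : x ∈ Set.Icc a b) {g k : ℝ → ℝ}
    (hg : ContinuousOn g (Set.Icc a b)) (hk : ContinuousOn k (Set.Icc a b)) (c : ℝ) :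
    fracInt α a (fun y => g y + c * k y) x = fracInt α a g x + c * fracInt α a k x := by
  simp only [fracInt]
  have e : ∀ s, s ^ (-α) * (g (x - s) + c * k (x - s))
      = s ^ (-α) * g (x - s) + c * (s ^ (-α) * k (x - s)) := fun s => by ring
  simp only [e]
  rw [intervalIntegral.integral_add (fracInt_integrable hα1 hx hg)
    ((fracInt_integrable hα1 hx hk).const_mul c), intervalIntegral.integral_const_mul]
  ring

lemma abs_fracInt_le {α a b x G : ℝ} (hα1 : α < 1) (hx : x ∈ Set.Icc a b) {g : ℝ → ℝ}
    (hG : ∀ y ∈ Set.Icc a b, |g y| ≤ G) :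
    |fracInt α a g x| ≤ 1 / Real.Gamma (1 - α) * ((b - a) ^ (1 - α) / (1 - α)) * G := by
  have hΓ : 0 < Real.Gamma (1 - α) := Real.Gamma_pos_of_pos (by linarith)
  have h1 : 0 < 1 - α := by linarith
  have hG0 : 0 ≤ G := (abs_nonneg _).trans (hG x hx)
  have hxa : 0 ≤ x - a := by linarith [hx.1]
  have := intervalIntegral.norm_integral_le_of_norm_le hxa
    (f := fun s => s ^ (-α) * g (x - s)) (g := fun s => s ^ (-α) * G)
    (Eventually.of_forall fun s hs => by
      rw [Real.norm_eq_abs, abs_mul, abs_of_nonneg (Real.rpow_nonneg hs.1.le _)]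
      exact mul_le_mul_of_nonneg_left (hG _ ⟨by linarith [hs.2], by linarith [hs.1, hx.2]⟩)
        (Real.rpow_nonneg hs.1.le _))
    ((intervalIntegral.intervalIntegrable_rpow' (a := 0) (b := x - a) (r := -α)
        (by linarith)).mul_const G)
  rw [Real.norm_eq_abs, intervalIntegral.integral_mul_const, integral_rpow
    (Or.inl (by linarith)), Real.zero_rpow (by linarith), sub_zero,
    show -α + 1 = 1 - α by ring] at this
  rw [fracInt, abs_mul, abs_of_pos (by positivity : 0 < 1 / Real.Gamma (1 - α)), mul_assoc]
  gcongr
  refine this.trans ?_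
  gcongr
  exact hx.2

/-- The spatial differential operator of the equation, in terms of the first and second
derivatives. -/
noncomputable def spatialDiffOp (α d1 d2 dα a b : ℝ) (f₁ f₂ : ℝ → ℝ) (x : ℝ) : ℝ :=
  -d1 * f₁ x + d2 * f₂ x - dα / (2 * Real.cos (Real.pi * α / 2))
    * (fracInt α a f₁ x + fracInt α a (fun y => -f₁ (a + b - y)) (a + b - x))

lemma spatialDiffOp_eq {α d1 d2 dα a b x : ℝ} (hα1 : α < 1) (hab : a < b) {f f₁ f₂ : ℝ → ℝ}
    (d₀ : HasDerivOnIcc a b f f₁) (d₁ : HasDerivOnIcc a b f₁ f₂) (hfa : f a = 0) (hfb : f b = 0)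
    (h1a : f₁ a = 0) (h1b : f₁ b = 0) (hx : x ∈ Set.Ioo a b) :
    -d1 * deriv f x + d2 * iteratedDeriv 2 f x + dα * riesz α a b f x
      = spatialDiffOp α d1 d2 dα a b f₁ f₂ x := by
  have hx' : a + b - x ∈ Set.Ioo a b := ⟨by linarith [hx.2], by linarith [hx.1]⟩
  have hc : ContinuousOn (fun y => -f₁ (a + b - y)) (Set.Icc a b) :=
    d₁.reflect.continuousOn.neg
  rw [riesz, rlRight_eq_rlLeft α a, rlLeft_eq_fracInt hα1 hab d₀ d₁.continuousOn hfa h1a hx,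
    rlLeft_eq_fracInt hα1 hab d₀.reflect hc (by simpa using hfb)
      (by simpa using h1b) hx', (d₀.hasDerivAt hx).deriv, d₀.iteratedDeriv_two d₁ hx,
    spatialDiffOp]
  ring

lemma mul_add_self_le {h L : ℝ} {j M : ℕ} (hh : 0 < h) (hMh : M * h = L) (hjM : j < M) :
    j * h + h ≤ L := by
  have : (j : ℝ) + 1 ≤ M := by exact_mod_cast hjM
  calc j * h + h = (j + 1) * h := by ring
    _ ≤ M * h := by gcongr
    _ = L := hMh

lemma self_le_mul {h : ℝ} {j : ℕ} (hh : 0 < h) (hj : 0 < j) : h ≤ j * h :=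
  le_mul_of_one_le_left hh.le (by exact_mod_cast hj)

/-- Central differences contribute plain `O(h²)`; the left and right quadratures contribute the
weights singular at the two end points. -/
lemma exists_spatial_consistency {α d1 d2 dα a b : ℝ} (h0 : 0 < α) (h1 : α < 1) (hd1 : 0 < d1)
    (hd2 : 0 < d2) (hdα : 0 < dα) (hab : a < b) :
    ∃ C : ℝ, 0 ≤ C ∧ ∀ (B : ℝ) (f f₁ f₂ f₃ f₄ : ℝ → ℝ), HasDerivOnIcc a b f f₁ →
      HasDerivOnIcc a b f₁ f₂ → HasDerivOnIcc a b f₂ f₃ → HasDerivOnIcc a b f₃ f₄ →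
      f a = 0 → f b = 0 → f₁ a = 0 → f₁ b = 0 → (∀ x ∈ Set.Icc a b, |f₂ x| ≤ B) →
      (∀ x ∈ Set.Icc a b, |f₃ x| ≤ B) → (∀ x ∈ Set.Icc a b, |f₄ x| ≤ B) →
      ∀ (M : ℕ) (h : ℝ), h = (b - a) / M → ∀ j ∈ Ioo 0 M,
        |spatialOp α d1 d2 dα h M (fun i => f (a + i * h)) j
          - spatialDiffOp α d1 d2 dα a b f₁ f₂ (a + j * h)|
        ≤ C * B * h ^ 2 * ((j * h) ^ (-α) + ((M - j : ℕ) * h) ^ (-α)) := by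
  obtain ⟨C₀, hC₀, hQ⟩ := exists_quadrature_error h0 h1
  have hcos := cos_half_pi_mul_pos h0 h1
  have hba : 0 < b - a := by linarith
  set κ : ℝ := dα / (2 * Real.cos (Real.pi * α / 2)) with hκ
  have hκ0 : 0 < κ := by positivity
  refine ⟨(2 * d2 + d1) * (b - a) ^ α + κ * (C₀ * (1 + (b - a))), by positivity, ?_⟩
  intro B f f₁ f₂ f₃ f₄ D₀ D₁ D₂ D₃ hfa hfb h1a h1b hB₂ hB₃ hB₄ M h hh j hj
  obtain ⟨hj0, hjM⟩ := mem_Ioo.1 hj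
  have hM : (0 : ℝ) < M := by exact_mod_cast hj0.trans hjM
  have hh0 : 0 < h := by rw [hh]; positivity
  have hMh : M * h = b - a := by rw [hh]; field_simp
  have hj1 : (1 : ℝ) ≤ j := by exact_mod_cast hj0
  have hjh := self_le_mul hh0 hj0
  have hjh' := mul_add_self_le hh0 hMh hjM
  have hB0 : 0 ≤ B := (abs_nonneg _).trans (hB₂ a ⟨le_rfl, hab.le⟩)
  set x : ℝ := a + j * h with hx
  have hl : x - h ∈ Set.Icc a b := ⟨by linarith, by linarith⟩
  have hr : x + h ∈ Set.Icc a b := ⟨by linarith, by linarith⟩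
  have X1 := D₀.abs_second_central_difference_le D₁ D₂ D₃ hh0.le hl hr hB₄
  have X2 := D₀.abs_central_difference_le D₁ D₂ hh0.le hl hr hB₃
  have Q1 := hQ a b B f f₁ f₂ f₃ D₀ D₁ D₂ D₃.continuousOn hfa h1a hB₂ hB₃ h j hh0 hj0
    (by linarith)
  have hrefl : ∀ y ∈ Set.Icc a b, a + b - y ∈ Set.Icc a b := fun y hy =>
    ⟨by linarith [hy.2], by linarith [hy.1]⟩
  have D₁' : HasDerivOnIcc a b (fun y => -f₁ (a + b - y)) (fun y => f₂ (a + b - y)) := by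
    intro y hy
    have := (D₁.reflect y hy).neg
    rw [neg_neg] at this
    exact this
  have D₃' : HasDerivOnIcc a b (fun y => -f₃ (a + b - y)) (fun y => f₄ (a + b - y)) := by
    intro y hy
    have := (D₃.reflect y hy).neg
    rw [neg_neg] at this
    exact this
  have hcast : ((M - j : ℕ) : ℝ) = M - j := Nat.cast_sub hjM.le
  -- The right quadrature is the left one for the reflected function, at distance `(M - j) h` from
  -- its base point.
  have Q2 := hQ a b B (fun y => f (a + b - y)) (fun y => -f₁ (a + b - y))
    (fun y => f₂ (a + b - y)) (fun y => -f₃ (a + b - y)) D₀.reflect D₁' D₂.reflect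
    D₃'.continuousOn (by simpa using hfb) (by simpa using h1b) (fun y hy => hB₂ _ (hrefl y hy))
    (fun y hy => by rw [abs_neg]; exact hB₃ _ (hrefl y hy)) h (M - j) hh0 (by omega)
    (by rw [hcast, sub_mul]; linarith)
  set p : ℝ := (j * h) ^ (-α) with hp
  set q : ℝ := ((M - j : ℕ) * h) ^ (-α) with hq
  have hp0 : 0 < p := by positivity
  have hq0 : 0 ≤ q := by positivity
  -- Since `jh ≤ b - a`, the nonsingular errors can be absorbed into the singular weight.
  have hpone : 1 ≤ (b - a) ^ α * p := by
    have h2 : (b - a) ^ (-α) ≤ p := Real.rpow_le_rpow_of_nonpos (by positivity)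
      (by linarith) (by linarith)
    calc (1 : ℝ) = (b - a) ^ α * (b - a) ^ (-α) := by
          rw [← Real.rpow_add hba]; simp
      _ ≤ _ := by gcongr
  have e2 : a + ((M - j : ℕ) : ℝ) * h = a + b - x := by rw [hcast, hx]; linarith
  rw [e2] at Q2
  have hν : nu α dα h = κ * h ^ (-α) := by
    rw [nu, hκ, Real.rpow_neg hh0.le]
    field_simp
  have hS1 : ∑ l ∈ range (j + 1), weight2 α l * f (a + ((j - l : ℕ) : ℝ) * h)
      = ∑ l ∈ range (j + 1), weight2 α l * f (x - l * h) := by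
    refine sum_congr rfl fun l hl => ?_
    rw [Nat.cast_sub (Nat.lt_succ_iff.1 (mem_range.1 hl)), hx]
    ring_nf
  have hS2 : ∑ l ∈ range (M - j + 1), weight2 α l * f (a + ((j + l : ℕ) : ℝ) * h)
      = ∑ l ∈ range (M - j + 1), weight2 α l * f (a + b - (a + b - x - l * h)) := by
    refine sum_congr rfl fun l _ => ?_
    rw [hx]
    push_cast
    ring_nf
  have e3 : a + ((j - 1 : ℕ) : ℝ) * h = x - h := by
    rw [Nat.cast_sub hj0, hx]
    push_cast
    ring
  have e4 : a + ((j + 1 : ℕ) : ℝ) * h = x + h := by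
    rw [hx]
    push_cast
    ring
  have hdiff : spatialOp α d1 d2 dα h M (fun i => f (a + i * h)) j
        - spatialDiffOp α d1 d2 dα a b f₁ f₂ x
      = d2 / h ^ 2 * (f (x - h) - 2 * f x + f (x + h) - h ^ 2 * f₂ x)
        - d1 / (2 * h) * (f (x + h) - f (x - h) - 2 * h * f₁ x)
        - κ * ((h ^ (-α) * ∑ l ∈ range (j + 1), weight2 α l * f (x - l * h) - fracInt α a f₁ x)
          + (h ^ (-α) * ∑ l ∈ range (M - j + 1),
              weight2 α l * f (a + b - (a + b - x - l * h))
            - fracInt α a (fun y => -f₁ (a + b - y)) (a + b - x))) := by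
    rw [spatialOp, spatialDiffOp, rieszSum, hS1, hS2, e3, e4, hν, ← hκ, ← hx]
    field_simp
    ring
  rw [hdiff]
  have b1 : |d2 / h ^ 2 * (f (x - h) - 2 * f x + f (x + h) - h ^ 2 * f₂ x)|
      ≤ 2 * d2 * B * h ^ 2 := by
    rw [abs_mul, abs_of_pos (by positivity)]
    calc _ ≤ d2 / h ^ 2 * (2 * B * h ^ 4) := by gcongr
      _ = _ := by field_simp
  have b2 : |d1 / (2 * h) * (f (x + h) - f (x - h) - 2 * h * f₁ x)| ≤ d1 * B * h ^ 2 := by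
    rw [abs_mul, abs_of_pos (by positivity)]
    calc _ ≤ d1 / (2 * h) * (2 * B * h ^ 3) := by gcongr
      _ = _ := by field_simp
  set Y1 := h ^ (-α) * ∑ l ∈ range (j + 1), weight2 α l * f (x - l * h) - fracInt α a f₁ x
  set Y2 := h ^ (-α) * ∑ l ∈ range (M - j + 1), weight2 α l * f (a + b - (a + b - x - l * h))
            - fracInt α a (fun y => -f₁ (a + b - y)) (a + b - x)
  have b3 : |κ * (Y1 + Y2)| ≤ κ * (C₀ * B * (1 + (b - a)) * h ^ 2 * (p + q)) := by
    rw [abs_mul, abs_of_pos hκ0]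
    gcongr
    refine (abs_add_le _ _).trans ((add_le_add Q1 Q2).trans_eq ?_)
    ring
  have b4 : (2 * d2 + d1) * B * h ^ 2 * 1
      ≤ (2 * d2 + d1) * B * h ^ 2 * ((b - a) ^ α * (p + q)) := by
    gcongr
    refine hpone.trans ?_
    gcongr
    linarith
  calc _ ≤ 2 * d2 * B * h ^ 2 + d1 * B * h ^ 2
        + κ * (C₀ * B * (1 + (b - a)) * h ^ 2 * (p + q)) := by
        refine (abs_sub _ _).trans (add_le_add ((abs_sub _ _).trans (add_le_add b1 b2)) b3)
    _ ≤ _ := by linarith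

lemma spatialDiffOp_linear {α d1 d2 dα a b x : ℝ} (h1 : α < 1) (hx : x ∈ Set.Icc a b)
    {f₁ f₂ g₁ g₂ : ℝ → ℝ} (hf : ContinuousOn f₁ (Set.Icc a b))
    (hg : ContinuousOn g₁ (Set.Icc a b)) (c : ℝ) :
    spatialDiffOp α d1 d2 dα a b (fun y => f₁ y + c * g₁ y) (fun y => f₂ y + c * g₂ y) x
      = spatialDiffOp α d1 d2 dα a b f₁ f₂ x + c * spatialDiffOp α d1 d2 dα a b g₁ g₂ x := by
  have hrefl : Set.MapsTo (fun y => a + b - y) (Set.Icc a b) (Set.Icc a b) := fun y hy =>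
    ⟨by linarith [hy.2], by linarith [hy.1]⟩
  have hf' : ContinuousOn (fun y => -f₁ (a + b - y)) (Set.Icc a b) :=
    (hf.comp (by fun_prop) hrefl).neg
  have hg' : ContinuousOn (fun y => -g₁ (a + b - y)) (Set.Icc a b) :=
    (hg.comp (by fun_prop) hrefl).neg
  have e : (fun y => -(f₁ (a + b - y) + c * g₁ (a + b - y)))
      = fun y => -f₁ (a + b - y) + c * -g₁ (a + b - y) := by
    ext y
    ring
  simp only [spatialDiffOp]
  rw [fracInt_linear h1 hx hf hg, e, fracInt_linear h1 (hrefl hx) hf' hg']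
  ring

lemma exists_abs_spatialDiffOp_le {α d1 d2 dα a b : ℝ} (h0 : 0 < α) (h1 : α < 1) (hd1 : 0 < d1)
    (hd2 : 0 < d2) (hdα : 0 < dα) (hab : a < b) :
    ∃ C : ℝ, 0 ≤ C ∧ ∀ (G : ℝ) (g₁ g₂ : ℝ → ℝ), (∀ y ∈ Set.Icc a b, |g₁ y| ≤ G) →
      (∀ y ∈ Set.Icc a b, |g₂ y| ≤ G) → ∀ x ∈ Set.Icc a b,
        |spatialDiffOp α d1 d2 dα a b g₁ g₂ x| ≤ C * G := by
  have hcos := cos_half_pi_mul_pos h0 h1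
  have hba : 0 < b - a := by linarith
  have hα : 0 < 1 - α := by linarith
  have hΓ : 0 < Real.Gamma (1 - α) := Real.Gamma_pos_of_pos hα
  set κ : ℝ := dα / (2 * Real.cos (Real.pi * α / 2)) with hκ
  have hκ0 : 0 < κ := by positivity
  refine ⟨d1 + d2 + κ * (2 * (1 / Real.Gamma (1 - α) * ((b - a) ^ (1 - α) / (1 - α)))),
    by positivity, fun G g₁ g₂ hG₁ hG₂ x hx => ?_⟩
  have hrefl : ∀ y ∈ Set.Icc a b, a + b - y ∈ Set.Icc a b := fun y hy =>
    ⟨by linarith [hy.2], by linarith [hy.1]⟩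
  have f1 := abs_fracInt_le (α := α) h1 hx hG₁
  have f2 := abs_fracInt_le (α := α) (g := fun y => -g₁ (a + b - y)) h1 (hrefl x hx)
    fun y hy => by rw [abs_neg]; exact hG₁ _ (hrefl y hy)
  rw [spatialDiffOp, ← hκ]
  have a1 : |-d1 * g₁ x| ≤ d1 * G := by
    rw [abs_mul, abs_neg, abs_of_pos hd1]
    exact mul_le_mul_of_nonneg_left (hG₁ x hx) hd1.le
  have a2 : |d2 * g₂ x| ≤ d2 * G := by
    rw [abs_mul, abs_of_pos hd2]
    exact mul_le_mul_of_nonneg_left (hG₂ x hx) hd2.le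
  have a3 : |κ * (fracInt α a g₁ x + fracInt α a (fun y => -g₁ (a + b - y)) (a + b - x))|
      ≤ κ * (1 / Real.Gamma (1 - α) * ((b - a) ^ (1 - α) / (1 - α)) * G
        + 1 / Real.Gamma (1 - α) * ((b - a) ^ (1 - α) / (1 - α)) * G) := by
    rw [abs_mul, abs_of_pos hκ0]
    exact mul_le_mul_of_nonneg_left ((abs_add_le _ _).trans (add_le_add f1 f2)) hκ0.le
  refine ((abs_sub _ _).trans (add_le_add ((abs_add_le _ _).trans (add_le_add a1 a2)) a3)).trans_eq
    ?_
  ring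

/-- A telescoping sum: the concave `x^(1-α)` lies below its tangent at `n + 1`. -/
lemma sum_rpow_neg_le {α : ℝ} (h0 : 0 < α) (h1 : α < 1) (n : ℕ) :
    ∑ i ∈ range n, ((i : ℝ) + 1) ^ (-α) ≤ (n : ℝ) ^ (1 - α) / (1 - α) := by
  have hα : 0 < 1 - α := by linarith
  induction n with
  | zero => simp [Real.zero_rpow hα.ne']
  | succ n ih =>
    have h := rpow_le_rpow_add_mul_sub (p := 1 - α) (y := (n : ℝ)) (z := (n : ℝ) + 1) hα.le
      (by linarith) (by positivity) (by positivity)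
    rw [show 1 - α - 1 = -α by ring] at h
    rw [sum_range_succ]
    push_cast
    rw [le_div_iff₀ hα] at ih ⊢
    linarith

/-- Uniform `L¹` bound for the singular weights: a Riemann sum of an integrable function. -/
lemma mul_sum_rpow_neg_le {α h : ℝ} (h0 : 0 < α) (h1 : α < 1) (hh : 0 < h) (M : ℕ) :
    h * ∑ j ∈ Ioo 0 M, ((j * h) ^ (-α) + ((M - j : ℕ) * h) ^ (-α))
      ≤ 2 * ((M * h) ^ (1 - α) / (1 - α)) := by
  have hα : 0 < 1 - α := by linarith
  have s2 : ∑ j ∈ Ioo 0 M, (((M - j : ℕ) : ℝ) * h) ^ (-α) = ∑ j ∈ Ioo 0 M, ((j : ℝ) * h) ^ (-α) :=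
    sum_bij' (fun j _ => M - j) (fun j _ => M - j)
      (fun j hj => by have := mem_Ioo.1 hj; exact mem_Ioo.2 (by omega))
      (fun j hj => by have := mem_Ioo.1 hj; exact mem_Ioo.2 (by omega))
      (fun j hj => by have := mem_Ioo.1 hj; omega)
      (fun j hj => by have := mem_Ioo.1 hj; omega) (fun j hj => rfl)
  have s1 : h * ∑ j ∈ Ioo 0 M, ((j : ℝ) * h) ^ (-α) ≤ (M * h) ^ (1 - α) / (1 - α) := by
    cases M with
    | zero =>
      simp [Real.zero_rpow hα.ne']
    | succ m =>
      rw [sum_Ioo_zero_succ]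
      have e : ∑ i ∈ range m, (((i + 1 : ℕ) : ℝ) * h) ^ (-α)
          = h ^ (-α) * ∑ i ∈ range m, ((i : ℝ) + 1) ^ (-α) := by
        rw [mul_sum]
        refine sum_congr rfl fun i _ => ?_
        rw [Real.mul_rpow (by positivity) hh.le]
        push_cast
        ring
      have eh : h * h ^ (-α) = h ^ (1 - α) := by
        rw [sub_eq_add_neg, Real.rpow_add hh, Real.rpow_one]
      rw [e, ← mul_assoc, eh, Real.mul_rpow (by positivity) hh.le, mul_comm, div_eq_mul_inv,
        mul_right_comm, ← div_eq_mul_inv]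
      gcongr
      refine (sum_rpow_neg_le h0 h1 m).trans ?_
      gcongr
      simp
  rw [sum_add_distrib, s2, mul_add]
  linarith

set_option maxHeartbeats 4000000 in
/-- Consistency of second order of the Crank–Nicolson scheme. -/
lemma exists_truncation_error_le {α d1 d2 dα a b T : ℝ} (h0 : 0 < α) (h1 : α < 1) (hd1 : 0 < d1)
    (hd2 : 0 < d2) (hdα : 0 < dα) (hab : a < b) (hT : 0 < T) {φ : ℝ → ℝ} {s u : ℝ → ℝ → ℝ}
    (hu : IsSolution α d1 d2 dα a b T φ s u)
    (hreg : ContDiffOn ℝ 4 (fun p : ℝ × ℝ => u p.1 p.2) (Set.Icc a b ×ˢ Set.Icc 0 T))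
    (hua : ∀ t ∈ Set.Icc 0 T, derivWithin (fun x => u x t) (Set.Icc a b) a = 0)
    (hub : ∀ t ∈ Set.Icc 0 T, derivWithin (fun x => u x t) (Set.Icc a b) b = 0) :
    ∃ C : ℝ, 0 ≤ C ∧ ∀ M N : ℕ, 0 < M → 0 < N → ∀ h τ : ℝ, h = (b - a) / M → τ = T / N →
      ∀ k < N, ∀ j ∈ Ioo 0 M,
        |2 / τ * (u (a + j * h) ((k + 1 : ℕ) * τ) - u (a + j * h) (k * τ))
          - (spatialOp α d1 d2 dα h M (fun i => u (a + i * h) ((k + 1 : ℕ) * τ)) j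
            + spatialOp α d1 d2 dα h M (fun i => u (a + i * h) (k * τ)) j)
          - 2 * s (a + j * h) ((k + 1 / 2) * τ)|
        ≤ C * (τ ^ 2 + h ^ 2) * ((j * h) ^ (-α) + ((M - j : ℕ) * h) ^ (-α)) := by
  obtain ⟨ux, ut, cux, cut, dx0, dt0⟩ := exists_partial_derivs hab hT (n := 3)
    (F := fun p : ℝ × ℝ => u p.1 p.2) (by exact_mod_cast hreg)
  obtain ⟨uxx, uxt, cuxx, cuxt, dx1, dt1⟩ := exists_partial_derivs hab hT (n := 2)
    (F := ux) (by exact_mod_cast cux)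
  obtain ⟨uxxx, uxxt, cuxxx, cuxxt, dx2, dt2⟩ := exists_partial_derivs hab hT (n := 1)
    (F := uxx) (by exact_mod_cast cuxx)
  obtain ⟨uxxxx, -, cuxxxx, -, dx3, -⟩ := exists_partial_derivs hab hT (n := 0)
    (F := uxxx) (by exact_mod_cast cuxxx)
  obtain ⟨-, utt, -, cutt, -, dtt⟩ := exists_partial_derivs hab hT (n := 2)
    (F := ut) (by exact_mod_cast cut)
  obtain ⟨-, uttt, -, cuttt, -, dttt⟩ := exists_partial_derivs hab hT (n := 1)
    (F := utt) (by exact_mod_cast cutt)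
  -- Time derivatives are taken after the space derivatives, so mixed derivatives never have to be
  -- interchanged.
  obtain ⟨-, uxtt, -, cuxtt, -, dxtt⟩ := exists_partial_derivs hab hT (n := 1)
    (F := uxt) (by exact_mod_cast cuxt)
  obtain ⟨-, uxxtt, -, cuxxtt, -, dxxtt⟩ := exists_partial_derivs hab hT (n := 0)
    (F := uxxt) (by exact_mod_cast cuxxt)
  obtain ⟨B1, hB1, bxx⟩ := exists_abs_le_on_rectangle cuxx.continuousOn
  obtain ⟨B2, hB2, bxxx⟩ := exists_abs_le_on_rectangle cuxxx.continuousOn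
  obtain ⟨B3, hB3, bxxxx⟩ := exists_abs_le_on_rectangle cuxxxx.continuousOn
  obtain ⟨B4, hB4, bttt⟩ := exists_abs_le_on_rectangle cuttt.continuousOn
  obtain ⟨B5, hB5, bxtt⟩ := exists_abs_le_on_rectangle cuxtt.continuousOn
  obtain ⟨B6, hB6, bxxtt⟩ := exists_abs_le_on_rectangle cuxxtt.continuousOn
  obtain ⟨C₁, hC₁, hcons⟩ := exists_spatial_consistency (d1 := d1) h0 h1 hd1 hd2 hdα hab
  obtain ⟨C₂, hC₂, hop⟩ := exists_abs_spatialDiffOp_le (d1 := d1) h0 h1 hd1 hd2 hdα hab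
  obtain ⟨B, hBn, l1, l2, l3, l4, l5, l6⟩ : ∃ B : ℝ, 0 ≤ B ∧ B1 ≤ B ∧ B2 ≤ B ∧ B3 ≤ B ∧ B4 ≤ B ∧
      B5 ≤ B ∧ B6 ≤ B :=
    ⟨B1 + B2 + B3 + B4 + B5 + B6, by positivity, by linarith, by linarith, by linarith,
      by linarith, by linarith, by linarith⟩
  have hba : 0 < b - a := by linarith
  refine ⟨2 * C₁ * B + (B + C₂ * B) * (b - a) ^ α, by positivity, ?_⟩
  intro M N hM hN h τ hh hτ k hk j hj
  obtain ⟨hj0, hjM⟩ := mem_Ioo.1 hj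
  have hMr : (0 : ℝ) < M := by exact_mod_cast hM
  have hNr : (0 : ℝ) < N := by exact_mod_cast hN
  have hh0 : 0 < h := by rw [hh]; positivity
  have hτ0 : 0 < τ := by rw [hτ]; positivity
  have hMh : M * h = b - a := by rw [hh]; field_simp
  have hNτ : N * τ = T := by rw [hτ]; field_simp
  have hj1 : (1 : ℝ) ≤ j := by exact_mod_cast hj0
  have hjh := self_le_mul hh0 hj0
  have hjh' := mul_add_self_le hh0 hMh hjM
  have hkT := mul_add_self_le hτ0 hNτ hk
  have hk0 : (0 : ℝ) ≤ k := k.cast_nonneg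
  set x : ℝ := a + j * h with hx
  set m : ℝ := (k + 1 / 2) * τ with hm
  have hxo : x ∈ Set.Ioo a b := ⟨by linarith, by linarith⟩
  have hxI := Set.Ioo_subset_Icc_self hxo
  have hmo : m ∈ Set.Ioo 0 T := ⟨by positivity, by rw [hm, add_mul]; linarith⟩
  have hmI := Set.Ioo_subset_Icc_self hmo
  have el : (k : ℝ) * τ = m - τ / 2 := by rw [hm]; ring
  have er : ((k + 1 : ℕ) : ℝ) * τ = m + τ / 2 := by rw [hm]; push_cast; ring
  have hτ2 : 0 ≤ τ / 2 := by positivity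
  have hlI : m - τ / 2 ∈ Set.Icc 0 T := ⟨by rw [← el]; positivity, by rw [← el]; linarith⟩
  have hrI : m + τ / 2 ∈ Set.Icc 0 T :=
    ⟨by rw [← er]; positivity, by rw [← er]; push_cast; rw [add_mul]; linarith⟩
  rw [el, er]
  have haI : a ∈ Set.Icc a b := ⟨le_rfl, hab.le⟩
  have hbI : b ∈ Set.Icc a b := ⟨hab.le, le_rfl⟩
  have hxa : ∀ t ∈ Set.Icc 0 T, ux (a, t) = 0 := fun t ht => by
    rw [← hua t ht]
    exact ((dx0 t ht a haI).derivWithin (uniqueDiffOn_Icc hab a haI)).symm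
  have hxb : ∀ t ∈ Set.Icc 0 T, ux (b, t) = 0 := fun t ht => by
    rw [← hub t ht]
    exact ((dx0 t ht b hbI).derivWithin (uniqueDiffOn_Icc hab b hbI)).symm
  have hspace : ∀ t ∈ Set.Icc 0 T, |spatialOp α d1 d2 dα h M (fun i => u (a + i * h) t) j
      - spatialDiffOp α d1 d2 dα a b (fun y => ux (y, t)) (fun y => uxx (y, t)) x|
      ≤ C₁ * B * h ^ 2 * ((j * h) ^ (-α) + ((M - j : ℕ) * h) ^ (-α)) := fun t ht =>
    hcons B (fun y => u y t) (fun y => ux (y, t)) (fun y => uxx (y, t)) (fun y => uxxx (y, t))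
      (fun y => uxxxx (y, t)) (dx0 t ht) (dx1 t ht) (dx2 t ht) (dx3 t ht)
      (hu.boundary_left t ht) (hu.boundary_right t ht) (hxa t ht) (hxb t ht)
      (fun y hy => (bxx y hy t ht).trans l1)
      (fun y hy => (bxxx y hy t ht).trans l2)
      (fun y hy => (bxxxx y hy t ht).trans l3) M h hh j hj
  have S1 := hspace _ hlI
  have S2 := hspace _ hrI
  have Tm : |u x (m + τ / 2) - u x (m - τ / 2) - 2 * (τ / 2) * ut (x, m)|
      ≤ 2 * B * (τ / 2) ^ 3 :=
    (dt0 x hxI).abs_central_difference_le (dtt x hxI) (dttt x hxI) hτ2 hlI hrI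
      fun t ht => (bttt x hxI t ht).trans l4
  -- By linearity this second difference in time moves onto `u_x` and `u_xx` inside the operator,
  -- which is bounded in the maximum norm.
  have hav : |spatialDiffOp α d1 d2 dα a b (fun y => ux (y, m + τ / 2))
        (fun y => uxx (y, m + τ / 2)) x
      + spatialDiffOp α d1 d2 dα a b (fun y => ux (y, m - τ / 2)) (fun y => uxx (y, m - τ / 2)) x
      - 2 * spatialDiffOp α d1 d2 dα a b (fun y => ux (y, m)) (fun y => uxx (y, m)) x|
      ≤ C₂ * (2 * B * (τ / 2) ^ 2) := by
    have e1 := spatialDiffOp_linear (d1 := d1) (d2 := d2) (dα := dα) h1 hxI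
      (f₁ := fun y => ux (y, m + τ / 2)) (f₂ := fun y => uxx (y, m + τ / 2))
      (g₁ := fun y => ux (y, m - τ / 2)) (g₂ := fun y => uxx (y, m - τ / 2))
      (dx1 _ hrI).continuousOn (dx1 _ hlI).continuousOn 1
    have e2 := spatialDiffOp_linear (d1 := d1) (d2 := d2) (dα := dα) h1 hxI
      (f₁ := fun y => ux (y, m + τ / 2) + 1 * ux (y, m - τ / 2))
      (f₂ := fun y => uxx (y, m + τ / 2) + 1 * uxx (y, m - τ / 2))
      (g₁ := fun y => ux (y, m)) (g₂ := fun y => uxx (y, m))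
      ((dx1 _ hrI).continuousOn.add ((dx1 _ hlI).continuousOn.const_mul 1))
      (dx1 _ hmI).continuousOn (-2)
    have e : spatialDiffOp α d1 d2 dα a b (fun y => ux (y, m + τ / 2))
        (fun y => uxx (y, m + τ / 2)) x
      + spatialDiffOp α d1 d2 dα a b (fun y => ux (y, m - τ / 2)) (fun y => uxx (y, m - τ / 2)) x
      - 2 * spatialDiffOp α d1 d2 dα a b (fun y => ux (y, m)) (fun y => uxx (y, m)) x
      = spatialDiffOp α d1 d2 dα a b
        (fun y => ux (y, m + τ / 2) + 1 * ux (y, m - τ / 2) + -2 * ux (y, m))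
        (fun y => uxx (y, m + τ / 2) + 1 * uxx (y, m - τ / 2) + -2 * uxx (y, m)) x := by
      rw [e2, e1]
      ring
    rw [e]
    refine hop _ _ _ (fun y hy => ?_) (fun y hy => ?_) x hxI
    · have := (dt1 y hy).abs_second_difference_le (dxtt y hy) hτ2 hlI hrI
        fun t ht => (bxtt y hy t ht).trans l5
      rwa [one_mul, neg_mul, ← sub_eq_add_neg]
    · have := (dt2 y hy).abs_second_difference_le (dxxtt y hy) hτ2 hlI hrI
        fun t ht => (bxxtt y hy t ht).trans l6
      rwa [one_mul, neg_mul, ← sub_eq_add_neg]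
  -- The equation is used only at the midpoint in time, about which both time expansions are
  -- symmetric.
  have hpde : ut (x, m) = spatialDiffOp α d1 d2 dα a b (fun y => ux (y, m))
      (fun y => uxx (y, m)) x + s x m := by
    have heq := hu.equation x hxo m hmo
    have hder : deriv (fun r => u x r) m = ut (x, m) := ((dt0 x hxI).hasDerivAt hmo).deriv
    rw [hder, spatialDiffOp_eq h1 hab (dx0 m hmI) (dx1 m hmI) (hu.boundary_left m hmI)
      (hu.boundary_right m hmI) (hxa m hmI) (hxb m hmI) hxo] at heq
    exact heq
  set p : ℝ := (j * h) ^ (-α) with hp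
  set q : ℝ := ((M - j : ℕ) * h) ^ (-α) with hq
  have hp0 : 0 < p := by positivity
  have hq0 : 0 ≤ q := by positivity
  have hpone : 1 ≤ (b - a) ^ α * (p + q) := by
    have h2 : (b - a) ^ (-α) ≤ p := Real.rpow_le_rpow_of_nonpos (by positivity)
      (by linarith) (by linarith)
    calc (1 : ℝ) = (b - a) ^ α * (b - a) ^ (-α) := by
          rw [← Real.rpow_add hba]; simp
      _ ≤ _ := by
          gcongr
          linarith
  set O1 := spatialOp α d1 d2 dα h M (fun i => u (a + i * h) (m + τ / 2)) j
  set O2 := spatialOp α d1 d2 dα h M (fun i => u (a + i * h) (m - τ / 2)) j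
  set P1 := spatialDiffOp α d1 d2 dα a b (fun y => ux (y, m + τ / 2))
        (fun y => uxx (y, m + τ / 2)) x
  set P2 := spatialDiffOp α d1 d2 dα a b (fun y => ux (y, m - τ / 2))
        (fun y => uxx (y, m - τ / 2)) x
  set P0 := spatialDiffOp α d1 d2 dα a b (fun y => ux (y, m)) (fun y => uxx (y, m)) x
  have hTm : |2 / τ * (u x (m + τ / 2) - u x (m - τ / 2) - 2 * (τ / 2) * ut (x, m))|
      ≤ B * τ ^ 2 := by
    rw [abs_mul, abs_of_pos (by positivity)]
    calc _ ≤ 2 / τ * (2 * B * (τ / 2) ^ 3) := by gcongr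
      _ = 1 / 2 * (B * τ ^ 2) := by field_simp
      _ ≤ _ := by
        have : 0 ≤ B * τ ^ 2 := by positivity
        linarith
  -- The truncation error splits into the time difference, the two spatial consistency errors and
  -- the error of averaging in time.
  have hsplit : 2 / τ * (u x (m + τ / 2) - u x (m - τ / 2)) - (O1 + O2) - 2 * s x m
      = 2 / τ * (u x (m + τ / 2) - u x (m - τ / 2) - 2 * (τ / 2) * ut (x, m))
        - (O1 - P1) - (O2 - P2) - (P1 + P2 - 2 * P0) := by
    have : s x m = ut (x, m) - P0 := by rw [hpde]; ring
    rw [this]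
    field_simp
    ring
  rw [hsplit]
  have hfin : |2 / τ * (u x (m + τ / 2) - u x (m - τ / 2) - 2 * (τ / 2) * ut (x, m))
        - (O1 - P1) - (O2 - P2) - (P1 + P2 - 2 * P0)|
      ≤ B * τ ^ 2 + C₁ * B * h ^ 2 * (p + q) + C₁ * B * h ^ 2 * (p + q)
        + C₂ * (2 * B * (τ / 2) ^ 2) := by
    refine (abs_sub _ _).trans (add_le_add ((abs_sub _ _).trans (add_le_add
      ((abs_sub _ _).trans (add_le_add hTm S2)) S1)) hav)
  refine hfin.trans ?_
  have t1 : (B + C₂ * B) * τ ^ 2 * 1 ≤ (B + C₂ * B) * τ ^ 2 * ((b - a) ^ α * (p + q)) := by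
    gcongr
  have t2 : 0 ≤ C₂ * B * τ ^ 2 := by positivity
  have t3 : 0 ≤ C₁ * B * τ ^ 2 * (p + q) := by positivity
  have t4 : 0 ≤ (B + C₂ * B) * (b - a) ^ α * h ^ 2 * (p + q) := by positivity
  linarith

/-! ### Convergence. -/

theorem exists_convergence_bound {α d1 d2 dα a b T : ℝ} (h0 : 0 < α) (h1 : α < 1) (hd1 : 0 < d1)
    (hd2 : 0 < d2) (hdα : 0 < dα) (hab : a < b) (hT : 0 < T) {φ : ℝ → ℝ} {s u : ℝ → ℝ → ℝ}
    (hu : IsSolution α d1 d2 dα a b T φ s u)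
    (hreg : ContDiffOn ℝ 4 (fun p : ℝ × ℝ => u p.1 p.2) (Set.Icc a b ×ˢ Set.Icc 0 T))
    (hua : ∀ t ∈ Set.Icc 0 T, derivWithin (fun x => u x t) (Set.Icc a b) a = 0)
    (hub : ∀ t ∈ Set.Icc 0 T, derivWithin (fun x => u x t) (Set.Icc a b) b = 0) :
    ∃ C : ℝ, ∀ M N : ℕ, 0 < M → 0 < N → ∀ h τ : ℝ, h = (b - a) / M → τ = T / N →
      ∀ U : ℕ → ℕ → ℝ,
        IsSchemeSolution α d1 d2 dα h τ M N
          (fun j => φ (a + j * h)) (fun k j => s (a + j * h) ((k + 1 / 2) * τ)) U →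
        ∀ k : ℕ, k ≤ N →
          discreteL2 h M (fun j => u (a + j * h) (k * τ) - U k j) ≤ C * (τ ^ 2 + h ^ 2) := by
  obtain ⟨C, hC, hR⟩ := exists_truncation_error_le h0 h1 hd1 hd2 hdα hab hT hu hreg hua hub
  have hba : 0 < b - a := by linarith
  have hα : 0 < 1 - α := by linarith
  set S : ℝ := 2 * ((b - a) ^ (1 - α) / (1 - α)) with hS
  -- The square root of the bound in `energy_estimate` with `kτ ≤ T`, `Mh = b - a` and `A = C (τ² +
  -- h²) S`, where `S` bounds the discrete `L¹` norm of the weights.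
  refine ⟨Real.sqrt (T * (b - a) / (8 * d2)) * (C * S), ?_⟩
  intro M N hM hN h τ hh hτ U hU k hk
  have hMr : (0 : ℝ) < M := by exact_mod_cast hM
  have hNr : (0 : ℝ) < N := by exact_mod_cast hN
  have hh0 : 0 < h := by rw [hh]; positivity
  have hτ0 : 0 < τ := by rw [hτ]; positivity
  have hMh : M * h = b - a := by rw [hh]; field_simp
  have hNτ : N * τ = T := by rw [hτ]; field_simp
  have htI : ∀ k ≤ N, (k : ℝ) * τ ∈ Set.Icc 0 T := fun k hk => by
    have : (k : ℝ) ≤ N := by exact_mod_cast hk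
    exact ⟨by positivity, by rw [← hNτ]; gcongr⟩
  have hlin : ∀ (k j : ℕ), spatialOp α d1 d2 dα h M (fun i => u (a + i * h) (k * τ) - U k i) j
      = spatialOp α d1 d2 dα h M (fun i => u (a + i * h) (k * τ)) j
        - spatialOp α d1 d2 dα h M (U k) j := by
    intro k j
    have := spatialOp_linear α d1 d2 dα h M (-1) (fun i => u (a + i * h) (k * τ)) (U k) j
    simpa only [neg_one_mul, ← sub_eq_add_neg] using this
  -- The error solves the scheme with the truncation error as residual and zero initial values.
  have hE := energy_estimate (d1 := d1) (A := C * (τ ^ 2 + h ^ 2) * S)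
    (e := fun k j => u (a + j * h) (k * τ) - U k j)
    (R := fun k j => 2 / τ * (u (a + j * h) ((k + 1 : ℕ) * τ) - u (a + j * h) (k * τ))
          - (spatialOp α d1 d2 dα h M (fun i => u (a + i * h) ((k + 1 : ℕ) * τ)) j
            + spatialOp α d1 d2 dα h M (fun i => u (a + i * h) (k * τ)) j)
          - 2 * s (a + j * h) ((k + 1 / 2) * τ)) h0 h1 hd2 hdα hh0 hτ0 hM
    (fun k hk => by
      simp [hU.boundary_left k hk, hu.boundary_left _ (htI k hk)])
    (fun k hk => by
      rw [hMh, add_sub_cancel, hU.boundary_right k hk, hu.boundary_right _ (htI k hk), sub_zero])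
    (fun k hk j hj => by
      have hj := mem_Ioo.1 hj
      have a1 := (step_iff _ _ _ _).1 (hU.step k hk j hj.1 hj.2)
      simp only [hlin]
      linarith)
    (fun k hk => by
      have := mul_sum_rpow_neg_le h0 h1 hh0 M
      rw [hMh, ← hS] at this
      calc h * _ ≤ h * ∑ j ∈ Ioo 0 M, C * (τ ^ 2 + h ^ 2)
            * ((j * h) ^ (-α) + ((M - j : ℕ) * h) ^ (-α)) := by
            gcongr with j hj
            exact hR M N hM hN h τ hh hτ k hk j hj
        _ = C * (τ ^ 2 + h ^ 2)
            * (h * ∑ j ∈ Ioo 0 M, ((j * h) ^ (-α) + ((M - j : ℕ) * h) ^ (-α))) := by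
            rw [← mul_sum]
            ring
        _ ≤ _ := by gcongr) k hk
  have e0 : ∑ j ∈ Ioo 0 M, (u (a + j * h) ((0 : ℕ) * τ) - U 0 j) ^ 2 = 0 := by
    refine sum_eq_zero fun j hj => ?_
    obtain ⟨hj0, hjM⟩ := mem_Ioo.1 hj
    have hjr : (j : ℝ) ≤ M := by exact_mod_cast hjM.le
    have hx : a + j * h ∈ Set.Icc a b :=
      ⟨by have : 0 ≤ (j : ℝ) * h := by positivity
          linarith, by nlinarith⟩
    rw [hU.initial j hj0 hjM, Nat.cast_zero, zero_mul, hu.initial _ hx]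
    ring
  rw [e0, mul_zero, zero_add, hMh] at hE
  have hkT := (htI k hk).2
  have hS0 : 0 ≤ S := by positivity
  rw [discreteL2]
  refine Real.sqrt_le_iff.2 ⟨by positivity, hE.trans ?_⟩
  have hsq : Real.sqrt (T * (b - a) / (8 * d2)) ^ 2 = T * (b - a) / (8 * d2) :=
    Real.sq_sqrt (by positivity)
  calc _ ≤ T * ((C * (τ ^ 2 + h ^ 2) * S) ^ 2 * (b - a) / (8 * d2)) := by gcongr
    _ = T * (b - a) / (8 * d2) * (C * S * (τ ^ 2 + h ^ 2)) ^ 2 := by ring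
    _ = _ := by rw [mul_assoc (Real.sqrt _), mul_pow (Real.sqrt _), hsq]

end TurbulentDiffusion

theorem mainTheorem3 (α d1 d2 dα a b T : ℝ) (hα0 : 0 < α) (hα1 : α < 1)
    (hd1 : 0 < d1) (hd2 : 0 < d2) (hdα : 0 < dα) (hab : a < b) (hT : 0 < T) :
    -- unconditional stability
    (∀ h τ : ℝ, 0 < h → 0 < τ → TurbulentDiffusion.IsVonNeumannStable α d1 d2 dα h τ) ∧
    (∀ M N : ℕ, 0 < M → 0 < N →
      TurbulentDiffusion.IsUniquelySolvable α d1 d2 dα ((b - a) / M) (T / N) M N ∧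
      TurbulentDiffusion.IsL2Stable α d1 d2 dα ((b - a) / M) (T / N) M N) ∧
    -- convergence of second order in time and in space
    (∀ (φ : ℝ → ℝ) (s u : ℝ → ℝ → ℝ),
      TurbulentDiffusion.IsSolution α d1 d2 dα a b T φ s u →
      ContDiffOn ℝ 4 (fun p : ℝ × ℝ => u p.1 p.2) (Set.Icc a b ×ˢ Set.Icc 0 T) →
      (∀ t ∈ Set.Icc 0 T, derivWithin (fun x => u x t) (Set.Icc a b) a = 0) →
      (∀ t ∈ Set.Icc 0 T, derivWithin (fun x => u x t) (Set.Icc a b) b = 0) →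
      ∃ C : ℝ, ∀ M N : ℕ, 0 < M → 0 < N → ∀ h τ : ℝ, h = (b - a) / M → τ = T / N →
        ∀ U : ℕ → ℕ → ℝ,
          TurbulentDiffusion.IsSchemeSolution α d1 d2 dα h τ M N
            (fun j => φ (a + j * h)) (fun k j => s (a + j * h) ((k + 1 / 2) * τ)) U →
          ∀ k : ℕ, k ≤ N →
            TurbulentDiffusion.discreteL2 h M (fun j => u (a + j * h) (k * τ) - U k j)
              ≤ C * (τ ^ 2 + h ^ 2)) := by
  refine ⟨fun h τ hh hτ => TurbulentDiffusion.isVonNeumannStable hα0 hα1 hd2 hdα hh hτ,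
    fun M N hM hN => ?_, fun φ s u hu hreg hua hub =>
      TurbulentDiffusion.exists_convergence_bound hα0 hα1 hd1 hd2 hdα hab hT hu hreg hua hub⟩
  have hM' : (0 : ℝ) < M := by exact_mod_cast hM
  have hN' : (0 : ℝ) < N := by exact_mod_cast hN
  have hh : 0 < (b - a) / M := div_pos (by linarith) hM'
  have hτ : 0 < T / N := by positivity
  exact ⟨TurbulentDiffusion.isUniquelySolvable hα0 hα1 hd2 hdα hh hτ hM N,
    TurbulentDiffusion.isL2Stable hα0 hα1 hd2 hdα hh hτ hM N⟩
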